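/- Let $K$ be a field, and consider symmetric operads in $K$-vector spaces which are finitely generated, binary and quadratic. Such an operad $\mathcal O$ is given by its space $E$ of generating binary operations, with the involution $\mu\mapsto\mu^{op}$, and by an $S_3$-submodule of relations in the arity-three part $T(E)(3)$ of the free operad on $E$. Anticommutative means $[x,y]=-[y,x]$ and commutative means $xy=yx$. Notation. $\mathcal{M}ag_{p,q,r}$ is the operad generated by $p$ nonsymmetric, $q$ commutative and $r$ anticommutative operations, without relations. $\mathcal{A}ss$, $\mathcal{C}om$, $\mathcal{L}ie$, $\mathcal{P}ois$ are the operads of associative, of commutative associative, of Lie and of (commutative) Poisson algebras. The following are generated by nonsymmetric operations with the given relations: * $pre\mathcal{L}ie$: $(xy)z-x(yz)=(xz)y-x(zy)$; * $\mathcal{P}erm$: $(xy)z=x(yz)=x(zy)$; * $\mathcal{L}eib$: $(xy)z=x(yz)+(xz)y$; * $\mathcal{Z}inb$: $(xy)z=x(yz)+x(zy)$; * $\mathcal{D}end$: $(x\prec y)\prec z=x\prec(y\prec z+y\succ z)$, $(x\succ y)\prec z=x\succ(y\prec z)$, $(x\prec y+x\succ y)\succ z=x\succ(y\succ z)$. An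 $(\mathcal O+\mathcal P)$-algebra is a vector space with an $\mathcal O$-algebra and a $\mathcal P$-algebra structure, without further relations. Let $C^*(\Delta_1;V)=C^*(\Delta_1;K)\otimes V$ be the non-degenerate cochains on the $1$-simplex with values in $V$, and $\cup$ the cup product on $C^*(\Delta_1;K)$. For an operad $\mathcal O$, the operad $\mathrm{Ass}_\circ(\mathcal O)$ is generated by the nonsymmetric operations $\cup\otimes\mu$, for $\mu$ in a basis of the generating operations of $\mathcal O$ (a nonsymmetric generator $\cdot$ gives two of them, $\prec=\cup\otimes\cdot$ and $\succ=\cup\otimes\cdot^{op}$), with all the ternary relations which hold for these operations on $C^*(\Delta_1;V)$ for every $\mathcal O$-algebra $V$. The operad $\mathrm{Lie}_\circ(\mathcal O)$ is generated by the operations $(\cup-\cup^{op})\otimes\mu$, with all the ternary relations which hold for these operations on $C^*(\Delta_1;V)$ for every $\mathcal O$-algebra $V$; thus nonsymmetric generators of $\mathcal O$ give nonsymmetric ones, commutative generators give anticommutative ones, and anticommutative generators give commutative ones. The Manin white product $\mathcal O\circ\mathcal P$ is the binary quadratic operad generated by $\mathcal O(2)\otimes\mathcal P(2)$ whose relations are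 the elements of the kernel of the canonical map from the arity-three part of the free operad on $\mathcal O(2)\otimes\mathcal P(2)$ to $\mathcal O(3)\otimes\mathcal P(3)$. Theorem. There are isomorphisms of operads, compatible with the evident generating operations: 1. $\mathrm{Lie}_\circ(\mathcal{Z}inb)=pre\mathcal{L}ie$, with $(\cup-\cup^{op})\otimes\cdot$ corresponding to the pre-Lie product, and $\mathrm{Ass}_\circ(\mathcal{Z}inb)=\mathcal{D}end$, with $\cup\otimes\cdot$ corresponding to $\prec$ and $\cup\otimes\cdot^{op}$ to $\succ$. 2. $\mathrm{Lie}_\circ(\mathcal{A}ss)=\mathrm{Lie}_\circ(pre\mathcal{L}ie)=\mathcal{M}ag_{1,0,0}$, $\mathrm{Lie}_\circ(\mathcal{L}ie)=\mathcal{M}ag_{0,1,0}$ and $\mathrm{Lie}_\circ(\mathcal{P}erm)=\mathcal{L}eib$. 3. If the characteristic of $K$ is not $2$, $\mathrm{Lie}_\circ(\mathcal{P}ois)=\mathcal{L}ie+\mathcal{M}ag_{0,1,0}$, where the Lie bracket comes from the commutative product and the magmatic commutative operation from the Poisson bracket. 4. The top row of Chapoton's square is the Manin white product of its middle row with $\mathcal{Z}inb$: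 let $\mathcal{L}ie\to\mathcal{A}ss\to\mathcal{C}om$ be the morphisms $[-,-]\mapsto\cup-\cup^{op}$ and $\cup\mapsto\bullet$, and let $pre\mathcal{L}ie\to\mathcal{D}end\to\mathcal{Z}inb$ be the morphisms $\cdot\mapsto\prec-\succ^{op}$ and $\prec\mapsto\cdot$, $\succ\mapsto\cdot^{op}$. There are isomorphisms $\mathcal{L}ie\circ\mathcal{Z}inb\cong pre\mathcal{L}ie$ with $[-,-]\otimes\cdot\mapsto\cdot$, $\mathcal{A}ss\circ\mathcal{Z}inb\cong\mathcal{D}end$ with $\cup\otimes\cdot\mapsto\prec$ and $\cup\otimes\cdot^{op}\mapsto\succ$, and $\mathcal{C}om\circ\mathcal{Z}inb\cong\mathcal{Z}inb$ with $\bullet\otimes\cdot\mapsto\cdot$, which identify the row $\mathcal{L}ie\circ\mathcal{Z}inb\to\mathcal{A}ss\circ\mathcal{Z}inb\to\mathcal{C}om\circ\mathcal{Z}inb$ induced by the first row with the second row. -/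

import Mathlib

open scoped TensorProduct

universe u v w

/-! # Symmetric operads in vector spaces -/

namespace Operads

/-- `A ⊔ (B ⊔ {∗}) ≃ (A ⊔ B) ⊔ {∗}`. -/
def seqEquiv (A B : Type) : A ⊕ Option B ≃ Option (A ⊕ B) where
  toFun
    | .inl a => some (.inl a)
    | .inr none => none
    | .inr (some b) => some (.inr b)
  invFun
    | none => .inr none
    | some (.inl a) => .inl a
    | some (.inr b) => .inr (some b)
  left_inv := by rintro (a | _ | b) <;> rfl
  right_inv := by rintro (_ | a | b) <;> rfl

/-- `(A ⊔ {∗}) ⊔ B ≃ (A ⊔ B) ⊔ {∗}`. -/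
def parEquiv (A B : Type) : Option A ⊕ B ≃ Option (A ⊕ B) where
  toFun
    | .inl none => none
    | .inl (some a) => some (.inl a)
    | .inr b => some (.inr b)
  invFun
    | none => .inl none
    | some (.inl a) => .inl (some a)
    | some (.inr b) => .inr b
  left_inv := by rintro ((_ | a) | b) <;> rfl
  right_inv := by rintro (_ | a | b) <;> rfl

/-- The exchange of the two extra points of `A ⊔ {∗} ⊔ {∗'}`. -/
def optionSwap (A : Type) : Option (Option A) ≃ Option (Option A) where
  toFun
    | none => some none
    | some none => none
    | some (some a) => some (some a)
  invFun
    | none => some none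
    | some none => none
    | some (some a) => some (some a)
  left_inv := by rintro (_ | _ | a) <;> rfl
  right_inv := by rintro (_ | _ | a) <;> rfl

/-- `(A ⊔ C) ⊔ B ≃ (A ⊔ B) ⊔ C`. -/
def sumSwap (A B C : Type) : (A ⊕ C) ⊕ B ≃ (A ⊕ B) ⊕ C where
  toFun
    | .inl (.inl a) => .inl (.inl a)
    | .inl (.inr c) => .inr c
    | .inr b => .inl (.inr b)
  invFun
    | .inl (.inl a) => .inl (.inl a)
    | .inl (.inr b) => .inr b
    | .inr c => .inl (.inr c)
  left_inv := by rintro ((a | c) | b) <;> rfl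
  right_inv := by rintro ((a | b) | c) <;> rfl

/-- `{∗} ≃ ∅ ⊔ {∗}`. -/
def unitEquiv : Unit ≃ Option Empty where
  toFun _ := none
  invFun _ := ()
  left_inv _ := rfl
  right_inv := by rintro (_ | a) <;> [rfl; exact a.elim]

/-- The two inputs of a binary operation, the first one being marked. -/
def firstEquiv : Fin 2 ≃ Option Unit where
  toFun i := if i = 0 then none else some ()
  invFun o := if o = none then 0 else 1
  left_inv := by decide
  right_inv := by decide

/-- The labelling of the inputs of `(- ν -) μ -` by `k + 1, k + 2, k` (modulo 3). -/
def treeEquiv (k : Fin 3) : Unit ⊕ Fin 2 ≃ Fin 3 where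
  toFun
    | .inl _ => k
    | .inr 0 => k + 1
    | .inr 1 => k + 2
  invFun i := if i = k then .inl () else if i = k + 1 then .inr 0 else .inr 1
  left_inv := by revert k; decide
  right_inv := by revert k; decide

/-- A symmetric operad in `K`-vector spaces, in terms of partial compositions, with the inputs of
the operations labelled by finite sets: `comp p q` is the insertion of `q` in the marked
input `none` of `p`. -/
structure SymOperad (K : Type u) [Field K] where
  obj : (X : Type) → [Finite X] → Type v
  [grp : ∀ (X : Type) [Finite X], AddCommGroup (obj X)]
  [mod : ∀ (X : Type) [Finite X], Module K (obj X)]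
  map : ∀ {X Y : Type} [Finite X] [Finite Y], X ≃ Y → obj X →ₗ[K] obj Y
  one : obj Unit
  comp : ∀ {A B : Type} [Finite A] [Finite B], obj (Option A) →ₗ[K] obj B →ₗ[K] obj (A ⊕ B)
  map_refl : ∀ {X : Type} [Finite X] (p : obj X), map (Equiv.refl X) p = p
  map_trans : ∀ {X Y Z : Type} [Finite X] [Finite Y] [Finite Z] (σ : X ≃ Y) (ρ : Y ≃ Z)
    (p : obj X), map (σ.trans ρ) p = map ρ (map σ p)
  comp_map : ∀ {A B A' B' : Type} [Finite A] [Finite B] [Finite A'] [Finite B']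
    (σ : A ≃ A') (ρ : B ≃ B') (p : obj (Option A)) (q : obj B),
    comp (map (Equiv.optionCongr σ) p) (map ρ q) = map (Equiv.sumCongr σ ρ) (comp p q)
  one_comp : ∀ {B : Type} [Finite B] (q : obj B),
    comp (map unitEquiv one) q = map (Equiv.emptySum Empty B).symm q
  comp_one : ∀ {A : Type} [Finite A] (p : obj (Option A)),
    comp p one = map (Equiv.optionEquivSumPUnit A) p
  comp_assoc : ∀ {A B C : Type} [Finite A] [Finite B] [Finite C]
    (p : obj (Option A)) (q : obj (Option B)) (r : obj C),
    comp (map (seqEquiv A B) (comp p q)) r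
      = map (Equiv.sumAssoc A B C).symm (comp p (comp q r))
  comp_comm : ∀ {A B C : Type} [Finite A] [Finite B] [Finite C]
    (p : obj (Option (Option A))) (q : obj B) (r : obj C),
    comp (map (parEquiv A B) (comp p q)) r
      = map (sumSwap A B C) (comp (map (parEquiv A C) (comp (map (optionSwap A) p) r)) q)

attribute [instance] SymOperad.grp SymOperad.mod

/-- Morphisms of operads. -/
structure SymOperad.Hom {K : Type u} [Field K] (P : SymOperad.{u, v} K)
    (Q : SymOperad.{u, w} K) where
  app : (X : Type) → [Finite X] → P.obj X →ₗ[K] Q.obj X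
  app_map : ∀ {X Y : Type} [Finite X] [Finite Y] (σ : X ≃ Y) (p : P.obj X),
    app Y (P.map σ p) = Q.map σ (app X p)
  app_one : app Unit P.one = Q.one
  app_comp : ∀ {A B : Type} [Finite A] [Finite B] (p : P.obj (Option A)) (q : P.obj B),
    app (A ⊕ B) (P.comp p q) = Q.comp (app (Option A) p) (app B q)

/-- A morphism of operads is an isomorphism if all its components are bijective. -/
def SymOperad.Hom.IsIso {K : Type u} [Field K] {P : SymOperad.{u, v} K} {Q : SymOperad.{u, w} K}
    (f : SymOperad.Hom P Q) : Prop :=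
  ∀ (X : Type) [Finite X], Function.Bijective (f.app X)

/-! # Binary quadratic operads -/

/-- The arity three component of the free operad on a space `E` of binary operations. The
element `μ ⊗ ν` of the summand `k` stands for `(x_{k+1} ν x_{k+2}) μ x_k`, indices modulo 3. -/
abbrev T3 (K : Type u) [Field K] (E : Type u) [AddCommGroup E] [Module K E] : Type u :=
  Fin 3 → E ⊗[K] E

section T3

variable {K : Type u} [Field K] {E : Type u} [AddCommGroup E] [Module K E]
  {F : Type u} [AddCommGroup F] [Module K F] {V : Type v} [AddCommGroup V] [Module K V]

/-- The substitution `x_i ↦ x_{σ i}`. Here `τ` sends an operation to the opposite one: an odd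
permutation reverses the cyclic order, hence exchanges the arguments of the inner operation. -/
noncomputable def T3.perm (τ : E →ₗ[K] E) (σ : Equiv.Perm (Fin 3)) : T3 K E →ₗ[K] T3 K E :=
  LinearMap.pi fun k =>
    (if Equiv.Perm.sign σ = 1 then LinearMap.id else TensorProduct.map LinearMap.id τ) ∘ₗ
      LinearMap.proj (σ⁻¹ k)

/-- The map induced by a linear map of operations. -/
noncomputable def T3.map (f : E →ₗ[K] F) : T3 K E →ₗ[K] T3 K F :=
  LinearMap.pi fun k => TensorProduct.map f f ∘ₗ LinearMap.proj k

/-- The map `μ ⊗ ν ↦ (a ν b) μ c`. -/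
noncomputable def T3.evalAt (op : E →ₗ[K] V →ₗ[K] V →ₗ[K] V) (a b c : V) : E ⊗[K] E →ₗ[K] V :=
  TensorProduct.lift
    (LinearMap.mk₂ K (fun μ ν => op μ (op ν a b) c)
      (by intros; simp) (by intros; simp) (by intros; simp) (by intros; simp))

/-- The value of a ternary operation at `x_0, x_1, x_2`. -/
noncomputable def T3.eval (op : E →ₗ[K] V →ₗ[K] V →ₗ[K] V) (x : Fin 3 → V) : T3 K E →ₗ[K] V :=
  ∑ k : Fin 3, T3.evalAt op (x (k + 1)) (x (k + 2)) (x k) ∘ₗ LinearMap.proj k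

/-- The monomial `(x_a ν x_b) μ x_c`, for distinct `a, b, c`. -/
noncomputable def T3.monL (τ : E →ₗ[K] E) (μ ν : E) (a b c : Fin 3) : T3 K E :=
  Pi.single c (if b = a + 1 then μ ⊗ₜ ν else μ ⊗ₜ τ ν)

/-- The monomial `x_a μ (x_b ν x_c)`, for distinct `a, b, c`. -/
noncomputable def T3.monR (τ : E →ₗ[K] E) (μ ν : E) (a b c : Fin 3) : T3 K E :=
  T3.monL τ (τ μ) ν b c a

theorem T3.perm_mul (τ : E →ₗ[K] E) (h : ∀ e, τ (τ e) = e) (σ ρ : Equiv.Perm (Fin 3))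
    (t : T3 K E) : T3.perm τ (σ * ρ) t = T3.perm τ σ (T3.perm τ ρ t) := by
  have h2 : (TensorProduct.map (LinearMap.id : E →ₗ[K] E) τ) ∘ₗ
      (TensorProduct.map (LinearMap.id : E →ₗ[K] E) τ) = LinearMap.id := by
    rw [← TensorProduct.map_comp]
    have : τ ∘ₗ τ = LinearMap.id := by ext e; simp [h]
    rw [this]; simp
  funext k
  have h3 : ∀ z, TensorProduct.map (LinearMap.id : E →ₗ[K] E) τ
      (TensorProduct.map (LinearMap.id : E →ₗ[K] E) τ z) = z := fun z => LinearMap.congr_fun h2 z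
  rcases Int.units_eq_one_or (Equiv.Perm.sign σ) with h1 | h1 <;>
  rcases Int.units_eq_one_or (Equiv.Perm.sign ρ) with h1' | h1' <;>
  simp [T3.perm, h1, h1', h3]

theorem T3.evalAt_swap (τ : E →ₗ[K] E) (op : E →ₗ[K] V →ₗ[K] V →ₗ[K] V)
    (h : ∀ e x y, op (τ e) x y = op e y x) (a b c : V) (z : E ⊗[K] E) :
    T3.evalAt op a b c (TensorProduct.map LinearMap.id τ z) = T3.evalAt op b a c z := by
  induction z with
  | zero => simp
  | tmul μ ν => simp [T3.evalAt, h]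
  | add y z hy hz => simp [hy, hz]

theorem T3.eval_perm (τ : E →ₗ[K] E) (op : E →ₗ[K] V →ₗ[K] V →ₗ[K] V)
    (h : ∀ e x y, op (τ e) x y = op e y x) (σ : Equiv.Perm (Fin 3)) (x : Fin 3 → V)
    (t : T3 K E) : T3.eval op x (T3.perm τ σ t) = T3.eval op (x ∘ σ) t := by
  have h1 : ∀ σ : Equiv.Perm (Fin 3), Equiv.Perm.sign σ = 1 → ∀ k,
      σ (k + 1) = σ k + 1 ∧ σ (k + 2) = σ k + 2 := by decide
  have h2 : ∀ σ : Equiv.Perm (Fin 3), Equiv.Perm.sign σ = -1 → ∀ k,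
      σ (k + 1) = σ k + 2 ∧ σ (k + 2) = σ k + 1 := by decide
  simp only [T3.eval, LinearMap.sum_apply, LinearMap.comp_apply, LinearMap.proj_apply,
    Function.comp_apply]
  rw [← Equiv.sum_comp σ]
  refine Finset.sum_congr rfl fun k _ => ?_
  rcases Int.units_eq_one_or (Equiv.Perm.sign σ) with hs | hs
  · obtain ⟨ha, hb⟩ := h1 σ hs k
    simp [T3.perm, hs, ha, hb]
  · obtain ⟨ha, hb⟩ := h2 σ hs k
    simp [T3.perm, hs, ha, hb, T3.evalAt_swap τ op h]

theorem T3.map_perm (τ : E →ₗ[K] E) (τ' : F →ₗ[K] F) (f : E →ₗ[K] F)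
    (h : ∀ e, f (τ e) = τ' (f e)) (σ : Equiv.Perm (Fin 3)) (t : T3 K E) :
    T3.map f (T3.perm τ σ t) = T3.perm τ' σ (T3.map f t) := by
  have h2 : TensorProduct.map f f ∘ₗ TensorProduct.map LinearMap.id τ
      = TensorProduct.map LinearMap.id τ' ∘ₗ TensorProduct.map f f := by
    ext a b; simp [h]
  have h3 : ∀ z, TensorProduct.map f f (TensorProduct.map LinearMap.id τ z)
      = TensorProduct.map LinearMap.id τ' (TensorProduct.map f f z) :=
    fun z => LinearMap.congr_fun h2 z
  funext k
  rcases Int.units_eq_one_or (Equiv.Perm.sign σ) with hs | hs <;> simp [T3.map, T3.perm, hs, h3]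

end T3

/-- A finitely generated binary quadratic operad over `K`, given by its generating operations and
its relations. `E` is the `S_2`-module of generating operations: `τ e` is the operation opposite
to `e`. The relations are an `S_3`-submodule of the ternary part of the free operad on `E`. -/
structure BinQuad (K : Type u) [Field K] where
  E : Type u
  [grp : AddCommGroup E]
  [mod : Module K E]
  [fin : Module.Finite K E]
  τ : E →ₗ[K] E
  τ_τ : ∀ e, τ (τ e) = e
  rel : Submodule K (T3 K E)
  rel_perm : ∀ (σ : Equiv.Perm (Fin 3)) (r : T3 K E), r ∈ rel → T3.perm τ σ r ∈ rel

attribute [instance] BinQuad.grp BinQuad.mod BinQuad.fin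

/-- An algebra over a binary quadratic operad. -/
structure BinQuad.Alg {K : Type u} [Field K] (O : BinQuad K) (V : Type u) [AddCommGroup V]
    [Module K V] where
  op : O.E →ₗ[K] V →ₗ[K] V →ₗ[K] V
  op_τ : ∀ e x y, op (O.τ e) x y = op e y x
  sat : ∀ r ∈ O.rel, ∀ x : Fin 3 → V, T3.eval op x r = 0

/-! ## The operad presented by generators and relations

Formal composites of generating operations, modulo the smallest equivalence relation which makes
them an operad, is compatible with the structure of `E`, and kills the relations. -/

/-- Formal composites of generating operations, with inputs labelled by a set. -/
inductive Pre {K : Type u} [Field K] (O : BinQuad K) : Type → Type (max 1 u)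
  | gen (e : O.E) : Pre O (Fin 2)
  | one : Pre O Unit
  | ren {X Y : Type} (σ : X ≃ Y) (p : Pre O X) : Pre O Y
  | comp {A B : Type} (p : Pre O (Option A)) (q : Pre O B) : Pre O (A ⊕ B)
  | zero {X : Type} : Pre O X
  | plus {X : Type} (p q : Pre O X) : Pre O X
  | smul {X : Type} (c : K) (p : Pre O X) : Pre O X

section Pre

variable {K : Type u} [Field K] {O : BinQuad K}

/-- The formal composite `(x_{k+1} ν x_{k+2}) μ x_k`. -/
def Pre.tree (O : BinQuad K) (k : Fin 3) (μ ν : O.E) : Pre O (Fin 3) :=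
  .ren (treeEquiv k) (.comp (.ren firstEquiv (.gen μ)) (.gen ν))

/-- The equivalence relation on formal composites. -/
inductive Pre.Rel (O : BinQuad K) : ∀ {X : Type}, Pre O X → Pre O X → Prop
  | refl {X : Type} (p : Pre O X) : Rel O p p
  | symm {X : Type} {p q : Pre O X} : Rel O p q → Rel O q p
  | trans {X : Type} {p q r : Pre O X} : Rel O p q → Rel O q r → Rel O p r
  -- compatibility with the operations
  | congr_ren {X Y : Type} (σ : X ≃ Y) {p q : Pre O X} :
      Rel O p q → Rel O (.ren σ p) (.ren σ q)
  | congr_comp {A B : Type} {p p' : Pre O (Option A)} {q q' : Pre O B} :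
      Rel O p p' → Rel O q q' → Rel O (.comp p q) (.comp p' q')
  | congr_plus {X : Type} {p p' q q' : Pre O X} :
      Rel O p p' → Rel O q q' → Rel O (.plus p q) (.plus p' q')
  | congr_smul {X : Type} (c : K) {p q : Pre O X} :
      Rel O p q → Rel O (.smul c p) (.smul c q)
  -- vector space axioms
  | plus_assoc {X : Type} (p q r : Pre O X) :
      Rel O (.plus (.plus p q) r) (.plus p (.plus q r))
  | plus_comm {X : Type} (p q : Pre O X) : Rel O (.plus p q) (.plus q p)
  | zero_plus {X : Type} (p : Pre O X) : Rel O (.plus .zero p) p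
  | neg_plus {X : Type} (p : Pre O X) : Rel O (.plus (.smul (-1) p) p) .zero
  | smul_plus {X : Type} (c : K) (p q : Pre O X) :
      Rel O (.smul c (.plus p q)) (.plus (.smul c p) (.smul c q))
  | plus_smul {X : Type} (c d : K) (p : Pre O X) :
      Rel O (.smul (c + d) p) (.plus (.smul c p) (.smul d p))
  | mul_smul {X : Type} (c d : K) (p : Pre O X) :
      Rel O (.smul (c * d) p) (.smul c (.smul d p))
  | one_smul {X : Type} (p : Pre O X) : Rel O (.smul 1 p) p
  -- linearity
  | ren_plus {X Y : Type} (σ : X ≃ Y) (p q : Pre O X) :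
      Rel O (.ren σ (.plus p q)) (.plus (.ren σ p) (.ren σ q))
  | ren_smul {X Y : Type} (σ : X ≃ Y) (c : K) (p : Pre O X) :
      Rel O (.ren σ (.smul c p)) (.smul c (.ren σ p))
  | plus_comp {A B : Type} (p p' : Pre O (Option A)) (q : Pre O B) :
      Rel O (.comp (.plus p p') q) (.plus (.comp p q) (.comp p' q))
  | smul_comp {A B : Type} (c : K) (p : Pre O (Option A)) (q : Pre O B) :
      Rel O (.comp (.smul c p) q) (.smul c (.comp p q))
  | comp_plus {A B : Type} (p : Pre O (Option A)) (q q' : Pre O B) :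
      Rel O (.comp p (.plus q q')) (.plus (.comp p q) (.comp p q'))
  | comp_smul {A B : Type} (c : K) (p : Pre O (Option A)) (q : Pre O B) :
      Rel O (.comp p (.smul c q)) (.smul c (.comp p q))
  -- operad axioms
  | ren_refl {X : Type} (p : Pre O X) : Rel O (.ren (Equiv.refl X) p) p
  | ren_trans {X Y Z : Type} (σ : X ≃ Y) (ρ : Y ≃ Z) (p : Pre O X) :
      Rel O (.ren (σ.trans ρ) p) (.ren ρ (.ren σ p))
  | comp_ren {A B A' B' : Type} (σ : A ≃ A') (ρ : B ≃ B') (p : Pre O (Option A)) (q : Pre O B) :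
      Rel O (.comp (.ren (Equiv.optionCongr σ) p) (.ren ρ q))
        (.ren (Equiv.sumCongr σ ρ) (.comp p q))
  | one_comp {B : Type} (q : Pre O B) :
      Rel O (.comp (.ren unitEquiv .one) q) (.ren (Equiv.emptySum Empty B).symm q)
  | comp_one {A : Type} (p : Pre O (Option A)) :
      Rel O (.comp p .one) (.ren (Equiv.optionEquivSumPUnit A) p)
  | comp_assoc {A B C : Type} (p : Pre O (Option A)) (q : Pre O (Option B)) (r : Pre O C) :
      Rel O (.comp (.ren (seqEquiv A B) (.comp p q)) r)
        (.ren (Equiv.sumAssoc A B C).symm (.comp p (.comp q r)))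
  | comp_comm {A B C : Type} (p : Pre O (Option (Option A))) (q : Pre O B) (r : Pre O C) :
      Rel O (.comp (.ren (parEquiv A B) (.comp p q)) r)
        (.ren (sumSwap A B C)
          (.comp (.ren (parEquiv A C) (.comp (.ren (optionSwap A) p) r)) q))
  -- the structure of the space of generators
  | gen_plus (e e' : O.E) : Rel O (.gen (e + e')) (.plus (.gen e) (.gen e'))
  | gen_smul (c : K) (e : O.E) : Rel O (.gen (c • e)) (.smul c (.gen e))
  | gen_τ (e : O.E) : Rel O (.gen (O.τ e)) (.ren (Equiv.swap 0 1) (.gen e))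
  -- the quadratic relations
  | quad (l : List (Fin 3 × O.E × O.E))
      (h : (l.map fun a => (Pi.single a.1 (a.2.1 ⊗ₜ[K] a.2.2) : T3 K O.E)).sum ∈ O.rel) :
      Rel O (l.foldr (fun a p => .plus (Pre.tree O a.1 a.2.1 a.2.2) p) .zero) .zero

/-- The setoid of the relation above. -/
def Pre.setoid (O : BinQuad K) (X : Type) : Setoid (Pre O X) where
  r := Pre.Rel O
  iseqv := ⟨.refl, .symm, .trans⟩

/-- The operations with inputs labelled by `X` of the operad presented by `O`. -/
def BinQuad.Obj (O : BinQuad K) (X : Type) : Type (max 1 u) := Quotient (Pre.setoid O X)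

instance BinQuad.instAdd (X : Type) : Add (O.Obj X) :=
  ⟨Quotient.map₂ .plus fun _ _ h _ _ h' => .congr_plus h h'⟩

instance BinQuad.instZero (X : Type) : Zero (O.Obj X) := ⟨Quotient.mk _ .zero⟩

instance BinQuad.instNeg (X : Type) : Neg (O.Obj X) :=
  ⟨Quotient.map (.smul (-1)) fun _ _ h => .congr_smul _ h⟩

instance BinQuad.instSMul (X : Type) : SMul K (O.Obj X) :=
  ⟨fun c => Quotient.map (.smul c) fun _ _ h => .congr_smul c h⟩

instance BinQuad.instGroup (X : Type) : AddCommGroup (O.Obj X) where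
  nsmul := nsmulRec
  zsmul := zsmulRec
  add_assoc := by rintro ⟨p⟩ ⟨q⟩ ⟨r⟩; exact Quotient.sound (.plus_assoc p q r)
  add_comm := by rintro ⟨p⟩ ⟨q⟩; exact Quotient.sound (.plus_comm p q)
  zero_add := by rintro ⟨p⟩; exact Quotient.sound (.zero_plus p)
  add_zero := by
    rintro ⟨p⟩; exact Quotient.sound (.trans (.plus_comm p .zero) (.zero_plus p))
  neg_add_cancel := by rintro ⟨p⟩; exact Quotient.sound (.neg_plus p)

instance BinQuad.instModule (X : Type) : Module K (O.Obj X) :=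
  Module.ofMinimalAxioms
    (by rintro c ⟨p⟩ ⟨q⟩; exact Quotient.sound (Pre.Rel.smul_plus c p q))
    (by rintro c d ⟨p⟩; exact Quotient.sound (Pre.Rel.plus_smul c d p))
    (by rintro c d ⟨p⟩; exact Quotient.sound (Pre.Rel.mul_smul c d p))
    (by rintro ⟨p⟩; exact Quotient.sound (Pre.Rel.one_smul p))

/-- The operad presented by `O`. -/
def BinQuad.operad (O : BinQuad K) : SymOperad.{u, max 1 u} K where
  obj X _ := O.Obj X
  map σ :=
    { toFun := Quotient.map (.ren σ) fun _ _ h => .congr_ren σ h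
      map_add' := by rintro ⟨p⟩ ⟨q⟩; exact Quotient.sound (.ren_plus σ p q)
      map_smul' := by rintro c ⟨p⟩; exact Quotient.sound (Pre.Rel.ren_smul σ c p) }
  one := Quotient.mk _ .one
  comp := LinearMap.mk₂ K
    (Quotient.map₂ .comp fun _ _ h _ _ h' => .congr_comp h h')
    (by rintro ⟨p⟩ ⟨p'⟩ ⟨q⟩; exact Quotient.sound (.plus_comp p p' q))
    (by rintro c ⟨p⟩ ⟨q⟩; exact Quotient.sound (Pre.Rel.smul_comp c p q))
    (by rintro ⟨p⟩ ⟨q⟩ ⟨q'⟩; exact Quotient.sound (.comp_plus p q q'))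
    (by rintro c ⟨p⟩ ⟨q⟩; exact Quotient.sound (Pre.Rel.comp_smul c p q))
  map_refl := by rintro X _ ⟨p⟩; exact Quotient.sound (.ren_refl p)
  map_trans := by rintro X Y Z _ _ _ σ ρ ⟨p⟩; exact Quotient.sound (.ren_trans σ ρ p)
  comp_map := by
    rintro A B A' B' _ _ _ _ σ ρ ⟨p⟩ ⟨q⟩; exact Quotient.sound (.comp_ren σ ρ p q)
  one_comp := by rintro B _ ⟨q⟩; exact Quotient.sound (.one_comp q)
  comp_one := by rintro A _ ⟨p⟩; exact Quotient.sound (.comp_one p)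
  comp_assoc := by
    rintro A B C _ _ _ ⟨p⟩ ⟨q⟩ ⟨r⟩; exact Quotient.sound (.comp_assoc p q r)
  comp_comm := by
    rintro A B C _ _ _ ⟨p⟩ ⟨q⟩ ⟨r⟩; exact Quotient.sound (.comp_comm p q r)

/-- The generating operations, as elements of arity two of the operad presented by `O`. -/
def BinQuad.gen (O : BinQuad K) : O.E →ₗ[K] O.operad.obj (Fin 2) where
  toFun e := (Quotient.mk _ (.gen e) : O.Obj (Fin 2))
  map_add' e e' := Quotient.sound (.gen_plus e e')
  map_smul' c e := Quotient.sound (Pre.Rel.gen_smul c e)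

/-- `O` and `P` are isomorphic operads, by an isomorphism which sends the generating operation `a`
to the generating operation `b`, for all pairs `(a, b)` in `s`. -/
def BinQuad.IsoWith (O P : BinQuad K) (s : Set (O.E × P.E)) : Prop :=
  ∃ f : SymOperad.Hom O.operad P.operad, f.IsIso ∧
    ∀ ab ∈ s, f.app (Fin 2) (O.gen ab.1) = P.gen ab.2

end Pre

/-! ## Operads given by nonsymmetric, commutative and anticommutative operations -/

section Examples

variable (K : Type u) [Field K] (p q r : ℕ)

/-- The operations spanned by `p` nonsymmetric operations and their opposites, `q` commutative
operations and `r` anticommutative operations. -/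
abbrev Gens : Type u := (Fin p → K × K) × (Fin q → K) × (Fin r → K)

/-- The passage to the opposite operation. -/
def Gens.op : Gens K p q r →ₗ[K] Gens K p q r where
  toFun e := (fun i => (e.1 i).swap, e.2.1, -e.2.2)
  map_add' e e' := by ext <;> simp [add_comm]
  map_smul' c e := by ext <;> simp

variable {p q r}

/-- The `i`-th nonsymmetric operation. -/
def dot (i : Fin p) : Gens K p q r := (Pi.single i (1, 0), 0, 0)

/-- The `j`-th commutative operation. -/
def com (j : Fin q) : Gens K p q r := (0, Pi.single j 1, 0)

/-- The `k`-th anticommutative operation. -/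
def ant (k : Fin r) : Gens K p q r := (0, 0, Pi.single k 1)

variable (p q r)

/-- The operad generated by `p` nonsymmetric, `q` commutative and `r` anticommutative operations,
with the relations generated by `s` (under linear combinations and permutations of variables). -/
def ofRel (s : Set (T3 K (Gens K p q r))) : BinQuad K where
  E := Gens K p q r
  τ := Gens.op K p q r
  τ_τ e := by ext <;> simp [Gens.op]
  rel := Submodule.span K {t | ∃ σ : Equiv.Perm (Fin 3), ∃ a ∈ s, T3.perm (Gens.op K p q r) σ a = t}
  rel_perm σ t ht := by
    induction ht using Submodule.span_induction with
    | mem x hx =>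
      obtain ⟨ρ, a, ha, rfl⟩ := hx
      exact Submodule.subset_span ⟨σ * ρ, a, ha, T3.perm_mul _ (fun e => by
        ext <;> simp [Gens.op]) σ ρ a⟩
    | zero => simp
    | add x y _ _ hx hy => rw [map_add]; exact Submodule.add_mem _ hx hy
    | smul c x _ hx => rw [map_smul]; exact Submodule.smul_mem _ c hx

variable {p q r}

/-- `(x_a ν x_b) μ x_c` -/
local notation "mL" => T3.monL (Gens.op _ _ _ _)

/-- `x_a μ (x_b ν x_c)` -/
local notation "mR" => T3.monR (Gens.op _ _ _ _)

variable (p q r)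

/-- Magmatic operations: no relations. -/
def mag : BinQuad K := ofRel K p q r ∅

/-- Associative algebras: `(x y) z = x (y z)`. -/
noncomputable def ass : BinQuad K := ofRel K 1 0 0
  {mL (dot K 0) (dot K 0) 0 1 2 - mR (dot K 0) (dot K 0) 0 1 2}

/-- Commutative and associative algebras. -/
noncomputable def comm : BinQuad K := ofRel K 0 1 0
  {mL (com K 0) (com K 0) 0 1 2 - mR (com K 0) (com K 0) 0 1 2}

/-- Lie algebras (the bracket is anticommutative): `[[x, y], z] + [[y, z], x] + [[z, x], y] = 0`. -/
noncomputable def lie : BinQuad K := ofRel K 0 0 1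
  {mL (ant K 0) (ant K 0) 0 1 2 + mL (ant K 0) (ant K 0) 1 2 0 + mL (ant K 0) (ant K 0) 2 0 1}

/-- Poisson algebras: a commutative associative product `com 0` and a Lie bracket `ant 0` with
`[x, y z] = [x, y] z + y [x, z]`. -/
noncomputable def pois : BinQuad K := ofRel K 0 1 1
  {mL (com K 0) (com K 0) 0 1 2 - mR (com K 0) (com K 0) 0 1 2,
   mL (ant K 0) (ant K 0) 0 1 2 + mL (ant K 0) (ant K 0) 1 2 0 + mL (ant K 0) (ant K 0) 2 0 1,
   mR (ant K 0) (com K 0) 0 1 2 - mL (com K 0) (ant K 0) 0 1 2 - mR (com K 0) (ant K 0) 1 0 2}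

/-- Right pre-Lie algebras: `(x y) z - x (y z) = (x z) y - x (z y)`. -/
noncomputable def preLie : BinQuad K := ofRel K 1 0 0
  {mL (dot K 0) (dot K 0) 0 1 2 - mR (dot K 0) (dot K 0) 0 1 2
    - mL (dot K 0) (dot K 0) 0 2 1 + mR (dot K 0) (dot K 0) 0 2 1}

/-- Right permutative algebras: `(x y) z = x (y z) = x (z y)`. -/
noncomputable def perm : BinQuad K := ofRel K 1 0 0
  {mL (dot K 0) (dot K 0) 0 1 2 - mR (dot K 0) (dot K 0) 0 1 2,
   mR (dot K 0) (dot K 0) 0 1 2 - mR (dot K 0) (dot K 0) 0 2 1}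

/-- Right Leibniz algebras: `(x y) z = x (y z) + (x z) y`. -/
noncomputable def leib : BinQuad K := ofRel K 1 0 0
  {mL (dot K 0) (dot K 0) 0 1 2 - mR (dot K 0) (dot K 0) 0 1 2 - mL (dot K 0) (dot K 0) 0 2 1}

/-- Right Zinbiel algebras: `(x y) z = x (y z) + x (z y)`. -/
noncomputable def zinb : BinQuad K := ofRel K 1 0 0
  {mL (dot K 0) (dot K 0) 0 1 2 - mR (dot K 0) (dot K 0) 0 1 2 - mR (dot K 0) (dot K 0) 0 2 1}

/-- Dendriform algebras, with `≺` equal to `dot 0` and `≻` equal to `dot 1`: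
`(x ≺ y) ≺ z = x ≺ (y ≺ z + y ≻ z)`, `(x ≻ y) ≺ z = x ≻ (y ≺ z)`,
`(x ≺ y + x ≻ y) ≻ z = x ≻ (y ≻ z)`. -/
noncomputable def dend : BinQuad K := ofRel K 2 0 0
  {mL (dot K 0) (dot K 0) 0 1 2 - mR (dot K 0) (dot K 0) 0 1 2 - mR (dot K 0) (dot K 1) 0 1 2,
   mL (dot K 0) (dot K 1) 0 1 2 - mR (dot K 1) (dot K 0) 0 1 2,
   mL (dot K 1) (dot K 0) 0 1 2 + mL (dot K 1) (dot K 1) 0 1 2 - mR (dot K 1) (dot K 1) 0 1 2}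

end Examples

/-! ## Sums, white products, and the cochain constructions -/

section Constructions

variable {K : Type u} [Field K]

/-- The operad `O + P`: an algebra is an `O`-algebra and a `P`-algebra on the same space, with no
further relations. -/
noncomputable def BinQuad.sum (O P : BinQuad K) : BinQuad K where
  E := O.E × P.E
  τ := O.τ.prodMap P.τ
  τ_τ e := by ext <;> simp [O.τ_τ, P.τ_τ]
  rel := O.rel.map (T3.map (LinearMap.inl K O.E P.E)) ⊔ P.rel.map (T3.map (LinearMap.inr K O.E P.E))
  rel_perm σ t ht := by
    obtain ⟨_, ⟨a, ha, rfl⟩, _, ⟨b, hb, rfl⟩, rfl⟩ := Submodule.mem_sup.mp ht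
    rw [map_add, ← T3.map_perm O.τ _ (LinearMap.inl K O.E P.E) (by intro e; simp),
      ← T3.map_perm P.τ _ (LinearMap.inr K O.E P.E) (by intro e; simp)]
    exact Submodule.add_mem_sup ⟨_, O.rel_perm σ a ha, rfl⟩ ⟨_, P.rel_perm σ b hb, rfl⟩

/-- The canonical map from the ternary part of the free operad on `E ⊗ F` to the tensor product of
the ternary parts of the free operads on `E` and on `F`. -/
noncomputable def T3.split (E F : Type u) [AddCommGroup E] [Module K E] [AddCommGroup F]
    [Module K F] : T3 K (E ⊗[K] F) →ₗ[K] T3 K E ⊗[K] T3 K F :=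
  ∑ k : Fin 3,
    TensorProduct.map (LinearMap.single K (fun _ : Fin 3 => E ⊗[K] E) k)
        (LinearMap.single K (fun _ : Fin 3 => F ⊗[K] F) k) ∘ₗ
      (TensorProduct.tensorTensorTensorComm K E F E F).toLinearMap ∘ₗ LinearMap.proj k

/-- `R ⊗ T(F)(3) + T(E)(3) ⊗ S`. -/
noncomputable def whiteRel {E F : Type u} [AddCommGroup E] [Module K E] [AddCommGroup F]
    [Module K F] (R : Submodule K (T3 K E)) (S : Submodule K (T3 K F)) :
    Submodule K (T3 K E ⊗[K] T3 K F) :=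
  LinearMap.range (TensorProduct.map R.subtype (LinearMap.id : T3 K F →ₗ[K] T3 K F)) ⊔
    LinearMap.range (TensorProduct.map (LinearMap.id : T3 K E →ₗ[K] T3 K E) S.subtype)

theorem whiteRel_map {E F : Type u} [AddCommGroup E] [Module K E] [AddCommGroup F]
    [Module K F] (R : Submodule K (T3 K E)) (S : Submodule K (T3 K F)) (f : T3 K E →ₗ[K] T3 K E)
    (g : T3 K F →ₗ[K] T3 K F) (hf : ∀ r ∈ R, f r ∈ R) (hg : ∀ s ∈ S, g s ∈ S)
    (t : T3 K E ⊗[K] T3 K F) (ht : t ∈ whiteRel R S) :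
    TensorProduct.map f g t ∈ whiteRel R S := by
  obtain ⟨_, ⟨a, rfl⟩, _, ⟨b, rfl⟩, rfl⟩ := Submodule.mem_sup.mp ht
  rw [map_add]
  refine Submodule.add_mem_sup ?_ ?_
  · refine ⟨TensorProduct.map (f.restrict hf) g a, ?_⟩
    rw [← LinearMap.comp_apply, ← LinearMap.comp_apply, ← TensorProduct.map_comp,
      ← TensorProduct.map_comp]
    rfl
  · refine ⟨TensorProduct.map f (g.restrict hg) b, ?_⟩
    rw [← LinearMap.comp_apply, ← LinearMap.comp_apply, ← TensorProduct.map_comp,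
      ← TensorProduct.map_comp]
    rfl

theorem T3.split_perm {E F : Type u} [AddCommGroup E] [Module K E] [AddCommGroup F]
    [Module K F] (τ : E →ₗ[K] E) (τ' : F →ₗ[K] F) (σ : Equiv.Perm (Fin 3))
    (t : T3 K (E ⊗[K] F)) :
    T3.split E F (T3.perm (TensorProduct.map τ τ') σ t)
      = TensorProduct.map (T3.perm τ σ) (T3.perm τ' σ) (T3.split E F t) := by
  have hs : ∀ {G : Type u} [AddCommGroup G] [Module K G] (ρ : G →ₗ[K] G) (k : Fin 3)
      (z : G ⊗[K] G), T3.perm ρ σ (Pi.single k z) = Pi.single (σ k)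
        ((if Equiv.Perm.sign σ = 1 then LinearMap.id else TensorProduct.map LinearMap.id ρ) z) := by
    intro G _ _ ρ k z
    funext i
    by_cases hi : i = σ k
    · subst hi; simp [T3.perm]
    · have : σ⁻¹ i ≠ k := fun h => hi (by rw [← h]; simp)
      simp only [T3.perm, LinearMap.pi_apply, LinearMap.comp_apply, LinearMap.proj_apply,
        Pi.single_eq_of_ne this, Pi.single_eq_of_ne hi, map_zero]
  have hsp : ∀ (k : Fin 3) (a c : E) (b d : F),
      T3.split (K := K) E F (Pi.single k ((a ⊗ₜ b) ⊗ₜ (c ⊗ₜ d)))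
        = (Pi.single k (a ⊗ₜ c)) ⊗ₜ (Pi.single k (b ⊗ₜ d)) := by
    intro k a c b d
    simp only [T3.split, LinearMap.sum_apply, LinearMap.comp_apply, LinearMap.proj_apply]
    rw [Finset.sum_eq_single k]
    · simp
    · intro j _ hj
      rw [Pi.single_eq_of_ne hj]; simp
    · simp
  suffices h : T3.split E F ∘ₗ T3.perm (TensorProduct.map τ τ') σ
      = TensorProduct.map (T3.perm τ σ) (T3.perm τ' σ) ∘ₗ T3.split E F from
    LinearMap.congr_fun h t
  refine LinearMap.pi_ext' fun k => ?_
  refine TensorProduct.ext_fourfold' fun a b c d => ?_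
  simp only [LinearMap.comp_apply, LinearMap.coe_single, hs, hsp, TensorProduct.map_tmul]
  split_ifs <;> simp [hsp]

/-- The Manin white product `O ∘ P`: the binary quadratic operad generated by `O(2) ⊗ P(2)`, with
the relations which hold in `O(3) ⊗ P(3)`. -/
noncomputable def BinQuad.white (O P : BinQuad K) : BinQuad K where
  E := O.E ⊗[K] P.E
  τ := TensorProduct.map O.τ P.τ
  τ_τ e := by
    have : TensorProduct.map O.τ P.τ ∘ₗ TensorProduct.map O.τ P.τ = LinearMap.id := by
      ext a b; simp [O.τ_τ, P.τ_τ]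
    exact LinearMap.congr_fun this e
  rel := (whiteRel O.rel P.rel).comap (T3.split O.E P.E)
  rel_perm σ t ht := by
    rw [Submodule.mem_comap, T3.split_perm]
    refine whiteRel_map _ _ _ _ (O.rel_perm σ) (P.rel_perm σ) _ ht

/-- The cells of the 1-simplex: the left vertex, the right vertex, and the edge. -/
inductive Cell
  | left
  | right
  | edge

/-- The non-degenerate cochains `C^*(Δ_1; V)` on the 1-simplex. -/
abbrev Cochain (V : Type u) : Type u := Cell → V

/-- The operation `∪ ⊗ m` on `C^*(Δ_1; V) = C^*(Δ_1; K) ⊗ V`, for a bilinear operation `m`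
on `V`. -/
def cup {V : Type u} [AddCommGroup V] [Module K V] (m : V →ₗ[K] V →ₗ[K] V) :
    Cochain V →ₗ[K] Cochain V →ₗ[K] Cochain V :=
  LinearMap.mk₂ K
    (fun α β c => match c with
      | .left => m (α .left) (β .left)
      | .right => m (α .right) (β .right)
      | .edge => m (α .left) (β .edge) + m (α .edge) (β .right))
    (by intro α α' β; funext c; cases c <;> simp; abel)
    (by intro c α β; funext c; cases c <;> simp)
    (by intro α β β'; funext c; cases c <;> simp; abel)
    (by intro c α β; funext c; cases c <;> simp)

/-- The cup products on `C^*(Δ_1; V)`, for an algebra `V`. The pair `(e, e')` stands for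
`∪ ⊗ e + (∪ ⊗ e')^op`. -/
def cupProduct {O : BinQuad K} {V : Type u} [AddCommGroup V] [Module K V] (A : O.Alg V) :
    O.E × O.E →ₗ[K] Cochain V →ₗ[K] Cochain V →ₗ[K] Cochain V where
  toFun e := cup (A.op e.1) + (cup (A.op e.2)).flip
  map_add' e e' := by
    ext α β c; cases c <;> (simp [cup]; abel)
  map_smul' c e := by
    ext α β c; cases c <;> simp [cup]

/-- The cup brackets `[-, -] ⊗ e = (∪ - ∪^op) ⊗ e` on `C^*(Δ_1; V)`, for an algebra `V`. -/
def cupBracket {O : BinQuad K} {V : Type u} [AddCommGroup V] [Module K V] (A : O.Alg V) :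
    O.E →ₗ[K] Cochain V →ₗ[K] Cochain V →ₗ[K] Cochain V where
  toFun e := cup (A.op e) - (cup (A.op e).flip).flip
  map_add' e e' := by
    ext α β c; cases c <;> simp [cup]
    abel
  map_smul' c e := by
    ext α β c; cases c <;> simp [cup, smul_sub]

/-- The operad `Ass_∘(O)`. It is generated by the nonsymmetric operations `∪ ⊗ e`, for `e` in a
basis of the operations of `O`, that is, by `(e, 0)`, with opposites `(0, e)`. The
relations are those which hold for the cup products on `C^*(Δ_1; V)`, for all `O`-algebras `V`.

The Leibniz rule for the differential and the locality of the cup products are conditions on the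
cup products only, which always hold, so that they do not affect the relations. Koszul signs occur
only in terms with two arguments of degree one, and these terms vanish. -/
def assCirc (O : BinQuad K) : BinQuad K where
  E := O.E × O.E
  τ := (LinearEquiv.prodComm K O.E O.E).toLinearMap
  τ_τ e := rfl
  rel :=
    { carrier := {t | ∀ (V : Type u) [AddCommGroup V] [Module K V] (A : O.Alg V)
        (x : Fin 3 → Cochain V), T3.eval (cupProduct A) x t = 0}
      add_mem' := fun ha hb V _ _ A x => by rw [map_add, ha V A x, hb V A x, add_zero]
      zero_mem' := fun V _ _ A x => map_zero _
      smul_mem' := fun c a ha V _ _ A x => by rw [map_smul, ha V A x, smul_zero] }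
  rel_perm σ t ht V _ _ A x := by
    rw [T3.eval_perm _ _ _ σ]
    · exact ht V A _
    · intro e α β
      simp [cupProduct, add_comm]

/-- The operad `Lie_∘(O)`. It is generated by the operations `[-, -] ⊗ e`, denoted by `e` again,
so that the opposite operation is now `- τ e`. The relations are those which hold for
the cup brackets on `C^*(Δ_1; V)`, for all `O`-algebras `V`. -/
def lieCirc (O : BinQuad K) : BinQuad K where
  E := O.E
  τ := -O.τ
  τ_τ e := by simp [O.τ_τ]
  rel :=
    { carrier := {t | ∀ (V : Type u) [AddCommGroup V] [Module K V] (A : O.Alg V)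
        (x : Fin 3 → Cochain V), T3.eval (cupBracket A) x t = 0}
      add_mem' := fun ha hb V _ _ A x => by rw [map_add, ha V A x, hb V A x, add_zero]
      zero_mem' := fun V _ _ A x => map_zero _
      smul_mem' := fun c a ha V _ _ A x => by rw [map_smul, ha V A x, smul_zero] }
  rel_perm σ t ht V _ _ A x := by
    rw [T3.eval_perm _ _ _ σ]
    · exact ht V A _
    · intro e α β
      have h : A.op (O.τ e) = (A.op e).flip := by ext x y; simp [A.op_τ]
      have h' : cup (-(A.op e).flip) = -cup (A.op e).flip := by
        ext α β c; cases c <;> simp [cup]; abel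
      have h'' : cup (-(A.op e).flip).flip = -cup (A.op e) := by
        ext α β c; cases c <;> simp [cup]; abel
      simp [cupBracket, h, h', h'']
      abel

end Constructions

end Operads

open Operads

namespace Operads

set_option linter.unusedSimpArgs false
set_option linter.unnecessarySeqFocus false

/-! ## Morphisms of presented operads -/

section Morphisms

variable {K : Type u} [Field K]

/-! An isomorphism of generating spaces which respects opposites and carries the relations exactly
onto the relations induces an isomorphism of the presented operads in all arities
(`BinQuad.IsEquiv.isIso`). The theorem is thereby reduced to linear algebra in arity three.

The relations of the cochain constructions quantify over all algebras. One test algebra suffices: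
the free algebra on three generators, truncated after its multilinear ternary part. A ternary
operation which vanishes on its generators is a relation (`BinQuad.mem_rel_of_trunc`), in any
characteristic. On the 1-simplex the cup bracket of two cochains vanishes at the vertices, and on
the edge it is `α_e μ δβ - δα μ β_e`, where `δ` is the right value minus the left one. In a double
bracket the outer argument therefore enters through `δ` only. Placing `x_i` on the edge kills the
summand `i` of a relation and weights the other two with opposite signs; these three parts must be
relations of the given operad (`mem_lieCirc_rel`). For cup products, associativity of `∪` merges the
two bracketings of each of the six orders of the arguments, and a relation splits into six words
(`mem_assCirc_rel`).

The relations of each operad are then described by linear equations, mostly the coefficients of a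
normal form (`mem_zinb_rel` and its analogues). Those of a white product are the kernel of a tensor
product of quotient maps, hence are cut out by the products of the equations of the factors
(`mem_white_rel`). What remains is to compare linear systems. A Zinbiel equation adds one
coefficient from each of the three summands. Both the edge condition and the pairing with the
equations of `lie` force these coefficients to be equal, which is the pre-Lie system after a sign
change. For `ass`, `preLie` and `lie` the edge condition makes every coefficient vanish.

The rows of the square are compared on generators, which determines the morphisms in every arity
(`BinQuad.hom_hom`). -/

theorem T3.map_single {E F : Type u} [AddCommGroup E] [Module K E] [AddCommGroup F] [Module K F]
    (f : E →ₗ[K] F) (k : Fin 3) (z : E ⊗[K] E) :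
    T3.map f (Pi.single k z) = Pi.single k (TensorProduct.map f f z) := by
  funext i
  by_cases h : i = k
  · subst h; simp [T3.map]
  · simp [T3.map, h]

theorem T3.map_comp {E F G : Type u} [AddCommGroup E] [Module K E] [AddCommGroup F] [Module K F]
    [AddCommGroup G] [Module K G] (g : F →ₗ[K] G) (f : E →ₗ[K] F) (t : T3 K E) :
    T3.map (g ∘ₗ f) t = T3.map g (T3.map f t) := by
  funext i
  simp [T3.map, TensorProduct.map_comp]

theorem T3.map_id {E : Type u} [AddCommGroup E] [Module K E] (t : T3 K E) :
    T3.map (LinearMap.id : E →ₗ[K] E) t = t := by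
  funext i
  simp [T3.map]

/-- The application of a map of generating operations to a formal composite. -/
def Pre.map {O P : BinQuad K} (f : O.E →ₗ[K] P.E) : ∀ {X : Type}, Pre O X → Pre P X
  | _, .gen e => .gen (f e)
  | _, .one => .one
  | _, .ren σ p => .ren σ (p.map f)
  | _, .comp p q => .comp (p.map f) (q.map f)
  | _, .zero => .zero
  | _, .plus p q => .plus (p.map f) (q.map f)
  | _, .smul c p => .smul c (p.map f)

theorem Pre.map_map {O P Q : BinQuad K} (f : O.E →ₗ[K] P.E) (g : P.E →ₗ[K] Q.E) {X : Type}
    (p : Pre O X) : (p.map f).map g = p.map (g ∘ₗ f) := by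
  induction p <;> simp_all [Pre.map]

theorem Pre.map_id {O : BinQuad K} {X : Type} (p : Pre O X) : p.map LinearMap.id = p := by
  induction p <;> simp_all [Pre.map]

/-- A map of generating operations is compatible with opposites and relations. -/
structure BinQuad.IsMorphism (O P : BinQuad K) (f : O.E →ₗ[K] P.E) : Prop where
  map_τ : ∀ e, f (O.τ e) = P.τ (f e)
  map_rel : ∀ r ∈ O.rel, T3.map f r ∈ P.rel

/-- All clauses are natural in the generators. Linearity of `f` serves `gen_plus` and `gen_smul`;
compatibility with opposites and with relations serves `gen_τ` and `quad`. -/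
theorem Pre.Rel.map {O P : BinQuad K} {f : O.E →ₗ[K] P.E} (hf : O.IsMorphism P f) {X : Type}
    {p q : Pre O X} (h : Pre.Rel O p q) : Pre.Rel P (p.map f) (q.map f) := by
  induction h with
  | refl p => exact .refl _
  | symm _ ih => exact .symm ih
  | trans _ _ ih ih' => exact .trans ih ih'
  | congr_ren σ _ ih => exact .congr_ren σ ih
  | congr_comp _ _ ih ih' => exact .congr_comp ih ih'
  | congr_plus _ _ ih ih' => exact .congr_plus ih ih'
  | congr_smul c _ ih => exact .congr_smul c ih
  | plus_assoc p q r => exact .plus_assoc _ _ _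
  | plus_comm p q => exact .plus_comm _ _
  | zero_plus p => exact .zero_plus _
  | neg_plus p => exact .neg_plus _
  | smul_plus c p q => exact .smul_plus c _ _
  | plus_smul c d p => exact .plus_smul c d _
  | mul_smul c d p => exact .mul_smul c d _
  | one_smul p => exact .one_smul _
  | ren_plus σ p q => exact .ren_plus σ _ _
  | ren_smul σ c p => exact .ren_smul σ c _
  | plus_comp p p' q => exact .plus_comp _ _ _
  | smul_comp c p q => exact .smul_comp c _ _
  | comp_plus p q q' => exact .comp_plus _ _ _
  | comp_smul c p q => exact .comp_smul c _ _
  | ren_refl p => exact .ren_refl _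
  | ren_trans σ ρ p => exact .ren_trans σ ρ _
  | comp_ren σ ρ p q => exact .comp_ren σ ρ _ _
  | one_comp q => exact .one_comp _
  | comp_one p => exact .comp_one _
  | comp_assoc p q r => exact .comp_assoc _ _ _
  | comp_comm p q r => exact .comp_comm _ _ _
  | gen_plus e e' => simp only [Pre.map, map_add]; exact .gen_plus _ _
  | gen_smul c e => simp only [Pre.map, map_smul]; exact .gen_smul _ _
  | gen_τ e => simp only [Pre.map, hf.map_τ]; exact .gen_τ _
  | quad l h =>
    -- A relation enters as a list of trees, so its image has to be exhibited as the list of image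
    -- trees before `map_rel` applies.
    have h1 : ∀ l : List (Fin 3 × O.E × O.E),
        (l.foldr (fun a p => Pre.plus (Pre.tree O a.1 a.2.1 a.2.2) p) .zero).map f
          = (l.map fun a => (a.1, f a.2.1, f a.2.2)).foldr
            (fun a p => .plus (Pre.tree P a.1 a.2.1 a.2.2) p) .zero := by
      intro l
      induction l with
      | nil => rfl
      | cons a l ih => simpa [Pre.map, Pre.tree] using ih
    rw [h1]
    refine .quad _ ?_
    have h2 := hf.map_rel _ h
    rw [map_list_sum, List.map_map] at h2
    rw [List.map_map]
    have h3 : (T3.map f ∘ fun a : Fin 3 × O.E × O.E =>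
        (Pi.single a.1 (a.2.1 ⊗ₜ[K] a.2.2) : T3 K O.E))
        = (fun a : Fin 3 × P.E × P.E => (Pi.single a.1 (a.2.1 ⊗ₜ[K] a.2.2) : T3 K P.E)) ∘
          fun a => (a.1, f a.2.1, f a.2.2) := by
      funext a
      simp [T3.map_single]
    rw [h3] at h2
    exact h2

/-- The morphism of operads given by a map of generating operations. -/
def BinQuad.hom {O P : BinQuad K} (f : O.E →ₗ[K] P.E) (hf : O.IsMorphism P f) :
    SymOperad.Hom O.operad P.operad where
  app X _ :=
    { toFun := Quotient.map (Pre.map f) fun _ _ h => h.map hf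
      map_add' := by rintro ⟨p⟩ ⟨q⟩; rfl
      map_smul' := by rintro c ⟨p⟩; rfl }
  app_map := by rintro X Y _ _ σ ⟨p⟩; rfl
  app_one := rfl
  app_comp := by rintro A B _ _ ⟨p⟩ ⟨q⟩; rfl

theorem BinQuad.hom_gen {O P : BinQuad K} (f : O.E →ₗ[K] P.E) (hf : O.IsMorphism P f) (e : O.E) :
    (BinQuad.hom f hf).app (Fin 2) (O.gen e) = P.gen (f e) := rfl

/-- An induced morphism depends only on its map of generators, so identities between composites are
checked in arity two. Both the invertibility of induced morphisms and the commutativity of the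
squares rest on this. -/
theorem BinQuad.hom_hom {O P Q : BinQuad K} {f : O.E →ₗ[K] P.E} (hf : O.IsMorphism P f)
    {g : P.E →ₗ[K] Q.E} (hg : P.IsMorphism Q g) {h : O.E →ₗ[K] Q.E} (hh : O.IsMorphism Q h)
    (e : g ∘ₗ f = h) (X : Type) [Finite X] (t : O.operad.obj X) :
    (BinQuad.hom g hg).app X ((BinQuad.hom f hf).app X t) = (BinQuad.hom h hh).app X t := by
  subst e
  obtain ⟨p⟩ := t
  exact congrArg (Quotient.mk _) (Pre.map_map f g p)

theorem BinQuad.IsMorphism.id (O : BinQuad K) : O.IsMorphism O LinearMap.id where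
  map_τ _ := rfl
  map_rel r hr := by rwa [T3.map_id]

theorem BinQuad.hom_id (O : BinQuad K) (X : Type) [Finite X] (t : O.operad.obj X) :
    (BinQuad.hom LinearMap.id (BinQuad.IsMorphism.id O)).app X t = t := by
  obtain ⟨p⟩ := t
  exact congrArg (Quotient.mk _) (Pre.map_id p)

/-- An equivalence of generating operations is compatible with opposites and relations. -/
structure BinQuad.IsEquiv (O P : BinQuad K) (f : O.E ≃ₗ[K] P.E) : Prop where
  map_τ : ∀ e, f (O.τ e) = P.τ (f e)
  map_rel_iff : ∀ r, T3.map f.toLinearMap r ∈ P.rel ↔ r ∈ O.rel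

theorem BinQuad.IsEquiv.isMorphism {O P : BinQuad K} {f : O.E ≃ₗ[K] P.E} (hf : O.IsEquiv P f) :
    O.IsMorphism P f.toLinearMap where
  map_τ := hf.map_τ
  map_rel r hr := (hf.map_rel_iff r).mpr hr

theorem BinQuad.IsEquiv.symm {O P : BinQuad K} {f : O.E ≃ₗ[K] P.E} (hf : O.IsEquiv P f) :
    P.IsEquiv O f.symm where
  map_τ e := by rw [LinearEquiv.symm_apply_eq, hf.map_τ, LinearEquiv.apply_symm_apply]
  map_rel_iff r := by
    rw [← hf.map_rel_iff, ← T3.map_comp]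
    simp [T3.map_id]

theorem BinQuad.IsEquiv.isIso {O P : BinQuad K} {f : O.E ≃ₗ[K] P.E} (hf : O.IsEquiv P f) :
    (BinQuad.hom f.toLinearMap hf.isMorphism).IsIso := by
  intro X _
  refine Function.bijective_iff_has_inverse.mpr
    ⟨(BinQuad.hom f.symm.toLinearMap hf.symm.isMorphism).app X, fun t => ?_, fun t => ?_⟩
  · rw [BinQuad.hom_hom _ _ (BinQuad.IsMorphism.id O) (by ext; simp), BinQuad.hom_id]
  · rw [BinQuad.hom_hom _ _ (BinQuad.IsMorphism.id P) (by ext; simp), BinQuad.hom_id]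

theorem BinQuad.IsEquiv.isoWith {O P : BinQuad K} {f : O.E ≃ₗ[K] P.E} (hf : O.IsEquiv P f)
    {s : Set (O.E × P.E)} (hs : ∀ ab ∈ s, f ab.1 = ab.2) : O.IsoWith P s :=
  ⟨_, hf.isIso, fun ab h => (BinQuad.hom_gen _ _ _).trans (congrArg P.gen (hs ab h))⟩

/-- A map of generating operations is a morphism if it becomes one after composition with an
isomorphism. -/
theorem BinQuad.IsMorphism.of_comp_equiv {O P Q : BinQuad K} {f : O.E →ₗ[K] P.E}
    {g : P.E ≃ₗ[K] Q.E} (hg : P.IsEquiv Q g) {h : O.E →ₗ[K] Q.E} (hh : O.IsMorphism Q h)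
    (e : g.toLinearMap ∘ₗ f = h) : O.IsMorphism P f where
  map_τ x := by
    have e' : ∀ x, g (f x) = h x := fun x => LinearMap.congr_fun e x
    apply g.injective
    rw [hg.map_τ, e', e', hh.map_τ]
  map_rel r hr := by
    rw [← hg.map_rel_iff, ← T3.map_comp, e]
    exact hh.map_rel r hr

theorem BinQuad.IsMorphism.comp {O P Q : BinQuad K} {f : O.E →ₗ[K] P.E} {g : P.E →ₗ[K] Q.E}
    (hg : P.IsMorphism Q g) (hf : O.IsMorphism P f) : O.IsMorphism Q (g ∘ₗ f) where
  map_τ x := by simp [hf.map_τ, hg.map_τ]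
  map_rel r hr := by rw [T3.map_comp]; exact hg.map_rel _ (hf.map_rel r hr)

end Morphisms

/-! ## Ternary relations and algebras -/

section Algebras

variable {K : Type u} [Field K]

theorem T3.hom_ext {E : Type u} [AddCommGroup E] [Module K E] {M : Type w} [AddCommGroup M]
    [Module K M] {f g : T3 K E →ₗ[K] M}
    (h : ∀ k μ ν, f (Pi.single k (μ ⊗ₜ ν)) = g (Pi.single k (μ ⊗ₜ ν))) : f = g := by
  refine LinearMap.pi_ext' fun k => TensorProduct.ext' fun μ ν => ?_
  exact h k μ ν

theorem T3.eval_single {E : Type u} [AddCommGroup E] [Module K E] {V : Type v} [AddCommGroup V]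
    [Module K V] (op : E →ₗ[K] V →ₗ[K] V →ₗ[K] V) (x : Fin 3 → V) (k : Fin 3) (μ ν : E) :
    T3.eval op x (Pi.single k (μ ⊗ₜ ν)) = op μ (op ν (x (k + 1)) (x (k + 2))) (x k) := by
  simp only [T3.eval, LinearMap.sum_apply, LinearMap.comp_apply, LinearMap.proj_apply]
  rw [Finset.sum_eq_single k]
  · simp [T3.evalAt]
  · intro j _ hj
    rw [Pi.single_eq_of_ne hj, map_zero]
  · simp

/-- Each monomial contains each of the three variables once. -/
theorem T3.eval_eq_zero {E : Type u} [AddCommGroup E] [Module K E] {V : Type v} [AddCommGroup V]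
    [Module K V] (op : E →ₗ[K] V →ₗ[K] V →ₗ[K] V) (x : Fin 3 → V) (j : Fin 3) (hj : x j = 0)
    (t : T3 K E) : T3.eval op x t = 0 := by
  refine LinearMap.congr_fun (T3.hom_ext (g := 0) fun k μ ν => ?_) t
  rw [T3.eval_single]
  have h : ∀ j k : Fin 3, j = k ∨ j = k + 1 ∨ j = k + 2 := by decide
  rcases h j k with rfl | rfl | rfl <;> simp [hj]

theorem T3.perm_addLeft {E : Type u} [AddCommGroup E] [Module K E] (τ : E →ₗ[K] E) (i : Fin 3)
    (t : T3 K E) (k : Fin 3) : T3.perm τ (Equiv.addLeft i) t k = t (k - i) := by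
  have h : Equiv.Perm.sign (Equiv.addLeft i) = 1 := by revert i; decide
  simp [T3.perm, h, neg_add_eq_sub]

theorem T3.perm_subLeft {E : Type u} [AddCommGroup E] [Module K E] (τ : E →ₗ[K] E) (i : Fin 3)
    (t : T3 K E) (k : Fin 3) : T3.perm τ (Equiv.subLeft i) t k =
      TensorProduct.map LinearMap.id τ (t (i - k)) := by
  have h : Equiv.Perm.sign (Equiv.subLeft i) ≠ 1 := by revert i; decide
  simp [T3.perm, h, neg_add_eq_sub]

theorem fin_three_neg_one : (-1 : Fin 3) = 2 := rfl

theorem fin_three_neg_two : (-2 : Fin 3) = 1 := rfl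

/-- `S_3` is the dihedral group of `ℤ/3`: the rotations are the even permutations and the
reflections are the odd ones, which twist the inner operation by `τ`. -/
theorem perm_three (σ : Equiv.Perm (Fin 3)) :
    (∃ i, σ = Equiv.addLeft i) ∨ ∃ i, σ = Equiv.subLeft i := by
  revert σ; decide

variable (O : BinQuad K)

/-- The truncated algebra on three generators, with the multilinear ternary part retained only. -/
abbrev BinQuad.Trunc : Type u := (Fin 3 → K) × (Fin 3 → O.E) × (T3 K O.E ⧸ O.rel)

/-- The product of two elements of degree one. -/
def BinQuad.truncTwo : O.E →ₗ[K] (Fin 3 → K) →ₗ[K] (Fin 3 → K) →ₗ[K] (Fin 3 → O.E) where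
  toFun μ := LinearMap.mk₂ K
    (fun a b k => (a (k + 1) * b (k + 2)) • μ + (a (k + 2) * b (k + 1)) • O.τ μ)
    (by intros; funext k; simp [add_mul, add_smul]; abel)
    (by intros; funext k; simp [mul_smul, mul_assoc])
    (by intros; funext k; simp [mul_add, add_smul]; abel)
    (by intros; funext k; simp [mul_smul, mul_left_comm])
  map_add' μ ν := by ext a b k; simp; abel
  map_smul' c μ := by ext a b k; simp [smul_smul, mul_comm c]

/-- The product of an element of degree one and an element of degree two. -/
noncomputable def BinQuad.truncThree :
    O.E →ₗ[K] (Fin 3 → O.E) →ₗ[K] (Fin 3 → K) →ₗ[K] T3 K O.E where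
  toFun μ := LinearMap.mk₂ K (fun α b k => b k • μ ⊗ₜ α k)
    (by intros; funext k; simp [TensorProduct.tmul_add])
    (by intros; funext k; simp [smul_smul, mul_comm])
    (by intros; funext k; simp [add_smul])
    (by intros; funext k; simp [smul_smul])
  map_add' μ ν := by ext a b k; simp [TensorProduct.add_tmul]
  map_smul' c μ := by ext a b k; simp [smul_smul, mul_comm c, TensorProduct.smul_tmul']

/-- The operations of the truncated algebra. -/
noncomputable def BinQuad.truncOp : O.E →ₗ[K] O.Trunc →ₗ[K] O.Trunc →ₗ[K] O.Trunc where
  toFun μ := LinearMap.mk₂ K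
    (fun v w => (0, O.truncTwo μ v.1 w.1,
      O.rel.mkQ (O.truncThree μ v.2.1 w.1 + O.truncThree (O.τ μ) w.2.1 v.1)))
    (by intros; ext <;> simp; abel)
    (by intros; ext <;> simp)
    (by intros; ext <;> simp; abel)
    (by intros; ext <;> simp)
  map_add' μ ν := by
    refine LinearMap.ext₂ fun v w => ?_
    ext <;> simp; abel
  map_smul' c μ := by
    refine LinearMap.ext₂ fun v w => ?_
    ext <;> simp

theorem BinQuad.truncOp_apply (μ : O.E) (v w : O.Trunc) :
    O.truncOp μ v w = (0, O.truncTwo μ v.1 w.1,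
      O.rel.mkQ (O.truncThree μ v.2.1 w.1 + O.truncThree (O.τ μ) w.2.1 v.1)) := rfl

/-- A triple product sees only the degree-one parts of its arguments, and only their multilinear
terms survive. Expanding them gives one term for each of the six substitutions of the generators,
rotations and reflections being listed separately. -/
theorem BinQuad.eval_truncOp (x : Fin 3 → O.Trunc) (t : T3 K O.E) :
    T3.eval O.truncOp x t = (0, 0, O.rel.mkQ
      (∑ i, ((∏ k, (x k).1 (i + k)) • T3.perm O.τ (Equiv.addLeft i) t +
        (∏ k, (x k).1 (i - k)) • T3.perm O.τ (Equiv.subLeft i) t))) := by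
  have h : T3.eval O.truncOp x = LinearMap.inr K _ _ ∘ₗ LinearMap.inr K _ _ ∘ₗ O.rel.mkQ ∘ₗ
      (∑ i, ((∏ k, (x k).1 (i + k)) • T3.perm O.τ (Equiv.addLeft i) +
        (∏ k, (x k).1 (i - k)) • T3.perm O.τ (Equiv.subLeft i))) := by
    refine T3.hom_ext fun k μ ν => ?_
    rw [T3.eval_single]
    have h0 : ∀ z : O.E ⊗[K] O.E, ∀ i j k: Fin 3,
        (Pi.single (M := fun _ => O.E ⊗[K] O.E) k z) (i - j) = if i - j = k then z else 0 := by
      intro z i j k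
      split_ifs with h <;> simp [h]
    simp only [O.truncOp_apply, LinearMap.comp_apply, LinearMap.inr_apply]
    refine Prod.ext rfl (Prod.ext ?_ ?_)
    · funext j
      simp [BinQuad.truncTwo]
    · dsimp only
      congr 1
      funext j
      simp only [Fin.prod_univ_three, Fin.sum_univ_three, LinearMap.add_apply,
        LinearMap.smul_apply, Pi.add_apply, Pi.smul_apply, T3.perm_addLeft, T3.perm_subLeft, h0]
      fin_cases k <;> fin_cases j <;>
        simp [BinQuad.truncTwo, BinQuad.truncThree, TensorProduct.tmul_add, smul_smul,
          TensorProduct.tmul_smul, fin_three_neg_one, fin_three_neg_two] <;> module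
  rw [h]
  simp

/-- The truncated algebra. -/
noncomputable def BinQuad.trunc : O.Alg O.Trunc where
  op := O.truncOp
  op_τ e x y := by
    rw [O.truncOp_apply, O.truncOp_apply, O.τ_τ]
    refine Prod.ext rfl (Prod.ext ?_ ?_)
    · funext k
      simp [BinQuad.truncTwo, O.τ_τ, mul_comm, add_comm]
    · dsimp only
      rw [add_comm]
  sat r hr x := by
    rw [O.eval_truncOp]
    -- The stability of the relations under `S_3` is what makes the truncation an algebra over `O`.
    have h : ∑ i, ((∏ k, (x k).1 (i + k)) • T3.perm O.τ (Equiv.addLeft i) r +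
        (∏ k, (x k).1 (i - k)) • T3.perm O.τ (Equiv.subLeft i) r) ∈ O.rel :=
      Submodule.sum_mem _ fun i _ => Submodule.add_mem _
        (Submodule.smul_mem _ _ (O.rel_perm _ _ hr)) (Submodule.smul_mem _ _ (O.rel_perm _ _ hr))
    rw [(Submodule.Quotient.mk_eq_zero O.rel).mpr h |> fun h => (h : O.rel.mkQ _ = 0)]
    rfl

/-- The generators of the truncated algebra. -/
def BinQuad.truncGen (k : Fin 3) : O.Trunc := (Pi.single k 1, 0, 0)

/-- The value at the three generators is the class of `t` modulo the relations. This replaces the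
quantification over all algebras by a single evaluation. -/
theorem BinQuad.mem_rel_of_trunc {t : T3 K O.E} (h : T3.eval O.trunc.op O.truncGen t = 0) :
    t ∈ O.rel := by
  have h1 := O.eval_truncOp O.truncGen t
  -- At the generators only the identity substitution has a nonzero coefficient.
  have h2 : ∑ i, ((∏ k, (O.truncGen k).1 (i + k)) • T3.perm O.τ (Equiv.addLeft i) t +
        (∏ k, (O.truncGen k).1 (i - k)) • T3.perm O.τ (Equiv.subLeft i) t) = t := by
    funext j
    simp [BinQuad.truncGen, Fin.prod_univ_three, Fin.sum_univ_three, T3.perm_addLeft,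
      fin_three_neg_one, fin_three_neg_two]
  rw [h2] at h1
  have h3 : O.rel.mkQ t = 0 := by
    have := h1.symm.trans h
    simpa using congrArg (fun z => z.2.2) this
  exact (Submodule.Quotient.mk_eq_zero O.rel).mp h3

end Algebras

/-! ## The relations of the cochain constructions -/

section Cochains

variable {K : Type u} [Field K]

/-- The ternary operations which a relation between cup brackets gives when the argument `i` is
located on the edge. -/
noncomputable def T3.edgePart (K : Type u) [Field K] (E : Type u) [AddCommGroup E] [Module K E]
    (i : Fin 3) : T3 K E →ₗ[K] T3 K E :=
  LinearMap.single K _ (i + 2) ∘ₗ LinearMap.proj (i + 2) -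
    LinearMap.single K _ (i + 1) ∘ₗ LinearMap.proj (i + 1)

/-- The argument `i` is evaluated on the edge, the other ones on the boundary of the edge. -/
def edgeArg {V : Type u} [AddCommGroup V] (x : Fin 3 → Cochain V) (i j : Fin 3) : V :=
  if j = i then x j .edge else x j .right - x j .left

/-- The inner bracket vanishes at the vertices, so `(x_{k+1} ν x_{k+2}) μ x_k` becomes the product
of an edge value and `δx_k`. The edge value has `x_{k+1}` on the edge with sign `+` and `x_{k+2}` on
the edge with sign `-`; thus for a fixed edge argument `i` the summands `i + 2` and `i + 1` remain,
with opposite signs. -/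
theorem eval_cupBracket {O : BinQuad K} {V : Type u} [AddCommGroup V] [Module K V]
    (A : O.Alg V) (x : Fin 3 → Cochain V) (t : T3 K O.E) :
    T3.eval (cupBracket A) x t =
      fun c => match c with
        | .left => 0
        | .right => 0
        | .edge => ∑ i, T3.eval A.op (edgeArg x i) (T3.edgePart K O.E i t) := by
  have h : T3.eval (cupBracket A) x = LinearMap.pi fun c => match c with
      | .left => 0
      | .right => 0
      | .edge => ∑ i, T3.eval A.op (edgeArg x i) ∘ₗ T3.edgePart K O.E i := by
    refine T3.hom_ext fun k μ ν => ?_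
    rw [T3.eval_single]
    funext c
    fin_cases k <;> cases c <;>
      simp [cupBracket, cup, T3.edgePart, edgeArg, T3.eval_single, Fin.sum_univ_three] <;> abel
  rw [h]
  funext c
  cases c <;> simp

/-- The three edge parts can be tested independently because the edge value and the vertex values of
a cochain can be prescribed independently. -/
theorem mem_lieCirc_rel {O : BinQuad K} {t : T3 K O.E} :
    t ∈ (lieCirc O).rel ↔ ∀ i, T3.edgePart K O.E i t ∈ O.rel := by
  constructor
  · intro h i
    apply O.mem_rel_of_trunc
    -- The argument `i` lives on the edge only; the others live at the right vertex only, so that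
    -- their difference of end values is a generator. Every part with another edge argument `j` then
    -- vanishes, since the edge value of `x j` is zero.
    have h1 := h O.Trunc O.trunc (fun j c => match c with
      | .left => 0
      | .right => if j = i then 0 else O.truncGen j
      | .edge => if j = i then O.truncGen j else 0)
    rw [eval_cupBracket] at h1
    have h2 : ∑ j, _ = (0 : O.Trunc) := congrFun h1 .edge
    rw [Finset.sum_eq_single i] at h2
    · convert h2 using 3
      funext j
      by_cases hj : j = i <;> simp [edgeArg, hj]
    · intro j _ hj
      refine T3.eval_eq_zero _ _ j ?_ _
      simp [edgeArg, hj]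
    · simp
  · intro h V _ _ A x
    rw [eval_cupBracket]
    funext c
    cases c
    · rfl
    · rfl
    · exact Finset.sum_eq_zero fun i _ => A.sat _ (h i) _

/-- The part of a relation between cup products in which the arguments of the cochain factor
occur in the order `i, i + 1, i + 2`. -/
noncomputable def evenWord (O : BinQuad K) (i : Fin 3) : T3 K (O.E × O.E) →ₗ[K] T3 K O.E :=
  LinearMap.single K _ i ∘ₗ TensorProduct.map (O.τ ∘ₗ LinearMap.snd K _ _) (LinearMap.fst K _ _)
    ∘ₗ LinearMap.proj i +
  LinearMap.single K _ (i + 2) ∘ₗ TensorProduct.map (LinearMap.fst K _ _) (LinearMap.fst K _ _)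
    ∘ₗ LinearMap.proj (i + 2)

/-- The part of a relation between cup products in which the arguments of the cochain factor
occur in the order `i, i + 2, i + 1`. -/
noncomputable def oddWord (O : BinQuad K) (i : Fin 3) : T3 K (O.E × O.E) →ₗ[K] T3 K O.E :=
  LinearMap.single K _ i ∘ₗ TensorProduct.map (O.τ ∘ₗ LinearMap.snd K _ _)
    (O.τ ∘ₗ LinearMap.snd K _ _) ∘ₗ LinearMap.proj i +
  LinearMap.single K _ (i + 1) ∘ₗ TensorProduct.map (LinearMap.fst K _ _)
    (O.τ ∘ₗ LinearMap.snd K _ _) ∘ₗ LinearMap.proj (i + 1)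

instance : DecidableEq Cell
  | .left, .left | .right, .right | .edge, .edge => isTrue rfl
  | .left, .right | .left, .edge | .right, .left | .right, .edge | .edge, .left | .edge, .right =>
    isFalse nofun

/-- The argument `j`, in position `pos j` of a word, is evaluated at the cell `c (pos j)`. -/
def wordArg {V : Type u} (x : Fin 3 → Cochain V) (pos : Fin 3 → Fin 3) (c : Fin 3 → Cell)
    (j : Fin 3) : V :=
  x j (c (pos j))

/-- The value of a word on the edge, as a sum over the possible positions of the argument which is
located on the edge. -/
noncomputable def wordEdge {O : BinQuad K} {V : Type u} [AddCommGroup V] [Module K V]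
    (A : O.Alg V) (x : Fin 3 → Cochain V) (pos : Fin 3 → Fin 3) : T3 K O.E →ₗ[K] V :=
  T3.eval A.op (wordArg x pos ![.edge, .right, .right]) +
    T3.eval A.op (wordArg x pos ![.left, .edge, .right]) +
    T3.eval A.op (wordArg x pos ![.left, .left, .edge])

/-- Since `∪` is associative, both bracketings of a word evaluate at the same triples of cells:
along the edge, some left vertices, then the edge once, then right vertices. The functions `j - i`
and `i - j` give the position of the argument `j` in the even and in the odd word which start with
`i`. -/
theorem eval_cupProduct {O : BinQuad K} {V : Type u} [AddCommGroup V] [Module K V]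
    (A : O.Alg V) (x : Fin 3 → Cochain V) (t : T3 K (O.E × O.E)) :
    T3.eval (cupProduct A) x t =
      fun c => match c with
        | .left => ∑ i, T3.eval A.op (fun j => x j .left) (evenWord O i t + oddWord O i t)
        | .right => ∑ i, T3.eval A.op (fun j => x j .right) (evenWord O i t + oddWord O i t)
        | .edge => ∑ i, (wordEdge A x (fun j => j - i) (evenWord O i t) +
            wordEdge A x (fun j => i - j) (oddWord O i t)) := by
  have h : T3.eval (cupProduct A) x = LinearMap.pi fun c => match c with
      | .left => ∑ i, T3.eval A.op (fun j => x j .left) ∘ₗ (evenWord O i + oddWord O i)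
      | .right => ∑ i, T3.eval A.op (fun j => x j .right) ∘ₗ (evenWord O i + oddWord O i)
      | .edge => ∑ i, (wordEdge A x (fun j => j - i) ∘ₗ evenWord O i +
            wordEdge A x (fun j => i - j) ∘ₗ oddWord O i) := by
    refine T3.hom_ext fun k μ ν => ?_
    rw [T3.eval_single]
    funext c
    fin_cases k <;> cases c <;>
      simp [cupProduct, cup, evenWord, oddWord, wordEdge, wordArg, T3.eval_single, A.op_τ,
        fin_three_neg_one, fin_three_neg_two, Fin.sum_univ_three] <;> abel
  rw [h]
  funext c
  cases c <;> simp

/-- Arguments of degree one in the truncated algebra, located at given cells. -/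
def truncArg (O : BinQuad K) (cell : Fin 3 → Cell) (j : Fin 3) : Cochain O.Trunc :=
  fun d => if d = cell j then O.truncGen j else 0

/-- A single cell which does not match makes an argument zero, so the cells select the words which
contribute. -/
theorem eval_truncArg (O : BinQuad K) (cell c : Fin 3 → Cell) (pos : Fin 3 → Fin 3)
    (t : T3 K O.E) :
    T3.eval O.trunc.op (wordArg (truncArg O cell) pos c) t =
      if ∀ j, c (pos j) = cell j then T3.eval O.trunc.op O.truncGen t else 0 := by
  split_ifs with h
  · congr 2
    funext j
    simp [wordArg, truncArg, h]
  · push Not at h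
    obtain ⟨j, hj⟩ := h
    exact T3.eval_eq_zero _ _ j (by simp [wordArg, truncArg, hj]) _

/-- The pattern left, edge, right has three distinct cells, so it determines the order of the
arguments and separates the six words. -/
theorem mem_assCirc_rel {O : BinQuad K} {t : T3 K (O.E × O.E)} :
    t ∈ (assCirc O).rel ↔ ∀ i, evenWord O i t ∈ O.rel ∧ oddWord O i t ∈ O.rel := by
  constructor
  · intro h
    have key : ∀ cell : Fin 3 → Cell, ∑ i,
        (wordEdge O.trunc (truncArg O cell) (fun j => j - i) (evenWord O i t) +
          wordEdge O.trunc (truncArg O cell) (fun j => i - j) (oddWord O i t)) = 0 := by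
      intro cell
      have h1 := h O.Trunc O.trunc (truncArg O cell)
      rw [eval_cupProduct] at h1
      exact congrFun h1 .edge
    refine fun i => ⟨O.mem_rel_of_trunc ?_, O.mem_rel_of_trunc ?_⟩
    · have h1 := key fun j => ![.left, .edge, .right] (j - i)
      fin_cases i <;> simpa [wordEdge, eval_truncArg, Fin.sum_univ_three, Fin.forall_fin_succ,
        fin_three_neg_one, fin_three_neg_two] using h1
    · have h1 := key fun j => ![.left, .edge, .right] (i - j)
      fin_cases i <;> simpa [wordEdge, eval_truncArg, Fin.sum_univ_three, Fin.forall_fin_succ,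
        fin_three_neg_one, fin_three_neg_two] using h1
  · intro h V _ _ A x
    rw [eval_cupProduct]
    have h1 : ∀ y i, T3.eval A.op y (evenWord O i t) = 0 := fun y i => A.sat _ (h i).1 y
    have h2 : ∀ y i, T3.eval A.op y (oddWord O i t) = 0 := fun y i => A.sat _ (h i).2 y
    funext c
    cases c <;> simp [wordEdge, h1, h2]

end Cochains

/-! ## Coordinates -/

section Coordinates

variable {K : Type u} [Field K] {E : Type u} [AddCommGroup E] [Module K E] {ι : Type w}

/-- The coordinates of ternary operations with respect to a basis of the binary operations. -/
noncomputable def T3.coef (b : Module.Basis ι K E) (k : Fin 3) (i j : ι) : T3 K E →ₗ[K] K :=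
  (b.tensorProduct b).coord (i, j) ∘ₗ LinearMap.proj k

theorem T3.coef_apply_tmul (b : Module.Basis ι K E) (k : Fin 3) (i j : ι) (t : T3 K E) (μ ν : E)
    (h : t k = μ ⊗ₜ ν) : T3.coef b k i j t = b.repr μ i * b.repr ν j := by
  simp [T3.coef, h, mul_comm]

theorem T3.coef_single (b : Module.Basis ι K E) (k : Fin 3) (i j : ι) (k' : Fin 3) (μ ν : E) :
    T3.coef b k i j (Pi.single k' (μ ⊗ₜ ν)) =
      if k = k' then b.repr μ i * b.repr ν j else 0 := by
  split_ifs with h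
  · subst h; exact T3.coef_apply_tmul _ _ _ _ _ _ _ (by simp)
  · simp [T3.coef, h]

theorem T3.coef_monL (b : Module.Basis ι K E) (k : Fin 3) (i j : ι) (τ : E →ₗ[K] E) (μ ν : E)
    (x y z : Fin 3) : T3.coef b k i j (T3.monL τ μ ν x y z) =
      if k = z then b.repr μ i * (if y = x + 1 then b.repr ν j else b.repr (τ ν) j) else 0 := by
  by_cases h : y = x + 1 <;> simp [T3.monL, T3.coef_single, h]

theorem T3.coef_monR (b : Module.Basis ι K E) (k : Fin 3) (i j : ι) (τ : E →ₗ[K] E) (μ ν : E)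
    (x y z : Fin 3) : T3.coef b k i j (T3.monR τ μ ν x y z) =
      if k = x then b.repr (τ μ) i * (if z = y + 1 then b.repr ν j else b.repr (τ ν) j) else 0 :=
  T3.coef_monL b k i j τ (τ μ) ν y z x

theorem T3.ext_coef (b : Module.Basis ι K E) {t t' : T3 K E}
    (h : ∀ k i j, T3.coef b k i j t = T3.coef b k i j t') : t = t' := by
  funext k
  apply (b.tensorProduct b).repr.injective
  ext ⟨i, j⟩
  exact h k i j

/-- The involution acts on a basis by a signed permutation. -/
def IsSigned (b : Module.Basis ι K E) (τ : E →ₗ[K] E) (s : ι → K) (ε : ι → ι) : Prop :=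
  ∀ e j, b.repr (τ e) j = s j * b.repr e (ε j)

theorem T3.coef_perm_addLeft (b : Module.Basis ι K E) (τ : E →ₗ[K] E) (l : Fin 3) (t : T3 K E)
    (k : Fin 3) (i j : ι) :
    T3.coef b k i j (T3.perm τ (Equiv.addLeft l) t) = T3.coef b (k - l) i j t := by
  simp [T3.coef, T3.perm_addLeft]

/-- A reflection turns only the inner operation into its opposite, so the sign and the change of
index concern `j` and not `i`. -/
theorem T3.coef_perm_subLeft {b : Module.Basis ι K E} {τ : E →ₗ[K] E} {s : ι → K} {ε : ι → ι}
    (h : IsSigned b τ s ε) (l : Fin 3) (t : T3 K E) (k : Fin 3) (i j : ι) :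
    T3.coef b k i j (T3.perm τ (Equiv.subLeft l) t) = s j * T3.coef b (l - k) i (ε j) t := by
  have h1 : T3.coef b k i j ∘ₗ T3.perm τ (Equiv.subLeft l) = s j • T3.coef b (l - k) i (ε j) := by
    refine T3.hom_ext fun k' μ ν => ?_
    rw [LinearMap.smul_apply, T3.coef_single, LinearMap.comp_apply]
    by_cases hk : l - k = k'
    · rw [T3.coef_apply_tmul (μ := μ) (ν := τ ν)]
      · rw [h, if_pos hk, smul_eq_mul]; ring
      · rw [T3.perm_subLeft]; simp [hk]
    · rw [if_neg hk]
      simp [T3.coef, T3.perm_subLeft, hk]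
  exact LinearMap.congr_fun h1 t

theorem T3.coef_map {F : Type u} [AddCommGroup F] [Module K F] {κ : Type v}
    (b : Module.Basis ι K E) (b' : Module.Basis κ K F) (f : E →ₗ[K] F) (s : κ → K) (ε : κ → ι)
    (hf : ∀ e j, b'.repr (f e) j = s j * b.repr e (ε j)) (t : T3 K E) (k : Fin 3) (i j : κ) :
    T3.coef b' k i j (T3.map f t) = s i * s j * T3.coef b k (ε i) (ε j) t := by
  have h1 : T3.coef b' k i j ∘ₗ T3.map f = (s i * s j) • T3.coef b k (ε i) (ε j) := by
    refine T3.hom_ext fun k' μ ν => ?_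
    rw [LinearMap.smul_apply, T3.coef_single, LinearMap.comp_apply, T3.map_single,
      TensorProduct.map_tmul, T3.coef_single, hf, hf]
    split_ifs
    · rw [smul_eq_mul]; ring
    · simp
  exact LinearMap.congr_fun h1 t

/-- The relations generated by a set, under linear combinations and permutations of variables. -/
def symSpan (τ : E →ₗ[K] E) (s : Set (T3 K E)) : Submodule K (T3 K E) :=
  Submodule.span K {t | ∃ σ : Equiv.Perm (Fin 3), ∃ a ∈ s, T3.perm τ σ a = t}

theorem perm_mem_symSpan {τ : E →ₗ[K] E} {s : Set (T3 K E)} {a : T3 K E} (ha : a ∈ s)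
    (σ : Equiv.Perm (Fin 3)) : T3.perm τ σ a ∈ symSpan τ s :=
  Submodule.subset_span ⟨σ, a, ha, rfl⟩

theorem symSpan_le {τ : E →ₗ[K] E} {s : Set (T3 K E)} {N : Submodule K (T3 K E)}
    (hN : ∀ (σ : Equiv.Perm (Fin 3)) (t : T3 K E), t ∈ N → T3.perm τ σ t ∈ N) (hs : ∀ a ∈ s, a ∈ N)
      :
    symSpan τ s ≤ N := by
  refine Submodule.span_le.mpr ?_
  rintro _ ⟨σ, a, ha, rfl⟩
  exact hN σ a (hs a ha)

/-- The relations generated by `s` satisfy a system of linear equations, which is permuted up to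
signs by the permutations of variables, if the elements of `s` do. -/
theorem symSpan_eq_zero {τ : E →ₗ[K] E} {s : Set (T3 K E)} {β : Type v}
    {g : β → Fin 3 → T3 K E →ₗ[K] K}
    (hadd : ∀ b l i t, g b i (T3.perm τ (Equiv.addLeft l) t) = g b (i - l) t)
    (hsub : ∀ b l i t, (∀ b', g b' (l - i) t = 0) → g b i (T3.perm τ (Equiv.subLeft l) t) = 0)
    (hs : ∀ a ∈ s, ∀ b i, g b i a = 0) {t : T3 K E} (ht : t ∈ symSpan τ s) (b : β) (i : Fin 3) :
    g b i t = 0 := by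
  have h : symSpan τ s ≤ LinearMap.ker (g b i) := by
    refine Submodule.span_le.mpr ?_
    rintro _ ⟨σ, a, ha, rfl⟩
    rcases perm_three σ with ⟨l, rfl⟩ | ⟨l, rfl⟩
    · exact (hadd b l i a).trans (hs a ha b _)
    · exact hsub b l i a fun b' => hs a ha b' _
  exact h ht

/-- A criterion for a linear combination of permuted relations, in coordinates. -/
theorem mem_symSpan_of_coef {b : Module.Basis ι K E} {τ : E →ₗ[K] E} {s : ι → K} {ε : ι → ι}
    (hτ : IsSigned b τ s ε) {R : Set (T3 K E)} {κ : Type} [Fintype κ] (r : κ → T3 K E)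
    (hr : ∀ a, r a ∈ R) (x y : κ → Fin 3 → K) {t : T3 K E}
    (h : ∀ k i j, T3.coef b k i j t = ∑ a,
      (x a k * T3.coef b 0 i j (r a) + x a (k + 2) * T3.coef b 1 i j (r a)
          + x a (k + 1) * T3.coef b 2 i j (r a)
        + s j * (y a k * T3.coef b 0 i (ε j) (r a) + y a (k + 1) * T3.coef b 1 i (ε j) (r a)
          + y a (k + 2) * T3.coef b 2 i (ε j) (r a)))) : t ∈ symSpan τ R := by
  -- Here `x a l` and `y a l` are the coefficients of the rotation and of the reflection with
  -- parameter `l` of the relation `r a`. The shifted indices in the hypothesis are the solutions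
  -- `l` of `k - l = 0, 1, 2` and of `l - k = 0, 1, 2`.
  have h1 : t = ∑ a, ∑ l, (x a l • T3.perm τ (Equiv.addLeft l) (r a)
      + y a l • T3.perm τ (Equiv.subLeft l) (r a)) := by
    refine T3.ext_coef b fun k i j => ?_
    rw [h, map_sum]
    refine Finset.sum_congr rfl fun a _ => ?_
    simp only [map_add, map_smul, smul_eq_mul, T3.coef_perm_addLeft,
      T3.coef_perm_subLeft hτ, Fin.sum_univ_three]
    fin_cases k <;> simp [fin_three_neg_one, fin_three_neg_two] <;> ring
  rw [h1]
  exact Submodule.sum_mem _ fun a _ => Submodule.sum_mem _ fun l _ => Submodule.add_mem _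
    (Submodule.smul_mem _ _ (perm_mem_symSpan (hr a) _))
    (Submodule.smul_mem _ _ (perm_mem_symSpan (hr a) _))

end Coordinates

/-! ## The relations of the examples as linear equations -/


section Equations

variable (K : Type u) [Field K]

/-- The basis of a nonsymmetric operation and its opposite. -/
noncomputable def basisDot : Module.Basis (Fin 2) K (Gens K 1 0 0) :=
  Module.Basis.ofEquivFun
    { toFun e := ![(e.1 0).1, (e.1 0).2]
      invFun c := (fun _ => (c 0, c 1), 0, 0)
      map_add' _ _ := by funext i; fin_cases i <;> rfl
      map_smul' _ _ := by funext i; fin_cases i <;> rfl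
      left_inv e := by
        refine Prod.ext (funext fun i => ?_) (Prod.ext (Subsingleton.elim _ _)
          (Subsingleton.elim _ _))
        rw [Subsingleton.elim i 0]; rfl
      right_inv c := by funext i; fin_cases i <;> rfl }

/-- The basis of a commutative operation. -/
noncomputable def basisCom : Module.Basis (Fin 1) K (Gens K 0 1 0) :=
  Module.Basis.ofEquivFun
    { toFun e := e.2.1
      invFun c := (0, c, 0)
      map_add' _ _ := rfl
      map_smul' _ _ := rfl
      left_inv _ := Prod.ext (Subsingleton.elim _ _) (Prod.ext rfl (Subsingleton.elim _ _))
      right_inv _ := rfl }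

/-- The basis of an anticommutative operation. -/
noncomputable def basisAnt : Module.Basis (Fin 1) K (Gens K 0 0 1) :=
  Module.Basis.ofEquivFun
    { toFun e := e.2.2
      invFun c := (0, 0, c)
      map_add' _ _ := rfl
      map_smul' _ _ := rfl
      left_inv _ := Prod.ext (Subsingleton.elim _ _) (Prod.ext (Subsingleton.elim _ _) rfl)
      right_inv _ := rfl }

/-- The basis of a commutative and an anticommutative operation. -/
noncomputable def basisComAnt : Module.Basis (Fin 2) K (Gens K 0 1 1) :=
  Module.Basis.ofEquivFun
    { toFun e := ![e.2.1 0, e.2.2 0]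
      invFun c := (0, fun _ => c 0, fun _ => c 1)
      map_add' _ _ := by funext i; fin_cases i <;> rfl
      map_smul' _ _ := by funext i; fin_cases i <;> rfl
      left_inv e := by
        refine Prod.ext (Subsingleton.elim _ _) (Prod.ext (funext fun i => ?_)
          (funext fun i => ?_)) <;> (rw [Subsingleton.elim i 0]; rfl)
      right_inv c := by funext i; fin_cases i <;> rfl }

/-- The basis of two nonsymmetric operations and their opposites. The opposite of `(0, i)` is
`(1, i)`. -/
noncomputable def basisDotDot : Module.Basis (Fin 2 × Fin 2) K (Gens K 2 0 0) :=
  Module.Basis.ofEquivFun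
    { toFun e i := ![(e.1 i.2).1, (e.1 i.2).2] i.1
      invFun c := (fun i => (c (0, i), c (1, i)), 0, 0)
      map_add' _ _ := by funext ⟨i, j⟩; fin_cases i <;> rfl
      map_smul' _ _ := by funext ⟨i, j⟩; fin_cases i <;> rfl
      left_inv e := Prod.ext rfl (Prod.ext (Subsingleton.elim _ _) (Subsingleton.elim _ _))
      right_inv c := by funext ⟨i, j⟩; fin_cases i <;> rfl }

variable {K}

@[simp] theorem basisDot_zero (e : Gens K 1 0 0) : (basisDot K).repr e 0 = (e.1 0).1 := rfl

@[simp] theorem basisDot_one (e : Gens K 1 0 0) : (basisDot K).repr e 1 = (e.1 0).2 := rfl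

@[simp] theorem basisCom_zero (e : Gens K 0 1 0) : (basisCom K).repr e 0 = e.2.1 0 := rfl

@[simp] theorem basisAnt_zero (e : Gens K 0 0 1) : (basisAnt K).repr e 0 = e.2.2 0 := rfl

@[simp] theorem basisComAnt_zero (e : Gens K 0 1 1) : (basisComAnt K).repr e 0 = e.2.1 0 := rfl

@[simp] theorem basisComAnt_one (e : Gens K 0 1 1) : (basisComAnt K).repr e 1 = e.2.2 0 := rfl

@[simp] theorem basisDotDot_zero (e : Gens K 2 0 0) (i : Fin 2) :
    (basisDotDot K).repr e (0, i) = (e.1 i).1 := rfl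

@[simp] theorem basisDotDot_one (e : Gens K 2 0 0) (i : Fin 2) :
    (basisDotDot K).repr e (1, i) = (e.1 i).2 := rfl

theorem isSigned_basisDot :
    IsSigned (basisDot K) (Gens.op K 1 0 0) ![1, 1] ![1, 0] := by
  intro e j
  fin_cases j <;> simp [Gens.op]

theorem isSigned_basisCom :
    IsSigned (basisCom K) (Gens.op K 0 1 0) ![1] ![0] := by
  intro e j
  fin_cases j; simp [Gens.op]

theorem isSigned_basisAnt :
    IsSigned (basisAnt K) (Gens.op K 0 0 1) ![-1] ![0] := by
  intro e j
  fin_cases j; simp [Gens.op]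

theorem isSigned_basisComAnt :
    IsSigned (basisComAnt K) (Gens.op K 0 1 1) ![1, -1] ![0, 1] := by
  intro e j
  fin_cases j <;> simp [Gens.op]

theorem isSigned_basisDotDot :
    IsSigned (basisDotDot K) (Gens.op K 2 0 0) (fun _ => 1) (fun j => (1 - j.1, j.2)) := by
  rintro e ⟨i, j⟩
  fin_cases i <;> simp [Gens.op]

theorem coef_dot_monL_even (k : Fin 3) (i j : Fin 2) :
    T3.coef (basisDot K) k i j (T3.monL (Gens.op K 1 0 0) (dot K 0) (dot K 0) 0 1 2) =
      if k = 2 ∧ i = 0 ∧ j = 0 then 1 else 0 := by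
  rw [T3.coef_monL]
  fin_cases i <;> fin_cases j <;> simp [dot]

theorem coef_dot_monR_even (k : Fin 3) (i j : Fin 2) :
    T3.coef (basisDot K) k i j (T3.monR (Gens.op K 1 0 0) (dot K 0) (dot K 0) 0 1 2) =
      if k = 0 ∧ i = 1 ∧ j = 0 then 1 else 0 := by
  rw [T3.coef_monR]
  fin_cases i <;> fin_cases j <;> simp [dot, Gens.op]

theorem coef_dot_monL_odd (k : Fin 3) (i j : Fin 2) :
    T3.coef (basisDot K) k i j (T3.monL (Gens.op K 1 0 0) (dot K 0) (dot K 0) 0 2 1) =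
      if k = 1 ∧ i = 0 ∧ j = 1 then 1 else 0 := by
  rw [T3.coef_monL]
  fin_cases i <;> fin_cases j <;> simp [dot, Gens.op]

theorem coef_dot_monR_odd (k : Fin 3) (i j : Fin 2) :
    T3.coef (basisDot K) k i j (T3.monR (Gens.op K 1 0 0) (dot K 0) (dot K 0) 0 2 1) =
      if k = 0 ∧ i = 1 ∧ j = 1 then 1 else 0 := by
  rw [T3.coef_monR]
  fin_cases i <;> fin_cases j <;> simp [dot, Gens.op]

theorem sub_add_one_fin (l i : Fin 3) : l - (i + 1) = l - i + 2 := by revert l i; decide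

theorem sub_add_two_fin (l i : Fin 3) : l - (i + 2) = l - i + 1 := by revert l i; decide

theorem add_one_add_one_fin (k : Fin 3) : k + 1 + 1 = k + 2 := by revert k; decide

theorem add_one_add_two_fin (k : Fin 3) : k + 1 + 2 = k := by revert k; decide

theorem add_two_add_one_fin (k : Fin 3) : k + 2 + 1 = k := by revert k; decide

theorem add_two_add_two_fin (k : Fin 3) : k + 2 + 2 = k + 1 := by revert k; decide

variable (K) in
/-- The relation `(x y) z = x (y z) + x (z y)`. -/
noncomputable def zinbRel : T3 K (Gens K 1 0 0) :=
  T3.monL (Gens.op K 1 0 0) (dot K 0) (dot K 0) 0 1 2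
    - T3.monR (Gens.op K 1 0 0) (dot K 0) (dot K 0) 0 1 2
    - T3.monR (Gens.op K 1 0 0) (dot K 0) (dot K 0) 0 2 1

theorem zinb_rel : (zinb K).rel = symSpan (Gens.op K 1 0 0) {zinbRel K} := rfl

/-- The equations of the relations of Zinbiel algebras. -/
noncomputable def zinbEq : Fin 2 → Fin 3 → T3 K (Gens K 1 0 0) →ₗ[K] K :=
  ![fun i => T3.coef (basisDot K) i 1 0 + T3.coef (basisDot K) (i + 1) 0 1
      + T3.coef (basisDot K) (i + 2) 0 0,
    fun i => T3.coef (basisDot K) i 1 1 + T3.coef (basisDot K) (i + 1) 0 1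
      + T3.coef (basisDot K) (i + 2) 0 0]

/-- The relation rewrites `(x y) z` into right-bracketed monomials. The equations are the six
coefficients of the normal form: each `x_i (x_j x_k)` receives its own coefficient and those of both
left-bracketed monomials starting with `x_i`. -/
theorem mem_zinb_rel {t : T3 K (Gens K 1 0 0)} :
    t ∈ (zinb K).rel ↔ ∀ b i, zinbEq b i t = 0 := by
  rw [zinb_rel]
  constructor
  · refine symSpan_eq_zero (fun b l i t => ?_) (fun b l i t h => ?_) ?_
    · fin_cases b <;> simp [zinbEq, T3.coef_perm_addLeft, add_sub_right_comm]
    · have h0 := h 0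
      have h1 := h 1
      simp only [zinbEq, Matrix.cons_val_zero, Matrix.cons_val_one, Matrix.cons_val,
        LinearMap.add_apply, LinearMap.sub_apply] at h0 h1
      fin_cases b <;>
        simp [zinbEq, T3.coef_perm_subLeft isSigned_basisDot, sub_add_one_fin, sub_add_two_fin] <;>
        grind
    · rintro _ rfl b i <;> fin_cases b <;>
        simp only [zinbEq, zinbRel, LinearMap.add_apply, LinearMap.sub_apply, map_sub, map_add,
          coef_dot_monL_even, coef_dot_monR_even, coef_dot_monL_odd, coef_dot_monR_odd] <;>
        fin_cases i <;> simp [coef_dot_monL_even, coef_dot_monR_even,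
      coef_dot_monL_odd, coef_dot_monR_odd]
  · intro h
    -- The permuted relations are weighted by the coefficients in `t` of their leading monomials
    -- `(x_l x_{l+1}) x_{l+2}` and `(x_l x_{l+2}) x_{l+1}`.
    refine mem_symSpan_of_coef isSigned_basisDot (fun _ : Unit => zinbRel K) (fun _ =>
      Set.mem_singleton _)
      (fun _ i => T3.coef (basisDot K) (i + 2) 0 0 t)
      (fun _ i => T3.coef (basisDot K) (i + 1) 0 1 t) fun k i j => ?_
    have h0 := h 0 k
    have h1 := h 1 k
    simp only [zinbEq, Matrix.cons_val_zero, Matrix.cons_val_one, Matrix.cons_val,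
      LinearMap.add_apply, LinearMap.sub_apply, add_one_add_one_fin, add_one_add_two_fin,
      add_two_add_one_fin, add_two_add_two_fin] at h0 h1
    simp only [zinbRel, map_sub, map_add, coef_dot_monL_even, coef_dot_monR_even,
      coef_dot_monL_odd, coef_dot_monR_odd,
      Finset.univ_unique, Finset.sum_singleton, add_one_add_one_fin, add_one_add_two_fin,
      add_two_add_one_fin, add_two_add_two_fin]
    fin_cases i <;> fin_cases j <;> simp <;> grind

variable (K) in
/-- The relation `(x y) z = x (y z)`. -/
noncomputable def assRel : T3 K (Gens K 1 0 0) :=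
  T3.monL (Gens.op K 1 0 0) (dot K 0) (dot K 0) 0 1 2
    - T3.monR (Gens.op K 1 0 0) (dot K 0) (dot K 0) 0 1 2

theorem ass_rel : (ass K).rel = symSpan (Gens.op K 1 0 0) {assRel K} := rfl

/-- The equations of the relations of associative algebras. -/
noncomputable def assEq : Fin 2 → Fin 3 → T3 K (Gens K 1 0 0) →ₗ[K] K :=
  ![fun i => T3.coef (basisDot K) i 1 0 + T3.coef (basisDot K) (i + 2) 0 0,
    fun i => T3.coef (basisDot K) i 1 1 + T3.coef (basisDot K) (i + 1) 0 1]

/-- For each of the six words, the coefficients of its two bracketings add up to zero. -/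
theorem mem_ass_rel {t : T3 K (Gens K 1 0 0)} :
    t ∈ (ass K).rel ↔ ∀ b i, assEq b i t = 0 := by
  rw [ass_rel]
  constructor
  · refine symSpan_eq_zero (fun b l i t => ?_) (fun b l i t h => ?_) ?_
    · fin_cases b <;> simp [assEq, T3.coef_perm_addLeft, add_sub_right_comm]
    · have h0 := h 0
      have h1 := h 1
      simp only [assEq, Matrix.cons_val_zero, Matrix.cons_val_one, Matrix.cons_val,
        LinearMap.add_apply, LinearMap.sub_apply] at h0 h1
      fin_cases b <;>
        simp [assEq, T3.coef_perm_subLeft isSigned_basisDot, sub_add_one_fin, sub_add_two_fin] <;>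
        grind
    · rintro _ rfl b i <;> fin_cases b <;>
        simp only [assEq, assRel, LinearMap.add_apply, LinearMap.sub_apply, map_sub, map_add,
          coef_dot_monL_even, coef_dot_monR_even, coef_dot_monL_odd, coef_dot_monR_odd] <;>
        fin_cases i <;> simp [coef_dot_monL_even, coef_dot_monR_even,
      coef_dot_monL_odd, coef_dot_monR_odd]
  · intro h
    refine mem_symSpan_of_coef isSigned_basisDot (fun _ : Unit => assRel K) (fun _ =>
      Set.mem_singleton _)
      (fun _ i => T3.coef (basisDot K) (i + 2) 0 0 t)
      (fun _ i => T3.coef (basisDot K) (i + 1) 0 1 t) fun k i j => ?_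
    have h0 := h 0 k
    have h1 := h 1 k
    simp only [assEq, Matrix.cons_val_zero, Matrix.cons_val_one, Matrix.cons_val,
      LinearMap.add_apply, LinearMap.sub_apply, add_one_add_one_fin, add_one_add_two_fin,
      add_two_add_one_fin, add_two_add_two_fin] at h0 h1
    simp only [assRel, map_sub, map_add, coef_dot_monL_even, coef_dot_monR_even,
      coef_dot_monL_odd, coef_dot_monR_odd,
      Finset.univ_unique, Finset.sum_singleton, add_one_add_one_fin, add_one_add_two_fin,
      add_two_add_one_fin, add_two_add_two_fin]
    fin_cases i <;> fin_cases j <;> simp <;> grind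

variable (K) in
/-- The relation `(x y) z - x (y z) = (x z) y - x (z y)`. -/
noncomputable def preLieRel : T3 K (Gens K 1 0 0) :=
  T3.monL (Gens.op K 1 0 0) (dot K 0) (dot K 0) 0 1 2
    - T3.monR (Gens.op K 1 0 0) (dot K 0) (dot K 0) 0 1 2
    - T3.monL (Gens.op K 1 0 0) (dot K 0) (dot K 0) 0 2 1
    + T3.monR (Gens.op K 1 0 0) (dot K 0) (dot K 0) 0 2 1

theorem preLie_rel : (preLie K).rel = symSpan (Gens.op K 1 0 0) {preLieRel K} := rfl

/-- The equations of the relations of pre-Lie algebras. -/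
noncomputable def preLieEq : Fin 3 → Fin 3 → T3 K (Gens K 1 0 0) →ₗ[K] K :=
  ![fun i => T3.coef (basisDot K) i 1 0 + T3.coef (basisDot K) i 1 1,
    fun i => T3.coef (basisDot K) i 1 0 + T3.coef (basisDot K) (i + 2) 0 0,
    fun i => T3.coef (basisDot K) i 1 1 + T3.coef (basisDot K) (i + 1) 0 1]

/-- For each `i`, the equations force the coefficients of `(x_i y) z`, `x_i (y z)`, `(x_i z) y`,
`x_i (z y)` to be `c, -c, -c, c`. -/
theorem mem_preLie_rel {t : T3 K (Gens K 1 0 0)} :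
    t ∈ (preLie K).rel ↔ ∀ b i, preLieEq b i t = 0 := by
  rw [preLie_rel]
  constructor
  · refine symSpan_eq_zero (fun b l i t => ?_) (fun b l i t h => ?_) ?_
    · fin_cases b <;> simp [preLieEq, T3.coef_perm_addLeft, add_sub_right_comm]
    · have h0 := h 0
      have h1 := h 1
      have h2 := h 2
      simp only [preLieEq, Matrix.cons_val_zero, Matrix.cons_val_one, Matrix.cons_val,
        LinearMap.add_apply, LinearMap.sub_apply] at h0 h1 h2
      fin_cases b <;>
        simp [preLieEq, T3.coef_perm_subLeft isSigned_basisDot, sub_add_one_fin,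
          sub_add_two_fin] <;>
        grind
    · rintro _ rfl b i <;> fin_cases b <;>
        simp only [preLieEq, preLieRel, LinearMap.add_apply, LinearMap.sub_apply, map_sub, map_add,
          coef_dot_monL_even, coef_dot_monR_even, coef_dot_monL_odd, coef_dot_monR_odd] <;>
        fin_cases i <;> simp [coef_dot_monL_even, coef_dot_monR_even,
      coef_dot_monL_odd, coef_dot_monR_odd]
  · intro h
    -- The relation is antisymmetric in its last two variables, so reflections give nothing new and
    -- have weight zero.
    refine mem_symSpan_of_coef isSigned_basisDot (fun _ : Unit => preLieRel K) (fun _ =>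
      Set.mem_singleton _)
      (fun _ i => T3.coef (basisDot K) (i + 2) 0 0 t)
      (fun _ i => 0) fun k i j => ?_
    have h0 := h 0 k
    have h1 := h 1 k
    have h2 := h 2 k
    have h0' := h 0 (k + 1)
    have h1' := h 1 (k + 1)
    have h2' := h 2 (k + 1)
    have h0'' := h 0 (k + 2)
    have h1'' := h 1 (k + 2)
    have h2'' := h 2 (k + 2)
    simp only [preLieEq, Matrix.cons_val_zero, Matrix.cons_val_one, Matrix.cons_val,
      LinearMap.add_apply, LinearMap.sub_apply, add_one_add_one_fin, add_one_add_two_fin,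
      add_two_add_one_fin, add_two_add_two_fin] at h0 h1 h2 h0' h1' h2' h0'' h1'' h2''
    simp only [preLieRel, map_sub, map_add, coef_dot_monL_even, coef_dot_monR_even,
      coef_dot_monL_odd, coef_dot_monR_odd,
      Finset.univ_unique, Finset.sum_singleton, add_one_add_one_fin, add_one_add_two_fin,
      add_two_add_one_fin, add_two_add_two_fin]
    fin_cases i <;> fin_cases j <;> simp <;> grind

variable (K) in
/-- The relation `(x y) z = x (y z)`. -/
noncomputable def permRel : T3 K (Gens K 1 0 0) :=
  T3.monL (Gens.op K 1 0 0) (dot K 0) (dot K 0) 0 1 2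
    - T3.monR (Gens.op K 1 0 0) (dot K 0) (dot K 0) 0 1 2

variable (K) in
/-- The relation `x (y z) = x (z y)`. -/
noncomputable def permRel' : T3 K (Gens K 1 0 0) :=
  T3.monR (Gens.op K 1 0 0) (dot K 0) (dot K 0) 0 1 2
    - T3.monR (Gens.op K 1 0 0) (dot K 0) (dot K 0) 0 2 1

theorem perm_rel : (perm K).rel = symSpan (Gens.op K 1 0 0) {permRel K, permRel' K} := rfl

/-- The equations of the relations of permutative algebras. -/
noncomputable def permEq : Fin 1 → Fin 3 → T3 K (Gens K 1 0 0) →ₗ[K] K :=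
  ![fun i => T3.coef (basisDot K) i 1 0 + T3.coef (basisDot K) i 1 1
      + T3.coef (basisDot K) (i + 1) 0 1 + T3.coef (basisDot K) (i + 2) 0 0]

/-- Modulo the relations, the four monomials with first variable `x_i` coincide, so only the sum of
their coefficients matters. -/
theorem mem_perm_rel {t : T3 K (Gens K 1 0 0)} :
    t ∈ (perm K).rel ↔ ∀ b i, permEq b i t = 0 := by
  rw [perm_rel]
  constructor
  · refine symSpan_eq_zero (fun b l i t => ?_) (fun b l i t h => ?_) ?_
    · fin_cases b <;> simp [permEq, T3.coef_perm_addLeft, add_sub_right_comm]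
    · have h0 := h 0
      simp only [permEq, Matrix.cons_val_zero, Matrix.cons_val_one, Matrix.cons_val,
        LinearMap.add_apply, LinearMap.sub_apply] at h0
      fin_cases b <;>
        simp [permEq, T3.coef_perm_subLeft isSigned_basisDot, sub_add_one_fin, sub_add_two_fin] <;>
        grind
    · rintro _ (rfl | rfl) b i <;> fin_cases b <;>
        simp only [permEq, permRel, permRel', LinearMap.add_apply, LinearMap.sub_apply, map_sub,
          map_add, coef_dot_monL_even, coef_dot_monR_even, coef_dot_monL_odd, coef_dot_monR_odd] <;>
        fin_cases i <;> simp [coef_dot_monL_even, coef_dot_monR_even,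
      coef_dot_monL_odd, coef_dot_monR_odd]
  · intro h
    -- Associativity first removes the left-bracketed monomials. The weight of the second relation
    -- is what is then left on `x_i (x_{i+1} x_{i+2})`.
    refine mem_symSpan_of_coef isSigned_basisDot ![permRel K,
      permRel' K] (fun a => by fin_cases a <;> simp)
      ![fun i => T3.coef (basisDot K) (i + 2) 0 0 t,
        fun i => T3.coef (basisDot K) i 1 0 t + T3.coef (basisDot K) (i + 2) 0 0 t]
      ![fun i => T3.coef (basisDot K) (i + 1) 0 1 t,
        fun i => 0] fun k i j => ?_
    have h0 := h 0 k
    simp only [permEq, Matrix.cons_val_zero, Matrix.cons_val_one, Matrix.cons_val,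
      LinearMap.add_apply, LinearMap.sub_apply, add_one_add_one_fin, add_one_add_two_fin,
      add_two_add_one_fin, add_two_add_two_fin] at h0
    simp only [permRel, permRel', map_sub, map_add, coef_dot_monL_even, coef_dot_monR_even,
      coef_dot_monL_odd, coef_dot_monR_odd,
      Fin.sum_univ_two, Matrix.cons_val_zero, Matrix.cons_val_one, Matrix.cons_val,
        add_one_add_one_fin, add_one_add_two_fin, add_two_add_one_fin, add_two_add_two_fin]
    fin_cases i <;> fin_cases j <;> simp <;> grind

variable (K) in
/-- The relation `(x y) z = x (y z) + (x z) y`. -/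
noncomputable def leibRel : T3 K (Gens K 1 0 0) :=
  T3.monL (Gens.op K 1 0 0) (dot K 0) (dot K 0) 0 1 2
    - T3.monR (Gens.op K 1 0 0) (dot K 0) (dot K 0) 0 1 2
    - T3.monL (Gens.op K 1 0 0) (dot K 0) (dot K 0) 0 2 1

theorem leib_rel : (leib K).rel = symSpan (Gens.op K 1 0 0) {leibRel K} := rfl

/-- The equations of the relations of Leibniz algebras. -/
noncomputable def leibEq : Fin 2 → Fin 3 → T3 K (Gens K 1 0 0) →ₗ[K] K :=
  ![fun i => T3.coef (basisDot K) (i + 2) 0 0 + T3.coef (basisDot K) i 1 0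
      - T3.coef (basisDot K) i 1 1,
    fun i => T3.coef (basisDot K) (i + 1) 0 1 + T3.coef (basisDot K) i 1 1
      - T3.coef (basisDot K) i 1 0]

/-- The relation is read as a rewriting of `x (y z)` into `(x y) z - (x z) y`, so that
left-bracketed monomials are the normal forms. This is why the weights below are minus the
coefficients of right-bracketed monomials. -/
theorem mem_leib_rel {t : T3 K (Gens K 1 0 0)} :
    t ∈ (leib K).rel ↔ ∀ b i, leibEq b i t = 0 := by
  rw [leib_rel]
  constructor
  · refine symSpan_eq_zero (fun b l i t => ?_) (fun b l i t h => ?_) ?_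
    · fin_cases b <;> simp [leibEq, T3.coef_perm_addLeft, add_sub_right_comm]
    · have h0 := h 0
      have h1 := h 1
      simp only [leibEq, Matrix.cons_val_zero, Matrix.cons_val_one, Matrix.cons_val,
        LinearMap.add_apply, LinearMap.sub_apply] at h0 h1
      fin_cases b <;>
        simp [leibEq, T3.coef_perm_subLeft isSigned_basisDot, sub_add_one_fin, sub_add_two_fin] <;>
        grind
    · rintro _ rfl b i <;> fin_cases b <;>
        simp only [leibEq, leibRel, LinearMap.add_apply, LinearMap.sub_apply, map_sub, map_add,
          coef_dot_monL_even, coef_dot_monR_even, coef_dot_monL_odd, coef_dot_monR_odd] <;>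
        fin_cases i <;> simp [coef_dot_monL_even, coef_dot_monR_even,
      coef_dot_monL_odd, coef_dot_monR_odd]
  · intro h
    refine mem_symSpan_of_coef isSigned_basisDot (fun _ : Unit => leibRel K) (fun _ =>
      Set.mem_singleton _)
      (fun _ i => -T3.coef (basisDot K) i 1 0 t)
      (fun _ i => -T3.coef (basisDot K) i 1 1 t) fun k i j => ?_
    have h0 := h 0 k
    have h1 := h 1 k
    have h0' := h 0 (k + 1)
    have h1' := h 1 (k + 1)
    have h0'' := h 0 (k + 2)
    have h1'' := h 1 (k + 2)
    simp only [leibEq, Matrix.cons_val_zero, Matrix.cons_val_one, Matrix.cons_val,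
      LinearMap.add_apply, LinearMap.sub_apply, add_one_add_one_fin, add_one_add_two_fin,
      add_two_add_one_fin, add_two_add_two_fin] at h0 h1 h0' h1' h0'' h1''
    simp only [leibRel, map_sub, map_add, coef_dot_monL_even, coef_dot_monR_even,
      coef_dot_monL_odd, coef_dot_monR_odd,
      Finset.univ_unique, Finset.sum_singleton, add_one_add_one_fin, add_one_add_two_fin,
      add_two_add_one_fin, add_two_add_two_fin]
    fin_cases i <;> fin_cases j <;> simp <;> grind

end Equations

/-! ### Equations for commutative, Lie, Poisson and dendriform relations -/

section MoreEquations

variable {K : Type u} [Field K]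

variable (K) in
/-- The associativity of a commutative product. -/
noncomputable def commRel : T3 K (Gens K 0 1 0) :=
  T3.monL (Gens.op K 0 1 0) (com K 0) (com K 0) 0 1 2
    - T3.monR (Gens.op K 0 1 0) (com K 0) (com K 0) 0 1 2

theorem comm_rel : (comm K).rel = symSpan (Gens.op K 0 1 0) {commRel K} := rfl

theorem coef_commRel (k : Fin 3) (i j : Fin 1) :
    T3.coef (basisCom K) k i j (commRel K) = ![-1, 0, 1] k := by
  rw [Subsingleton.elim i 0, Subsingleton.elim j 0]
  fin_cases k <;> simp [commRel, T3.coef_monL, T3.coef_monR, com, Gens.op]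

/-- The equations of the relations of commutative algebras. -/
noncomputable def commEq : Unit → Fin 3 → T3 K (Gens K 0 1 0) →ₗ[K] K :=
  fun _ i => T3.coef (basisCom K) i 0 0 + T3.coef (basisCom K) (i + 1) 0 0
    + T3.coef (basisCom K) (i + 2) 0 0

theorem mem_comm_rel {t : T3 K (Gens K 0 1 0)} :
    t ∈ (comm K).rel ↔ ∀ b i, commEq b i t = 0 := by
  rw [comm_rel]
  constructor
  · refine symSpan_eq_zero (fun b l i t => ?_) (fun b l i t h => ?_) ?_
    · simp [commEq, T3.coef_perm_addLeft, add_sub_right_comm]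
    · have h0 := h ()
      simp only [commEq, LinearMap.add_apply] at h0
      simp [commEq, T3.coef_perm_subLeft isSigned_basisCom, sub_add_one_fin, sub_add_two_fin]
      linear_combination h0
    · rintro _ rfl b i
      fin_cases i <;> simp [commEq, coef_commRel]
  · intro h
    -- The rotated relations are differences of two of the three monomials, and the weights are the
    -- partial sums of the coefficients, so the combination telescopes.
    refine mem_symSpan_of_coef isSigned_basisCom (fun _ : Unit => commRel K)
      (fun _ => Set.mem_singleton _)
      (fun _ => ![0, T3.coef (basisCom K) 0 0 0 t,
        T3.coef (basisCom K) 0 0 0 t + T3.coef (basisCom K) 1 0 0 t]) 0 fun k i j => ?_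
    have h0 := h () 0
    simp only [commEq, LinearMap.add_apply, zero_add] at h0
    rw [Subsingleton.elim i 0, Subsingleton.elim j 0]
    fin_cases k <;> simp [coef_commRel]
    linear_combination h0

variable (K) in
/-- The Jacobi identity. -/
noncomputable def lieRel : T3 K (Gens K 0 0 1) :=
  T3.monL (Gens.op K 0 0 1) (ant K 0) (ant K 0) 0 1 2
    + T3.monL (Gens.op K 0 0 1) (ant K 0) (ant K 0) 1 2 0
    + T3.monL (Gens.op K 0 0 1) (ant K 0) (ant K 0) 2 0 1

theorem lie_rel : (lie K).rel = symSpan (Gens.op K 0 0 1) {lieRel K} := rfl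

theorem coef_lieRel (k : Fin 3) (i j : Fin 1) :
    T3.coef (basisAnt K) k i j (lieRel K) = 1 := by
  rw [Subsingleton.elim i 0, Subsingleton.elim j 0]
  fin_cases k <;> simp [lieRel, T3.coef_monL, ant, Gens.op]

/-- The equations of the relations of Lie algebras. -/
noncomputable def lieEq : Fin 2 → Fin 3 → T3 K (Gens K 0 0 1) →ₗ[K] K :=
  ![fun i => T3.coef (basisAnt K) i 0 0 - T3.coef (basisAnt K) (i + 1) 0 0,
    fun i => T3.coef (basisAnt K) i 0 0 - T3.coef (basisAnt K) (i + 2) 0 0]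

/-- The Jacobi element has all coefficients equal to one and spans the relations, so membership
means that the three coefficients agree. -/
theorem mem_lie_rel {t : T3 K (Gens K 0 0 1)} :
    t ∈ (lie K).rel ↔ ∀ b i, lieEq b i t = 0 := by
  rw [lie_rel]
  constructor
  · refine symSpan_eq_zero (fun b l i t => ?_) (fun b l i t h => ?_) ?_
    · fin_cases b <;> simp [lieEq, T3.coef_perm_addLeft, add_sub_right_comm]
    · have h0 := h 0
      have h1 := h 1
      simp [lieEq] at h0 h1
      fin_cases b <;> simp [lieEq, T3.coef_perm_subLeft isSigned_basisAnt, sub_add_one_fin,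
        sub_add_two_fin] <;> grind
    · rintro _ rfl b i
      fin_cases b <;> simp [lieEq, coef_lieRel]
  · intro h
    refine mem_symSpan_of_coef isSigned_basisAnt (fun _ : Unit => lieRel K)
      (fun _ => Set.mem_singleton _)
      (fun _ => ![T3.coef (basisAnt K) 0 0 0 t, 0, 0]) 0 fun k i j => ?_
    have h0 := h 0 0
    have h1 := h 1 0
    simp [lieEq] at h0 h1
    rw [Subsingleton.elim i 0, Subsingleton.elim j 0]
    fin_cases k <;> simp [coef_lieRel] <;> grind

variable (K) in
/-- The relations of Poisson algebras. -/
noncomputable def poisRel : Fin 3 → T3 K (Gens K 0 1 1) :=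
  ![T3.monL (Gens.op K 0 1 1) (com K 0) (com K 0) 0 1 2
      - T3.monR (Gens.op K 0 1 1) (com K 0) (com K 0) 0 1 2,
    T3.monL (Gens.op K 0 1 1) (ant K 0) (ant K 0) 0 1 2
      + T3.monL (Gens.op K 0 1 1) (ant K 0) (ant K 0) 1 2 0
      + T3.monL (Gens.op K 0 1 1) (ant K 0) (ant K 0) 2 0 1,
    T3.monR (Gens.op K 0 1 1) (ant K 0) (com K 0) 0 1 2
      - T3.monL (Gens.op K 0 1 1) (com K 0) (ant K 0) 0 1 2
      - T3.monR (Gens.op K 0 1 1) (com K 0) (ant K 0) 1 0 2]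

theorem pois_rel : (pois K).rel = symSpan (Gens.op K 0 1 1) (Set.range (poisRel K)) := by
  have h : Set.range (poisRel K) = {poisRel K 0, poisRel K 1, poisRel K 2} := by
    ext t
    simp only [Set.mem_range, Fin.exists_fin_succ, Set.mem_insert_iff, Set.mem_singleton_iff]
    simp [eq_comm]
  rw [h]
  rfl

theorem coef_poisRel (a k : Fin 3) (i j : Fin 2) :
    T3.coef (basisComAnt K) k i j (poisRel K a) =
      ![![![![-1, 0], ![0, 0]], ![![0, 0], ![0, 0]], ![![1, 0], ![0, 0]]],
        ![![![0, 0], ![0, 1]], ![![0, 0], ![0, 1]], ![![0, 0], ![0, 1]]],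
        ![![![0, 0], ![-1, 0]], ![![0, 1], ![0, 0]], ![![0, -1], ![0, 0]]]] a k i j := by
  fin_cases a <;> fin_cases i <;> fin_cases j <;>
    simp [poisRel, T3.coef_monL, T3.coef_monR, com, ant, Gens.op] <;> fin_cases k <;> simp

/-- The equations of the relations of Poisson algebras. -/
noncomputable def poisEq : Fin 4 → Fin 3 → T3 K (Gens K 0 1 1) →ₗ[K] K :=
  ![fun i => T3.coef (basisComAnt K) i 0 0 + T3.coef (basisComAnt K) (i + 1) 0 0
      + T3.coef (basisComAnt K) (i + 2) 0 0,
    fun i => T3.coef (basisComAnt K) i 1 1 - T3.coef (basisComAnt K) (i + 1) 1 1,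
    fun i => T3.coef (basisComAnt K) i 1 1 - T3.coef (basisComAnt K) (i + 2) 1 1,
    fun i => T3.coef (basisComAnt K) i 0 1 + T3.coef (basisComAnt K) (i + 2) 1 0
      - T3.coef (basisComAnt K) (i + 1) 1 0]

/-- The system splits by type: associativity for `com`-`com`, Jacobi for `ant`-`ant`, and for mixed
monomials the normal form after expanding `[x_{k+1} x_{k+2}, x_k]` by the Leibniz rule. The
coefficient of `[x_{i+1}, x_{i+2}] x_i` then receives contributions of opposite signs from `k = i +
2` and `k = i + 1`. -/
theorem mem_pois_rel {t : T3 K (Gens K 0 1 1)} :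
    t ∈ (pois K).rel ↔ ∀ b i, poisEq b i t = 0 := by
  rw [pois_rel]
  constructor
  · refine symSpan_eq_zero (fun b l i t => ?_) (fun b l i t h => ?_) ?_
    · fin_cases b <;> simp [poisEq, T3.coef_perm_addLeft, add_sub_right_comm]
    · have h0 := h 0
      have h1 := h 1
      have h2 := h 2
      have h3 := h 3
      simp [poisEq] at h0 h1 h2 h3
      fin_cases b <;> simp [poisEq, T3.coef_perm_subLeft isSigned_basisComAnt, sub_add_one_fin,
        sub_add_two_fin] <;> grind
    · rintro _ ⟨a, rfl⟩ b i
      fin_cases b <;> simp only [poisEq, coef_poisRel, Matrix.cons_val, LinearMap.add_apply,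
        LinearMap.sub_apply, Fin.zero_eta, Fin.mk_one, Fin.reduceFinMk] <;>
        fin_cases a <;> fin_cases i <;> simp
  · intro h
    refine mem_symSpan_of_coef isSigned_basisComAnt (poisRel K) Set.mem_range_self
      ![![0, T3.coef (basisComAnt K) 0 0 0 t,
          T3.coef (basisComAnt K) 0 0 0 t + T3.coef (basisComAnt K) 1 0 0 t],
        ![T3.coef (basisComAnt K) 0 1 1 t, 0, 0],
        fun i => - T3.coef (basisComAnt K) i 1 0 t] 0 fun k i j => ?_
    have h0 := h 0 0
    have h1 := h 1 0
    have h2 := h 2 0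
    have h3 := h 3 k
    simp [poisEq] at h0 h1 h2 h3
    simp only [coef_poisRel, Fin.sum_univ_three]
    fin_cases i <;> fin_cases j <;> fin_cases k <;> simp at h3 ⊢ <;> grind

variable (K) in
/-- The relations of dendriform algebras. -/
noncomputable def dendRel : Fin 3 → T3 K (Gens K 2 0 0) :=
  ![T3.monL (Gens.op K 2 0 0) (dot K 0) (dot K 0) 0 1 2
      - T3.monR (Gens.op K 2 0 0) (dot K 0) (dot K 0) 0 1 2
      - T3.monR (Gens.op K 2 0 0) (dot K 0) (dot K 1) 0 1 2,
    T3.monL (Gens.op K 2 0 0) (dot K 0) (dot K 1) 0 1 2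
      - T3.monR (Gens.op K 2 0 0) (dot K 1) (dot K 0) 0 1 2,
    T3.monL (Gens.op K 2 0 0) (dot K 1) (dot K 0) 0 1 2
      + T3.monL (Gens.op K 2 0 0) (dot K 1) (dot K 1) 0 1 2
      - T3.monR (Gens.op K 2 0 0) (dot K 1) (dot K 1) 0 1 2]

theorem dend_rel : (dend K).rel = symSpan (Gens.op K 2 0 0) (Set.range (dendRel K)) := by
  have h : Set.range (dendRel K) = {dendRel K 0, dendRel K 1, dendRel K 2} := by
    ext t
    simp only [Set.mem_range, Fin.exists_fin_succ, Set.mem_insert_iff, Set.mem_singleton_iff]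
    simp [eq_comm]
  rw [h]
  rfl

theorem coef_dotDot_monL (a a' : Fin 2) (k : Fin 3) (i j x y : Fin 2) :
    T3.coef (basisDotDot K) k (i, x) (j, y)
      (T3.monL (Gens.op K 2 0 0) (dot K a) (dot K a') 0 1 2) =
      if k = 2 ∧ i = 0 ∧ j = 0 ∧ x = a ∧ y = a' then 1 else 0 := by
  rw [T3.coef_monL]
  fin_cases i <;> fin_cases j <;> fin_cases a <;> fin_cases a' <;> fin_cases x <;> fin_cases y <;>
    simp [dot]

theorem coef_dotDot_monR (a a' : Fin 2) (k : Fin 3) (i j x y : Fin 2) :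
    T3.coef (basisDotDot K) k (i, x) (j, y)
      (T3.monR (Gens.op K 2 0 0) (dot K a) (dot K a') 0 1 2) =
      if k = 0 ∧ i = 1 ∧ j = 0 ∧ x = a ∧ y = a' then 1 else 0 := by
  rw [T3.coef_monR]
  fin_cases i <;> fin_cases j <;> fin_cases a <;> fin_cases a' <;> fin_cases x <;> fin_cases y <;>
    simp [dot, Gens.op]

/-- The coefficient of `(x_i y x_{i + 1}) x x_{i + 2}`, or of `(x_i y x_{i + 2}) x x_{i + 1}`. -/
noncomputable def dendL (o x y : Fin 2) (i : Fin 3) : T3 K (Gens K 2 0 0) →ₗ[K] K :=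
  T3.coef (basisDotDot K) (if o = 0 then i + 2 else i + 1) (0, x) (o, y)

/-- The coefficient of `x_i x (x_{i + 1} y x_{i + 2})`, or of `x_i x (x_{i + 2} y x_{i + 1})`. -/
noncomputable def dendR (o x y : Fin 2) (i : Fin 3) : T3 K (Gens K 2 0 0) →ₗ[K] K :=
  T3.coef (basisDotDot K) i (1, x) (o, y)

/-- The equations of the relations of dendriform algebras. -/
noncomputable def dendEq (o : Fin 2) : Fin 5 → Fin 3 → T3 K (Gens K 2 0 0) →ₗ[K] K :=
  ![dendR o 0 0 + dendL o 0 0, dendR o 0 1 + dendL o 0 0, dendR o 1 0 + dendL o 0 1,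
    dendL o 1 0 - dendL o 1 1, dendR o 1 1 + dendL o 1 0]

-- The relations keep the order of the variables, so each word, given by its first variable `i` and
-- its orientation `o`, has its own space of eight monomials. Three relations leave five equations.
set_option maxHeartbeats 2000000 in
theorem mem_dend_rel {t : T3 K (Gens K 2 0 0)} :
    t ∈ (dend K).rel ↔ ∀ o b i, dendEq o b i t = 0 := by
  rw [dend_rel]
  constructor
  · intro ht o b i
    refine symSpan_eq_zero (g := fun p : Fin 2 × Fin 5 => dendEq p.1 p.2)
      (fun p l i t => ?_) (fun p l i t h => ?_) ?_ ht (o, b) i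
    · obtain ⟨o, b⟩ := p
      fin_cases o <;> fin_cases b <;>
        simp [dendEq, dendL, dendR, T3.coef_perm_addLeft, add_sub_right_comm]
    · obtain ⟨o, b⟩ := p
      -- A reflection exchanges the two orientations.
      have h' := h (1 - o, b)
      fin_cases o <;> fin_cases b <;>
        simp [dendEq, dendL, dendR, T3.coef_perm_subLeft isSigned_basisDotDot, sub_add_one_fin,
          sub_add_two_fin] at h' ⊢ <;> exact h'
    · rintro _ ⟨a, rfl⟩ ⟨o, b⟩ i
      fin_cases o <;> fin_cases b <;> fin_cases a <;>
        simp [dendEq, dendL, dendR, dendRel, coef_dotDot_monL, coef_dotDot_monR]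
  intro h
  refine mem_symSpan_of_coef isSigned_basisDotDot (dendRel K) Set.mem_range_self
      ![fun i => dendL 0 0 0 i t, fun i => dendL 0 0 1 i t, fun i => dendL 0 1 0 i t]
      ![fun i => dendL 1 0 0 i t, fun i => dendL 1 0 1 i t, fun i => dendL 1 1 0 i t]
      fun k ⟨i, x⟩ ⟨j, y⟩ => ?_
  have h0 := fun b => h 0 b k
  have h1 := fun b => h 1 b k
  have h2 := h 0 3 (k + 1)
  have h3 := h 1 3 (k + 2)
  simp only [Fin.forall_fin_succ] at h0 h1
  simp [dendEq, dendL, dendR, add_one_add_one_fin, add_one_add_two_fin,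
    add_two_add_one_fin, add_two_add_two_fin] at h0 h1 h2 h3
  simp only [dendRel, Fin.sum_univ_three, Matrix.cons_val, map_sub, map_add, coef_dotDot_monL,
    coef_dotDot_monR, dendL]
  fin_cases i <;> fin_cases j <;> fin_cases x <;> fin_cases y <;>
    simp [add_one_add_one_fin, add_one_add_two_fin,
    add_two_add_one_fin, add_two_add_two_fin] <;> grind

end MoreEquations

/-! ## The relations of white products as linear equations -/

section White

variable {K : Type u} [Field K] {E F : Type u} [AddCommGroup E] [Module K E] [AddCommGroup F]
  [Module K F]

/-- Right exactness of the tensor product: the kernel of a tensor product of two surjections is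
generated by the two kernels. -/
theorem whiteRel_eq_ker (R : Submodule K (T3 K E)) (S : Submodule K (T3 K F)) :
    whiteRel R S = LinearMap.ker (TensorProduct.map R.mkQ S.mkQ) := by
  have h := TensorProduct.map_ker (f := R.subtype) (g := R.mkQ) (f' := S.subtype) (g' := S.mkQ)
    (LinearMap.exact_subtype_mkQ R) R.mkQ_surjective (LinearMap.exact_subtype_mkQ S)
    S.mkQ_surjective
  rw [h, sup_comm]
  rfl

/-- A system of equations embeds each quotient into a coordinate space. The tensor product of the
two embeddings has the products of the equations as coordinates. -/
theorem mem_whiteRel_iff {R : Submodule K (T3 K E)} {S : Submodule K (T3 K F)} {α β : Type}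
    [Finite α] [Finite β] {g : α → T3 K E →ₗ[K] K} {h : β → T3 K F →ₗ[K] K}
    (hg : ∀ t, t ∈ R ↔ ∀ a, g a t = 0) (hh : ∀ t, t ∈ S ↔ ∀ b, h b t = 0)
    (z : T3 K E ⊗[K] T3 K F) :
    z ∈ whiteRel R S ↔
      ∀ a b, TensorProduct.lid K K (TensorProduct.map (g a) (h b) z) = 0 := by
  classical
  have hR : R = LinearMap.ker (LinearMap.pi g) := by
    ext t; rw [hg, LinearMap.mem_ker, funext_iff]; rfl
  have hS : S = LinearMap.ker (LinearMap.pi h) := by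
    ext t; rw [hh, LinearMap.mem_ker, funext_iff]; rfl
  let g' := R.liftQ (LinearMap.pi g) hR.le
  let h' := S.liftQ (LinearMap.pi h) hS.le
  have hg' : Function.Injective g' := LinearMap.ker_eq_bot.mp
    (Submodule.ker_liftQ_eq_bot _ _ _ hR.ge)
  have hh' : Function.Injective h' := LinearMap.ker_eq_bot.mp
    (Submodule.ker_liftQ_eq_bot _ _ _ hS.ge)
  -- Over a field all modules are flat, so a tensor product of injections is injective.
  have hinj := TensorProduct.map_injective_of_flat_flat g' h' hg' hh'
  have hcomp : TensorProduct.map (LinearMap.pi g) (LinearMap.pi h) =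
      TensorProduct.map g' h' ∘ₗ TensorProduct.map R.mkQ S.mkQ := by
    rw [← TensorProduct.map_comp]
    congr 1
  have := Fintype.ofFinite α
  have := Fintype.ofFinite β
  let B := (Pi.basisFun K α).tensorProduct (Pi.basisFun K β)
  have hB : ∀ a b, B.coord (a, b) ∘ₗ TensorProduct.map (LinearMap.pi g) (LinearMap.pi h) =
      (TensorProduct.lid K K).toLinearMap ∘ₗ TensorProduct.map (g a) (h b) := by
    intro a b
    refine TensorProduct.ext' fun x y => ?_
    simp [B, mul_comm]
  rw [whiteRel_eq_ker, LinearMap.mem_ker, ← map_eq_zero_iff _ hinj, ← LinearMap.comp_apply,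
    ← hcomp, ← B.forall_coord_eq_zero_iff]
  constructor
  · intro H a b
    exact (LinearMap.congr_fun (hB a b) z).symm.trans (H (a, b))
  · rintro H ⟨a, b⟩
    exact (LinearMap.congr_fun (hB a b) z).trans (H a b)

/-- The tensor product of two functionals, on the ternary operations of a white product. -/
noncomputable def T3.pair (g : T3 K E →ₗ[K] K) (h : T3 K F →ₗ[K] K) : T3 K (E ⊗[K] F) →ₗ[K] K :=
  (TensorProduct.lid K K).toLinearMap ∘ₗ TensorProduct.map g h ∘ₗ T3.split E F

theorem T3.split_single (k : Fin 3) (z : (E ⊗[K] F) ⊗[K] (E ⊗[K] F)) :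
    T3.split E F (Pi.single k z) =
      TensorProduct.map (LinearMap.single K (fun _ : Fin 3 => E ⊗[K] E) k)
        (LinearMap.single K (fun _ : Fin 3 => F ⊗[K] F) k)
        (TensorProduct.tensorTensorTensorComm K E F E F z) := by
  simp only [T3.split, LinearMap.sum_apply, LinearMap.comp_apply, LinearMap.proj_apply]
  rw [Finset.sum_eq_single k]
  · simp
  · intro j _ hj
    rw [Pi.single_eq_of_ne hj]; simp
  · simp

/-- The canonical map respects the summands: it sends the summand `k` to the tensor product of the
two summands `k`. Hence coefficients from different tree shapes pair to zero. -/
theorem T3.pair_coef {ι κ : Type} (b : Module.Basis ι K E) (b' : Module.Basis κ K F)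
    (k k' : Fin 3) (i j : ι) (i' j' : κ) :
    T3.pair (T3.coef b k i j) (T3.coef b' k' i' j') =
      if k = k' then T3.coef (b.tensorProduct b') k (i, i') (j, j') else 0 := by
  refine LinearMap.pi_ext' fun l => TensorProduct.ext_fourfold' fun x y x' y' => ?_
  have h1 : T3.pair (T3.coef b k i j) (T3.coef b' k' i' j')
      (Pi.single l ((x ⊗ₜ y) ⊗ₜ (x' ⊗ₜ y'))) =
      T3.coef b k i j (Pi.single l (x ⊗ₜ x')) * T3.coef b' k' i' j' (Pi.single l (y ⊗ₜ y')) := by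
    simp [T3.pair, T3.split_single]
  simp only [LinearMap.comp_apply, LinearMap.coe_single]
  rw [h1, T3.coef_single, T3.coef_single]
  split_ifs with h2 h3 h4 h5 h6
  · rw [T3.coef_single, if_pos h2]; simp; ring
  all_goals simp_all [T3.coef_single]

theorem T3.pair_add_left (g g' : T3 K E →ₗ[K] K) (h : T3 K F →ₗ[K] K) :
    T3.pair (g + g') h = T3.pair g h + T3.pair g' h := by
  simp [T3.pair, TensorProduct.map_add_left, LinearMap.add_comp, LinearMap.comp_add]

theorem T3.pair_add_right (g : T3 K E →ₗ[K] K) (h h' : T3 K F →ₗ[K] K) :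
    T3.pair g (h + h') = T3.pair g h + T3.pair g h' := by
  simp [T3.pair, TensorProduct.map_add_right, LinearMap.add_comp, LinearMap.comp_add]

theorem T3.pair_sub_left (g g' : T3 K E →ₗ[K] K) (h : T3 K F →ₗ[K] K) :
    T3.pair (g - g') h = T3.pair g h - T3.pair g' h := by
  rw [eq_sub_iff_add_eq, ← T3.pair_add_left, sub_add_cancel]

theorem mem_white_rel {O P : BinQuad K} {α β : Type} [Finite α] [Finite β]
    {g : α → Fin 3 → T3 K O.E →ₗ[K] K} {h : β → Fin 3 → T3 K P.E →ₗ[K] K}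
    (hg : ∀ t, t ∈ O.rel ↔ ∀ a i, g a i t = 0) (hh : ∀ t, t ∈ P.rel ↔ ∀ b i, h b i t = 0)
    {t : T3 K (O.E ⊗[K] P.E)} :
    t ∈ (O.white P).rel ↔ ∀ a i b j, T3.pair (g a i) (h b j) t = 0 := by
  refine (mem_whiteRel_iff (g := fun p : α × Fin 3 => g p.1 p.2)
    (h := fun p : β × Fin 3 => h p.1 p.2)
    (fun t => (hg t).trans ⟨fun H p => H p.1 p.2, fun H a i => H (a, i)⟩)
    (fun t => (hh t).trans ⟨fun H p => H p.1 p.2, fun H b i => H (b, i)⟩) _).trans ?_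
  exact ⟨fun H a i b j => H (a, i) (b, j), fun H p q => H p.1 p.2 q.1 q.2⟩

end White

/-! ## Isomorphisms -/

section Isomorphisms

variable {K : Type u} [Field K] {E F : Type u} [AddCommGroup E] [Module K E] [AddCommGroup F]
  [Module K F] {ι κ : Type}

/-- The equivalence which matches the elements of two bases up to scalars. -/
noncomputable def scaledEquiv (b : Module.Basis ι K E) (b' : Module.Basis κ K F) (e : κ ≃ ι)
    (s : κ → Kˣ) : E ≃ₗ[K] F :=
  b.equiv (b'.unitsSMul s) e.symm

theorem scaledEquiv_repr (b : Module.Basis ι K E) (b' : Module.Basis κ K F) (e : κ ≃ ι)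
    (s : κ → Kˣ) (x : E) (j : κ) :
    b'.repr (scaledEquiv b b' e s x) j = s j * b.repr x (e j) := by
  have h : b'.coord j ∘ₗ (scaledEquiv b b' e s).toLinearMap = (s j : K) • b.coord (e j) := by
    refine b.ext fun i => ?_
    obtain ⟨l, rfl⟩ := e.surjective i
    by_cases hl : l = j
    · subst hl; simp [scaledEquiv, Module.Basis.unitsSMul_apply, Units.smul_def]
    · simp [scaledEquiv, Module.Basis.unitsSMul_apply, Units.smul_def, hl]
  exact LinearMap.congr_fun h x

theorem scaledEquiv_τ {b : Module.Basis ι K E} {b' : Module.Basis κ K F} {e : κ ≃ ι}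
    {s : κ → Kˣ} {τ : E →ₗ[K] E} {τ' : F →ₗ[K] F} {r : ι → K} {r' : κ → K} {ε : ι → ι} {ε' : κ → κ}
    (hτ : IsSigned b τ r ε) (hτ' : IsSigned b' τ' r' ε')
    (h : ∀ j, ε (e j) = e (ε' j) ∧ s j * r (e j) = r' j * s (ε' j)) (x : E) :
    scaledEquiv b b' e s (τ x) = τ' (scaledEquiv b b' e s x) := by
  refine b'.ext_elem fun j => ?_
  rw [scaledEquiv_repr, hτ, hτ', scaledEquiv_repr, ← mul_assoc, ← mul_assoc, (h j).1, (h j).2]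

theorem T3.coef_map_scaledEquiv (b : Module.Basis ι K E) (b' : Module.Basis κ K F) (e : κ ≃ ι)
    (s : κ → Kˣ) (t : T3 K E) (k : Fin 3) (i j : κ) :
    T3.coef b' k i j (T3.map (scaledEquiv b b' e s).toLinearMap t) =
      s i * s j * T3.coef b k (e i) (e j) t :=
  T3.coef_map b b' _ _ e (scaledEquiv_repr b b' e s) t k i j

theorem IsSigned.neg {b : Module.Basis ι K E} {τ : E →ₗ[K] E} {r : ι → K} {ε : ι → ι}
    (h : IsSigned b τ r ε) : IsSigned b (-τ) (-r) ε := by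
  intro x j
  simp [h x j]

theorem IsSigned.tensorProduct {b : Module.Basis ι K E} {τ : E →ₗ[K] E} {r : ι → K} {ε : ι → ι}
    {b' : Module.Basis κ K F} {τ' : F →ₗ[K] F} {r' : κ → K} {ε' : κ → κ}
    (h : IsSigned b τ r ε) (h' : IsSigned b' τ' r' ε') :
    IsSigned (b.tensorProduct b') (TensorProduct.map τ τ') (fun p => r p.1 * r' p.2)
      (fun p => (ε p.1, ε' p.2)) := by
  rintro x ⟨i, j⟩
  have h1 : (b.tensorProduct b').coord (i, j) ∘ₗ TensorProduct.map τ τ' =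
      (r i * r' j) • (b.tensorProduct b').coord (ε i, ε' j) := by
    refine TensorProduct.ext' fun x y => ?_
    simp [h x i, h' y j]
    ring
  exact LinearMap.congr_fun h1 x

theorem IsSigned.prod {b : Module.Basis ι K E} {τ : E →ₗ[K] E} {r : ι → K} {ε : ι → ι}
    {b' : Module.Basis κ K F} {τ' : F →ₗ[K] F} {r' : κ → K} {ε' : κ → κ}
    (h : IsSigned b τ r ε) (h' : IsSigned b' τ' r' ε') :
    IsSigned (b.prod b') (τ.prodMap τ') (Sum.elim r r') (Sum.map ε ε') := by
  rintro ⟨x, y⟩ (i | i)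
  · simp [h x i]
  · simp [h' y i]

theorem isSigned_prodComm (b : Module.Basis ι K E) :
    IsSigned (b.prod b) (LinearEquiv.prodComm K E E).toLinearMap 1 Sum.swap := by
  rintro ⟨x, y⟩ (i | i) <;> simp

theorem T3.coef_single_tensor (b : Module.Basis ι K E) (k : Fin 3) (i j : ι) (k' : Fin 3)
    (z : E ⊗[K] E) : T3.coef b k i j (Pi.single k' z) =
      if k = k' then (b.tensorProduct b).coord (i, j) z else 0 := by
  split_ifs with h
  · subst h; simp [T3.coef]
  · simp [T3.coef, h]

theorem T3.coef_edgePart (b : Module.Basis ι K E) (k : Fin 3) (i j : ι) (l : Fin 3) (t : T3 K E) :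
    T3.coef b k i j (T3.edgePart K E l t) =
      (if k = l + 2 then T3.coef b k i j t else 0) -
        (if k = l + 1 then T3.coef b k i j t else 0) := by
  simp only [T3.edgePart, LinearMap.sub_apply, LinearMap.comp_apply, map_sub,
    LinearMap.coe_single, LinearMap.proj_apply, T3.coef_single_tensor]
  congr 1 <;> (split_ifs with h <;> simp [T3.coef, h])

theorem mem_lieCirc_rel_iff {O : BinQuad K} {β : Type} {g : β → Fin 3 → T3 K O.E →ₗ[K] K}
    (hg : ∀ t, t ∈ O.rel ↔ ∀ b i, g b i t = 0) {t : T3 K O.E} :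
    t ∈ (lieCirc O).rel ↔ ∀ l b i, g b i (T3.edgePart K O.E l t) = 0 :=
  mem_lieCirc_rel.trans (forall_congr' fun _ => hg _)

theorem forall_fin_three_iff {p : Fin 3 → Prop} (l : Fin 3) :
    (∀ i, p i) ↔ p l ∧ p (l + 1) ∧ p (l + 2) := by
  refine ⟨fun h => ⟨h _, h _, h _⟩, fun ⟨h0, h1, h2⟩ i => ?_⟩
  have h : ∀ i l : Fin 3, i = l ∨ i = l + 1 ∨ i = l + 2 := by decide
  rcases h i l with rfl | rfl | rfl <;> assumption

end Isomorphisms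

/-! ### Lie cochain operads of operads with one nonsymmetric generator -/

section LieCirc

variable {K : Type u} [Field K]

variable (K) in
/-- The equivalence which preserves a nonsymmetric operation and reverses the sign of the opposite
operation. -/
noncomputable def negOpEquiv : Gens K 1 0 0 ≃ₗ[K] Gens K 1 0 0 :=
  scaledEquiv (basisDot K) (basisDot K) (Equiv.refl _) ![1, -1]

theorem negOpEquiv_dot : negOpEquiv K (dot K 0) = dot K 0 := by
  refine (basisDot K).ext_elem fun j => ?_
  rw [negOpEquiv, scaledEquiv_repr]
  fin_cases j <;> simp [dot]

/-- The opposite operation in `lieCirc` carries a minus sign, which the sign on the second basis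
vector absorbs. -/
theorem negOpEquiv_τ (x : Gens K 1 0 0) :
    negOpEquiv K (-Gens.op K 1 0 0 x) = Gens.op K 1 0 0 (negOpEquiv K x) := by
  refine scaledEquiv_τ isSigned_basisDot.neg isSigned_basisDot (fun j => ?_) x
  fin_cases j <;> simp

theorem coef_negOpEquiv (t : T3 K (Gens K 1 0 0)) (k : Fin 3) (i j : Fin 2) :
    T3.coef (basisDot K) k i j (T3.map (negOpEquiv K).toLinearMap t) =
      ![1, -1] i * ![1, -1] j * T3.coef (basisDot K) k i j t := by
  rw [negOpEquiv, T3.coef_map_scaledEquiv]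
  fin_cases i <;> fin_cases j <;> simp

/-- Each Zinbiel equation has one term in every summand. Dropping one summand and giving the other
two opposite signs forces these terms to be equal. With the sign change on the opposite operation,
this is the pattern `c, -c, -c, c` of the pre-Lie relation. -/
theorem isEquiv_lieCirc_zinb : (lieCirc (zinb K)).IsEquiv (preLie K) (negOpEquiv K) where
  map_τ := negOpEquiv_τ
  map_rel_iff := by
    have key : ∀ t : T3 K (Gens K 1 0 0),
        (∀ b i, preLieEq b i (T3.map (negOpEquiv K).toLinearMap t) = 0) ↔
          ∀ l b i, zinbEq b i (T3.edgePart K (Gens K 1 0 0) l t) = 0 := by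
      intro t
      simp only [Fin.forall_fin_succ, Fin.forall_fin_zero, preLieEq, zinbEq, Matrix.cons_val,
        LinearMap.add_apply, LinearMap.sub_apply, coef_negOpEquiv, T3.coef_edgePart]
      simp [coef_negOpEquiv, T3.coef_edgePart]
      constructor <;> intro h <;> grind
    exact fun t => mem_preLie_rel.trans ((key t).trans
      (mem_lieCirc_rel_iff (O := zinb K) fun _ => mem_zinb_rel).symm)

/-- Grouping the permutative equation by summands leaves the sum of the two terms in the summand `i`
and one term in each of the others. The edge condition equates these three quantities, which is the
Leibniz system up to the sign change. -/
theorem isEquiv_lieCirc_perm : (lieCirc (perm K)).IsEquiv (leib K) (negOpEquiv K) where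
  map_τ := negOpEquiv_τ
  map_rel_iff := by
    have key : ∀ t : T3 K (Gens K 1 0 0),
        (∀ b i, leibEq b i (T3.map (negOpEquiv K).toLinearMap t) = 0) ↔
          ∀ l b i, permEq b i (T3.edgePart K (Gens K 1 0 0) l t) = 0 := by
      intro t
      simp only [Fin.forall_fin_succ, Fin.forall_fin_zero, leibEq, permEq, Matrix.cons_val,
        LinearMap.add_apply, LinearMap.sub_apply, coef_negOpEquiv, T3.coef_edgePart]
      simp [coef_negOpEquiv, T3.coef_edgePart]
      constructor <;> intro h <;> grind
    exact fun t => mem_leib_rel.trans ((key t).trans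
      (mem_lieCirc_rel_iff (O := perm K) fun _ => mem_perm_rel).symm)

theorem mem_mag_rel {p q r : ℕ} {t : T3 K (Gens K p q r)} : t ∈ (mag K p q r).rel ↔ t = 0 := by
  have h : (mag K p q r).rel = symSpan (Gens.op K p q r) ∅ := rfl
  rw [h, symSpan]
  simp only [Set.mem_empty_iff_false, false_and, exists_false, Set.ofPred_false,
    Submodule.span_empty]
  exact Submodule.mem_bot K

theorem eq_zero_iff_coef {E : Type u} [AddCommGroup E] [Module K E] {ι : Type}
    (b : Module.Basis ι K E) {t : T3 K E} : t = 0 ↔ ∀ k i j, T3.coef b k i j t = 0 :=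
  ⟨fun h => by simp [h], fun h => T3.ext_coef b fun k i j => by simp [h]⟩

/-- An associativity equation has two terms, in different summands. Each summand can be killed
separately, so every coefficient vanishes. -/
theorem isEquiv_lieCirc_ass : (lieCirc (ass K)).IsEquiv (mag K 1 0 0) (negOpEquiv K) where
  map_τ := negOpEquiv_τ
  map_rel_iff := by
    have key : ∀ t : T3 K (Gens K 1 0 0),
        (T3.map (negOpEquiv K).toLinearMap t = 0) ↔
          ∀ l b i, assEq b i (T3.edgePart K (Gens K 1 0 0) l t) = 0 := by
      intro t
      rw [eq_zero_iff_coef (basisDot K)]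
      simp only [Fin.forall_fin_succ, Fin.forall_fin_zero, assEq, Matrix.cons_val,
        LinearMap.add_apply, LinearMap.sub_apply, coef_negOpEquiv, T3.coef_edgePart]
      simp [coef_negOpEquiv, T3.coef_edgePart]
      constructor <;> intro h <;> grind
    exact fun t => mem_mag_rel.trans ((key t).trans
      (mem_lieCirc_rel_iff (O := ass K) fun _ => mem_ass_rel).symm)

/-- The pre-Lie equations include two-term ones linking different summands. As in the associative
case these already isolate every coefficient. -/
theorem isEquiv_lieCirc_preLie : (lieCirc (preLie K)).IsEquiv (mag K 1 0 0) (negOpEquiv K) where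
  map_τ := negOpEquiv_τ
  map_rel_iff := by
    have key : ∀ t : T3 K (Gens K 1 0 0),
        (T3.map (negOpEquiv K).toLinearMap t = 0) ↔
          ∀ l b i, preLieEq b i (T3.edgePart K (Gens K 1 0 0) l t) = 0 := by
      intro t
      rw [eq_zero_iff_coef (basisDot K)]
      simp only [Fin.forall_fin_succ, Fin.forall_fin_zero, preLieEq, Matrix.cons_val,
        LinearMap.add_apply, LinearMap.sub_apply, coef_negOpEquiv, T3.coef_edgePart]
      simp [coef_negOpEquiv, T3.coef_edgePart]
      constructor <;> intro h <;> grind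
    exact fun t => mem_mag_rel.trans ((key t).trans
      (mem_lieCirc_rel_iff (O := preLie K) fun _ => mem_preLie_rel).symm)

end LieCirc

/-! ### Lie cochain operads of Lie and Poisson algebras -/

section LieCircLie

variable {K : Type u} [Field K]

variable (K) in
/-- An anticommutative operation corresponds to a commutative operation. -/
noncomputable def antComEquiv : Gens K 0 0 1 ≃ₗ[K] Gens K 0 1 0 :=
  scaledEquiv (basisAnt K) (basisCom K) (Equiv.refl _) 1

theorem antComEquiv_ant : antComEquiv K (ant K 0) = com K 0 := by
  refine (basisCom K).ext_elem fun j => ?_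
  rw [antComEquiv, scaledEquiv_repr]
  fin_cases j; simp [ant, com]

theorem antComEquiv_τ (x : Gens K 0 0 1) :
    antComEquiv K (-Gens.op K 0 0 1 x) = Gens.op K 0 1 0 (antComEquiv K x) := by
  refine scaledEquiv_τ isSigned_basisAnt.neg isSigned_basisCom (fun j => ?_) x
  fin_cases j; simp

/-- The edge part has one zero coefficient, and the Lie equations make all three equal, hence zero.
-/
theorem isEquiv_lieCirc_lie : (lieCirc (lie K)).IsEquiv (mag K 0 1 0) (antComEquiv K) where
  map_τ := antComEquiv_τ
  map_rel_iff := by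
    have key : ∀ t : T3 K (Gens K 0 0 1),
        (T3.map (antComEquiv K).toLinearMap t = 0) ↔
          ∀ l b i, lieEq b i (T3.edgePart K (Gens K 0 0 1) l t) = 0 := by
      intro t
      rw [eq_zero_iff_coef (basisCom K)]
      simp only [Fin.forall_fin_succ, Fin.forall_fin_zero, lieEq, Matrix.cons_val,
        LinearMap.add_apply, LinearMap.sub_apply, antComEquiv, T3.coef_map_scaledEquiv,
        T3.coef_edgePart]
      simp [T3.coef_edgePart]
      constructor <;> intro h <;> grind
    exact fun t => mem_mag_rel.trans ((key t).trans
      (mem_lieCirc_rel_iff (O := lie K) fun _ => mem_lie_rel).symm)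

theorem BinQuad.mem_sum_rel_iff {O P : BinQuad K} (h : P.rel = ⊥) {t : T3 K (O.E × P.E)} :
    t ∈ (O.sum P).rel ↔ ∃ a ∈ O.rel, T3.map (LinearMap.inl K O.E P.E) a = t := by
  change t ∈ O.rel.map _ ⊔ P.rel.map _ ↔ _
  rw [h, Submodule.map_bot, sup_bot_eq]
  rfl

/-- As the magmatic factor has no relations, a relation of the sum has only bracket-bracket
components, and these satisfy the equations of `lie`. -/
theorem mem_lie_sum_mag_rel {t : T3 K (Gens K 0 0 1 × Gens K 0 1 0)} :
    t ∈ ((lie K).sum (mag K 0 1 0)).rel ↔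
      (∀ b i, lieEq b i (T3.map (LinearMap.fst K (Gens K 0 0 1) (Gens K 0 1 0)) t) = 0) ∧
      ∀ k, T3.coef ((basisAnt K).prod (basisCom K)) k (.inl 0) (.inr 0) t = 0 ∧
        T3.coef ((basisAnt K).prod (basisCom K)) k (.inr 0) (.inl 0) t = 0 ∧
        T3.coef ((basisAnt K).prod (basisCom K)) k (.inr 0) (.inr 0) t = 0 := by
  have hinl := fun x : T3 K (Gens K 0 0 1) => T3.coef_map (basisAnt K)
    ((basisAnt K).prod (basisCom K)) (LinearMap.inl K (Gens K 0 0 1) (Gens K 0 1 0))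
    (Sum.elim 1 0) (fun _ => 0)
    (by rintro e (j | j) <;> simp [Subsingleton.elim j 0]) x
  have hfst := fun x : T3 K (Gens K 0 0 1 × Gens K 0 1 0) =>
    T3.coef_map ((basisAnt K).prod (basisCom K)) (basisAnt K)
    (LinearMap.fst K (Gens K 0 0 1) (Gens K 0 1 0)) 1 Sum.inl (by intro e j; simp) x
  have key : (∃ a : T3 K (Gens K 0 0 1), (∀ b i, lieEq b i a = 0) ∧
      T3.map (LinearMap.inl K (Gens K 0 0 1) (Gens K 0 1 0)) a = t) ↔
      (∀ b i, lieEq b i (T3.map (LinearMap.fst K (Gens K 0 0 1) (Gens K 0 1 0)) t) = 0) ∧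
      ∀ k, T3.coef ((basisAnt K).prod (basisCom K)) k (.inl 0) (.inr 0) t = 0 ∧
        T3.coef ((basisAnt K).prod (basisCom K)) k (.inr 0) (.inl 0) t = 0 ∧
        T3.coef ((basisAnt K).prod (basisCom K)) k (.inr 0) (.inr 0) t = 0 := by
    constructor
    · rintro ⟨a, ha, rfl⟩
      refine ⟨fun b i => ?_, fun k => ?_⟩
      · rw [← T3.map_comp, LinearMap.fst_comp_inl, T3.map_id]
        exact ha b i
      · simp [hinl]
    · rintro ⟨h1, h2⟩
      refine ⟨_, h1, T3.ext_coef ((basisAnt K).prod (basisCom K)) fun k i j => ?_⟩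
      rw [hinl, hfst]
      obtain ⟨ha, hb, hc⟩ := h2 k
      rcases i with i | i <;> rcases j with j | j <;>
        rw [Subsingleton.elim i 0, Subsingleton.elim j 0] <;> simp [ha, hb, hc]
  refine (BinQuad.mem_sum_rel_iff (O := lie K) ?_).trans (Iff.trans ?_ key)
  · exact eq_bot_iff.mpr fun t ht => mem_mag_rel.mp ht
  · exact exists_congr fun a => and_congr_left' mem_lie_rel

/-- The two generators of a sum. -/
def sumFinEquiv : Fin 1 ⊕ Fin 1 ≃ Fin 2 where
  toFun := Sum.elim (fun _ => 0) (fun _ => 1)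
  invFun := ![.inl 0, .inr 0]
  left_inv := by decide
  right_inv := by decide

variable (K) in
/-- The brackets of a Poisson algebra: the commutative product gives an anticommutative operation,
the Poisson bracket gives a commutative operation. -/
noncomputable def poisEquiv : Gens K 0 1 1 ≃ₗ[K] Gens K 0 0 1 × Gens K 0 1 0 :=
  scaledEquiv (basisComAnt K) ((basisAnt K).prod (basisCom K)) sumFinEquiv 1

theorem poisEquiv_com : poisEquiv K (com K 0) = (ant K 0, 0) := by
  refine ((basisAnt K).prod (basisCom K)).ext_elem fun j => ?_
  rw [poisEquiv, scaledEquiv_repr]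
  rcases j with j | j <;> fin_cases j <;> simp [ant, com, sumFinEquiv]

theorem poisEquiv_ant : poisEquiv K (ant K 0) = (0, com K 0) := by
  refine ((basisAnt K).prod (basisCom K)).ext_elem fun j => ?_
  rw [poisEquiv, scaledEquiv_repr]
  rcases j with j | j <;> fin_cases j <;> simp [ant, com, sumFinEquiv]

theorem poisEquiv_τ (x : Gens K 0 1 1) : poisEquiv K (-Gens.op K 0 1 1 x) =
    (Gens.op K 0 0 1).prodMap (Gens.op K 0 1 0) (poisEquiv K x) := by
  refine scaledEquiv_τ isSigned_basisComAnt.neg (isSigned_basisAnt.prod isSigned_basisCom)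
    (fun j => ?_) x
  rcases j with j | j <;> fin_cases j <;> simp [sumFinEquiv]

/-- On `com`-`com` terms the edge condition turns the vanishing of the sum into equality of the
three coefficients, that is, the Jacobi identity. On `ant`-`ant` terms everything vanishes. On mixed
terms the three coefficients of products inside a bracket have pairwise sums zero, so twice each of
them is zero; this is where `h2` enters. The other mixed coefficients equal these. -/
theorem isEquiv_lieCirc_pois (h2 : (2 : K) ≠ 0) :
    (lieCirc (pois K)).IsEquiv ((lie K).sum (mag K 0 1 0)) (poisEquiv K) where
  map_τ := poisEquiv_τ
  map_rel_iff := by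
    have key : ∀ t : T3 K (Gens K 0 1 1),
        ((∀ b i, lieEq b i (T3.map (LinearMap.fst K (Gens K 0 0 1) (Gens K 0 1 0))
            (T3.map (poisEquiv K).toLinearMap t)) = 0) ∧
        ∀ k, T3.coef ((basisAnt K).prod (basisCom K)) k (.inl 0) (.inr 0)
              (T3.map (poisEquiv K).toLinearMap t) = 0 ∧
            T3.coef ((basisAnt K).prod (basisCom K)) k (.inr 0) (.inl 0)
              (T3.map (poisEquiv K).toLinearMap t) = 0 ∧
            T3.coef ((basisAnt K).prod (basisCom K)) k (.inr 0) (.inr 0)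
              (T3.map (poisEquiv K).toLinearMap t) = 0) ↔
          ∀ l b i, poisEq b i (T3.edgePart K (Gens K 0 1 1) l t) = 0 := by
      intro t
      have hfst : ∀ k, T3.coef (basisAnt K) k 0 0
          (T3.map (LinearMap.fst K (Gens K 0 0 1) (Gens K 0 1 0))
            (T3.map (poisEquiv K).toLinearMap t)) = T3.coef (basisComAnt K) k 0 0 t := by
        intro k
        rw [T3.coef_map ((basisAnt K).prod (basisCom K)) (basisAnt K)
          (LinearMap.fst K (Gens K 0 0 1) (Gens K 0 1 0)) 1 Sum.inl (by intro e j; simp),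
            poisEquiv, T3.coef_map_scaledEquiv]
        simp [sumFinEquiv]
      have h : ∀ k i j, T3.coef ((basisAnt K).prod (basisCom K)) k i j
          (T3.map (poisEquiv K).toLinearMap t) =
          T3.coef (basisComAnt K) k (sumFinEquiv i) (sumFinEquiv j) t := by
        intro k i j
        rw [poisEquiv, T3.coef_map_scaledEquiv]
        simp
      have f0 : (sumFinEquiv (Sum.inl 0 : Fin 1 ⊕ Fin 1)) = (0 : Fin 2) := rfl
      have f1 : (sumFinEquiv (Sum.inr 0 : Fin 1 ⊕ Fin 1)) = (1 : Fin 2) := rfl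
      simp only [Fin.forall_fin_succ, Fin.forall_fin_zero, lieEq, poisEq, Matrix.cons_val,
        LinearMap.add_apply, LinearMap.sub_apply, hfst, h, f0, f1]
      simp [T3.coef_edgePart, hfst]
      clear hfst h f0 f1
      constructor <;> intro h <;> grind
    exact fun t => mem_lie_sum_mag_rel.trans ((key t).trans
      (mem_lieCirc_rel_iff (O := pois K) fun _ => mem_pois_rel).symm)

end LieCircLie

/-! ### The associative cochain operad of Zinbiel algebras -/

section AssCirc

variable {K : Type u} [Field K]

/-- `∪ ⊗ ·` is `≺` and `∪ ⊗ ·^op` is `≻`. -/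
def cupIndexEquiv : Fin 2 × Fin 2 ≃ Fin 2 ⊕ Fin 2 where
  toFun p := ![.inl p.2, .inr p.2] p.1
  invFun := Sum.elim (fun x => (0, x)) (fun x => (1, x))
  left_inv := by decide
  right_inv := by decide

variable (K) in
/-- The products `∪ ⊗ ·` and `∪ ⊗ ·^op` correspond to `≺` and `≻`. -/
noncomputable def cupEquiv : (Gens K 1 0 0 × Gens K 1 0 0) ≃ₗ[K] Gens K 2 0 0 :=
  scaledEquiv ((basisDot K).prod (basisDot K)) (basisDotDot K) cupIndexEquiv 1

theorem cupEquiv_dot : cupEquiv K (dot K 0, 0) = dot K 0 := by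
  refine (basisDotDot K).ext_elem fun ⟨i, j⟩ => ?_
  rw [cupEquiv, scaledEquiv_repr]
  fin_cases i <;> fin_cases j <;> simp [dot, cupIndexEquiv]

theorem cupEquiv_op_dot : cupEquiv K (Gens.op K 1 0 0 (dot K 0), 0) = dot K 1 := by
  refine (basisDotDot K).ext_elem fun ⟨i, j⟩ => ?_
  rw [cupEquiv, scaledEquiv_repr]
  fin_cases i <;> fin_cases j <;> simp [dot, cupIndexEquiv, Gens.op]

theorem cupEquiv_τ (x : Gens K 1 0 0 × Gens K 1 0 0) :
    cupEquiv K (LinearEquiv.prodComm K _ _ x) = Gens.op K 2 0 0 (cupEquiv K x) := by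
  refine scaledEquiv_τ (isSigned_prodComm (basisDot K)) isSigned_basisDotDot (fun ⟨i, j⟩ => ?_) x
  fin_cases i <;> fin_cases j <;> simp [cupIndexEquiv]

theorem T3.coef_single_map {E F : Type u} [AddCommGroup E] [Module K E] [AddCommGroup F]
    [Module K F] {ι κ : Type} (b : Module.Basis ι K E) (b' : Module.Basis κ K F) (f g : E →ₗ[K] F)
    (ε ε' : κ → ι) (hf : ∀ e j, b'.repr (f e) j = b.repr e (ε j))
    (hg : ∀ e j, b'.repr (g e) j = b.repr e (ε' j)) (k l m : Fin 3) (i j : κ) (t : T3 K E) :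
    T3.coef b' k i j (Pi.single l (TensorProduct.map f g (t m))) =
      if k = l then T3.coef b m (ε i) (ε' j) t else 0 := by
  rw [T3.coef_single_tensor]
  congr 1
  have h : (b'.tensorProduct b').coord (i, j) ∘ₗ TensorProduct.map f g =
      (b.tensorProduct b).coord (ε i, ε' j) := by
    refine TensorProduct.ext' fun x y => ?_
    simp [hf, hg]
  exact LinearMap.congr_fun h (t m)

theorem coef_evenWord_zinb (k l : Fin 3) (i j : Fin 2) (t : T3 K (Gens K 1 0 0 × Gens K 1 0 0)) :
    T3.coef (basisDot K) k i j (evenWord (zinb K) l t) =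
      (if k = l then T3.coef ((basisDot K).prod (basisDot K)) l (.inr (![1, 0] i)) (.inl j) t
        else 0) +
      (if k = l + 2 then T3.coef ((basisDot K).prod (basisDot K)) (l + 2) (.inl i) (.inl j) t
        else 0) := by
  have h := isSigned_basisDot (K := K)
  have h1 := T3.coef_single_map ((basisDot K).prod (basisDot K)) (basisDot K)
    (Gens.op K 1 0 0 ∘ₗ LinearMap.snd K (Gens K 1 0 0) (Gens K 1 0 0))
    (LinearMap.fst K (Gens K 1 0 0) (Gens K 1 0 0)) (fun i => .inr (![1, 0] i)) .inl
    (by intro e j; rw [LinearMap.comp_apply, h]; fin_cases j <;> simp) (by intro e j; simp)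
    k l l i j t
  have h2 := T3.coef_single_map ((basisDot K).prod (basisDot K)) (basisDot K)
    (LinearMap.fst K (Gens K 1 0 0) (Gens K 1 0 0))
    (LinearMap.fst K (Gens K 1 0 0) (Gens K 1 0 0)) .inl .inl
    (by intro e j; simp) (by intro e j; simp) k (l + 2) (l + 2) i j t
  rw [← h1, ← h2, ← map_add]
  rfl

theorem coef_oddWord_zinb (k l : Fin 3) (i j : Fin 2) (t : T3 K (Gens K 1 0 0 × Gens K 1 0 0)) :
    T3.coef (basisDot K) k i j (oddWord (zinb K) l t) =
      (if k = l then T3.coef ((basisDot K).prod (basisDot K)) l (.inr (![1, 0] i))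
        (.inr (![1, 0] j)) t else 0) +
      (if k = l + 1 then T3.coef ((basisDot K).prod (basisDot K)) (l + 1) (.inl i)
        (.inr (![1, 0] j)) t else 0) := by
  have h := isSigned_basisDot (K := K)
  have h3 : ∀ (e : Gens K 1 0 0 × Gens K 1 0 0) j, (basisDot K).repr
      ((Gens.op K 1 0 0 ∘ₗ LinearMap.snd K (Gens K 1 0 0) (Gens K 1 0 0)) e) j =
      ((basisDot K).prod (basisDot K)).repr e (.inr (![1, 0] j)) := by
    intro e j; rw [LinearMap.comp_apply, h]; fin_cases j <;> simp
  have h1 := T3.coef_single_map ((basisDot K).prod (basisDot K)) (basisDot K)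
    (Gens.op K 1 0 0 ∘ₗ LinearMap.snd K (Gens K 1 0 0) (Gens K 1 0 0))
    (Gens.op K 1 0 0 ∘ₗ LinearMap.snd K (Gens K 1 0 0) (Gens K 1 0 0)) _ _ h3 h3 k l l i j t
  have h2 := T3.coef_single_map ((basisDot K).prod (basisDot K)) (basisDot K)
    (LinearMap.fst K (Gens K 1 0 0) (Gens K 1 0 0))
    (Gens.op K 1 0 0 ∘ₗ LinearMap.snd K (Gens K 1 0 0) (Gens K 1 0 0)) .inl _
    (by intro e j; simp) h3 k (l + 1) (l + 1) i j t
  rw [← h1, ← h2, ← map_add]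
  rfl

/-- A word meets two summands only, one for each bracketing. Of the six Zinbiel equations restricted
to it two coincide, and the remaining five are equivalent to the dendriform equations of that word.
-/
theorem dendEq_cupEquiv_iff (l : Fin 3) (t : T3 K (Gens K 1 0 0 × Gens K 1 0 0)) :
    ((∀ b i, zinbEq b i (evenWord (zinb K) l t) = 0) ↔
      ∀ b, dendEq 0 b l (T3.map (cupEquiv K).toLinearMap t) = 0) ∧
    ((∀ b i, zinbEq b i (oddWord (zinb K) l t) = 0) ↔
      ∀ b, dendEq 1 b l (T3.map (cupEquiv K).toLinearMap t) = 0) := by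
  constructor
  -- Only the coefficients of the word matter, so it is replaced by an arbitrary `s` with the same
  -- coefficients.
  · have key : ∀ s : T3 K (Gens K 1 0 0),
        (∀ k i j, T3.coef (basisDot K) k i j s = T3.coef (basisDot K) k i j (evenWord (zinb K) l
          t)) →
        ((∀ b i, zinbEq b i s = 0) ↔
          ∀ b, dendEq 0 b l (T3.map (cupEquiv K).toLinearMap t) = 0) := by
      intro s hs
      simp only [coef_evenWord_zinb] at hs
      simp only [Fin.forall_fin_succ (n := 1), Fin.forall_fin_succ (n := 0), Fin.forall_fin_zero,
        zinbEq, Matrix.cons_val, LinearMap.add_apply, hs, forall_fin_three_iff l]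
      fin_cases l <;> simp [hs, Fin.forall_fin_succ, dendEq, dendL, dendR, cupEquiv,
        T3.coef_map_scaledEquiv, cupIndexEquiv] <;> clear hs <;> constructor <;> intro h <;> grind
    exact key _ fun _ _ _ => rfl
  · have key : ∀ s : T3 K (Gens K 1 0 0),
        (∀ k i j, T3.coef (basisDot K) k i j s = T3.coef (basisDot K) k i j (oddWord (zinb K) l t))
          →
        ((∀ b i, zinbEq b i s = 0) ↔
          ∀ b, dendEq 1 b l (T3.map (cupEquiv K).toLinearMap t) = 0) := by
      intro s hs
      simp only [coef_oddWord_zinb] at hs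
      simp only [Fin.forall_fin_succ (n := 1), Fin.forall_fin_succ (n := 0), Fin.forall_fin_zero,
        zinbEq, Matrix.cons_val, LinearMap.add_apply, hs, forall_fin_three_iff l]
      fin_cases l <;> simp [hs, Fin.forall_fin_succ, dendEq, dendL, dendR, cupEquiv,
        T3.coef_map_scaledEquiv, cupIndexEquiv] <;> clear hs <;> constructor <;> intro h <;> grind
    exact key _ fun _ _ _ => rfl

theorem isEquiv_assCirc_zinb : (assCirc (zinb K)).IsEquiv (dend K) (cupEquiv K) where
  map_τ := cupEquiv_τ
  map_rel_iff := by
    have key : ∀ t : T3 K (Gens K 1 0 0 × Gens K 1 0 0),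
        (∀ o b i, dendEq o b i (T3.map (cupEquiv K).toLinearMap t) = 0) ↔
          ∀ l, (∀ b i, zinbEq b i (evenWord (zinb K) l t) = 0) ∧
            ∀ b i, zinbEq b i (oddWord (zinb K) l t) = 0 := by
      intro t
      simp only [(dendEq_cupEquiv_iff _ t).1, (dendEq_cupEquiv_iff _ t).2]
      exact ⟨fun h l => ⟨fun b => h 0 b l, fun b => h 1 b l⟩,
        fun h o b i => by fin_cases o; exacts [(h i).1 b, (h i).2 b]⟩
    exact fun t => mem_dend_rel.trans ((key t).trans
      (mem_assCirc_rel.trans (forall_congr' fun _ => and_congr mem_zinb_rel mem_zinb_rel)).symm)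

end AssCirc

/-! ### White products with the Zinbiel operad -/

section WhiteProducts

variable {K : Type u} [Field K]

/-- `e.symm` sends an operation of `Ass ⊗ Zinb` to an operation of `Dend`. -/
def assWhiteIndexEquiv : Fin 2 × Fin 2 ≃ Fin 2 × Fin 2 where
  -- Taking opposites acts on both tensor factors: the opposite of `∪ ⊗ ·` is `∪^op ⊗ ·^op`. The
  -- second index is therefore shifted by the first, modulo two.
  toFun p := (p.1, p.1 + p.2)
  invFun p := (p.1, p.1 + p.2)
  left_inv := by decide
  right_inv := by decide

variable (K) in
/-- The isomorphism of `Ass ∘ Zinb` with `Dend`, on generating operations. -/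
noncomputable def assWhiteEquiv : Gens K 1 0 0 ⊗[K] Gens K 1 0 0 ≃ₗ[K] Gens K 2 0 0 :=
  scaledEquiv ((basisDot K).tensorProduct (basisDot K)) (basisDotDot K) assWhiteIndexEquiv 1

variable (K) in
/-- The isomorphism of `Lie ∘ Zinb` with `preLie`, on generating operations. -/
noncomputable def lieWhiteEquiv : Gens K 0 0 1 ⊗[K] Gens K 1 0 0 ≃ₗ[K] Gens K 1 0 0 :=
  scaledEquiv ((basisAnt K).tensorProduct (basisDot K)) (basisDot K)
    (Equiv.uniqueProd (Fin 2) (Fin 1)).symm ![1, -1]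

variable (K) in
/-- The isomorphism of `Com ∘ Zinb` with `Zinb`, on generating operations. -/
noncomputable def commWhiteEquiv : Gens K 0 1 0 ⊗[K] Gens K 1 0 0 ≃ₗ[K] Gens K 1 0 0 :=
  scaledEquiv ((basisCom K).tensorProduct (basisDot K)) (basisDot K)
    (Equiv.uniqueProd (Fin 2) (Fin 1)).symm 1

theorem assWhiteEquiv_dot_dot : assWhiteEquiv K (dot K 0 ⊗ₜ dot K 0) = dot K 0 := by
  refine (basisDotDot K).ext_elem fun ⟨i, j⟩ => ?_
  rw [assWhiteEquiv, scaledEquiv_repr]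
  fin_cases i <;> fin_cases j <;> simp [dot, assWhiteIndexEquiv]

theorem assWhiteEquiv_dot_op :
    assWhiteEquiv K (dot K 0 ⊗ₜ Gens.op K 1 0 0 (dot K 0)) = dot K 1 := by
  refine (basisDotDot K).ext_elem fun ⟨i, j⟩ => ?_
  rw [assWhiteEquiv, scaledEquiv_repr]
  fin_cases i <;> fin_cases j <;> simp [dot, Gens.op, assWhiteIndexEquiv]

theorem assWhiteEquiv_τ (x : Gens K 1 0 0 ⊗[K] Gens K 1 0 0) :
    assWhiteEquiv K (TensorProduct.map (Gens.op K 1 0 0) (Gens.op K 1 0 0) x) =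
      Gens.op K 2 0 0 (assWhiteEquiv K x) := by
  refine scaledEquiv_τ (isSigned_basisDot.tensorProduct isSigned_basisDot) isSigned_basisDotDot
    (fun ⟨i, j⟩ => ?_) x
  fin_cases i <;> fin_cases j <;> simp [assWhiteIndexEquiv]

theorem lieWhiteEquiv_ant_dot : lieWhiteEquiv K (ant K 0 ⊗ₜ dot K 0) = dot K 0 := by
  refine (basisDot K).ext_elem fun j => ?_
  rw [lieWhiteEquiv, scaledEquiv_repr]
  fin_cases j <;> simp [dot, ant]

theorem lieWhiteEquiv_τ (x : Gens K 0 0 1 ⊗[K] Gens K 1 0 0) :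
    lieWhiteEquiv K (TensorProduct.map (Gens.op K 0 0 1) (Gens.op K 1 0 0) x) =
      Gens.op K 1 0 0 (lieWhiteEquiv K x) := by
  refine scaledEquiv_τ (isSigned_basisAnt.tensorProduct isSigned_basisDot) isSigned_basisDot
    (fun j => ?_) x
  fin_cases j <;> simp

theorem commWhiteEquiv_com_dot : commWhiteEquiv K (com K 0 ⊗ₜ dot K 0) = dot K 0 := by
  refine (basisDot K).ext_elem fun j => ?_
  rw [commWhiteEquiv, scaledEquiv_repr]
  fin_cases j <;> simp [dot, com]

theorem commWhiteEquiv_τ (x : Gens K 0 1 0 ⊗[K] Gens K 1 0 0) :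
    commWhiteEquiv K (TensorProduct.map (Gens.op K 0 1 0) (Gens.op K 1 0 0) x) =
      Gens.op K 1 0 0 (commWhiteEquiv K x) := by
  refine scaledEquiv_τ (isSigned_basisCom.tensorProduct isSigned_basisDot) isSigned_basisDot
    (fun j => ?_) x
  fin_cases j <;> simp

/-- The equations of `lie` are differences of coefficients of two summands. Pairing with them
equates the three terms of each Zinbiel equation, as for the cup brackets. -/
theorem isEquiv_lie_white_zinb : ((lie K).white (zinb K)).IsEquiv (preLie K) (lieWhiteEquiv K) where
  map_τ := lieWhiteEquiv_τ
  map_rel_iff := by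
    have key : ∀ t : T3 K (Gens K 0 0 1 ⊗[K] Gens K 1 0 0),
        (∀ b i, preLieEq b i (T3.map (lieWhiteEquiv K).toLinearMap t) = 0) ↔
          ∀ a i b j, T3.pair (lieEq a i) (zinbEq b j) t = 0 := by
      intro t
      simp only [Fin.forall_fin_succ, Fin.forall_fin_zero, preLieEq, lieEq, zinbEq,
        Matrix.cons_val, LinearMap.add_apply, LinearMap.sub_apply, lieWhiteEquiv,
        T3.coef_map_scaledEquiv]
      simp [T3.coef_map_scaledEquiv, T3.pair_add_right, T3.pair_sub_left, T3.pair_coef]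
      constructor <;> intro h <;> grind
    exact fun t => mem_preLie_rel.trans ((key t).trans
      (mem_white_rel (O := lie K) (P := zinb K) (fun _ => mem_lie_rel) fun _ => mem_zinb_rel).symm)

/-- The commutative equation sums all three summands with coefficient one, so pairing with it
returns the Zinbiel equations: `comm` acts as a unit. -/
theorem isEquiv_comm_white_zinb :
    ((comm K).white (zinb K)).IsEquiv (zinb K) (commWhiteEquiv K) where
  map_τ := commWhiteEquiv_τ
  map_rel_iff := by
    have key : ∀ t : T3 K (Gens K 0 1 0 ⊗[K] Gens K 1 0 0),
        (∀ b i, zinbEq b i (T3.map (commWhiteEquiv K).toLinearMap t) = 0) ↔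
          ∀ a i b j, T3.pair (commEq a i) (zinbEq b j) t = 0 := by
      intro t
      simp only [Fin.forall_fin_succ, Fin.forall_fin_zero, commEq, zinbEq,
        Matrix.cons_val, LinearMap.add_apply, LinearMap.sub_apply, commWhiteEquiv,
        T3.coef_map_scaledEquiv]
      simp [T3.coef_map_scaledEquiv, T3.pair_add_right, T3.pair_add_left, T3.pair_coef]
    exact fun t => mem_zinb_rel.trans ((key t).trans
      (mem_white_rel (O := comm K) (P := zinb K) (fun _ => mem_comm_rel)
        fun _ => mem_zinb_rel).symm)

/-- An associativity equation selects the two bracketings of one word. Pairing it with the Zinbiel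
equations gives the same system as the word parts of cup products. -/
theorem dendEq_assWhiteEquiv_iff (o : Fin 2) (t : T3 K (Gens K 1 0 0 ⊗[K] Gens K 1 0 0)) :
    (∀ b i, dendEq o b i (T3.map (assWhiteEquiv K).toLinearMap t) = 0) ↔
      ∀ i b j, T3.pair (assEq o i) (zinbEq b j) t = 0 := by
  refine forall_comm.trans (forall_congr' fun i => ?_)
  simp only [forall_fin_three_iff i]
  fin_cases o <;> fin_cases i <;> simp [Fin.forall_fin_succ, dendEq, dendL, dendR, assWhiteEquiv,
    T3.coef_map_scaledEquiv, assWhiteIndexEquiv, assEq, zinbEq, T3.pair_add_right, T3.pair_add_left,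
    T3.pair_coef] <;> constructor <;> intro h <;> grind

theorem isEquiv_ass_white_zinb : ((ass K).white (zinb K)).IsEquiv (dend K) (assWhiteEquiv K) where
  map_τ := assWhiteEquiv_τ
  map_rel_iff t := mem_dend_rel.trans ((forall_congr' fun o => dendEq_assWhiteEquiv_iff o t).trans
    (mem_white_rel (O := ass K) (P := zinb K) (fun _ => mem_ass_rel) fun _ => mem_zinb_rel).symm)

end WhiteProducts

/-! ## The rows of Chapoton's square -/

section Rows

variable {K : Type u} [Field K]

theorem BinQuad.IsMorphism.of_symSpan {O P : BinQuad K} {f : O.E →ₗ[K] P.E}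
    (hτ : ∀ e, f (O.τ e) = P.τ (f e)) {s : Set (T3 K O.E)} (hO : O.rel = symSpan O.τ s)
    (hs : ∀ a ∈ s, T3.map f a ∈ P.rel) : O.IsMorphism P f where
  map_τ := hτ
  map_rel := by
    have h : O.rel ≤ P.rel.comap (T3.map f) := by
      rw [hO]
      refine symSpan_le (fun σ t ht => ?_) hs
      rw [Submodule.mem_comap, T3.map_perm _ _ f hτ]
      exact P.rel_perm σ _ ht
    exact h

theorem T3.map_monL {E F : Type u} [AddCommGroup E] [Module K E] [AddCommGroup F] [Module K F]
    {f : E →ₗ[K] F} {τ : E →ₗ[K] E} {τ' : F →ₗ[K] F} (h : ∀ e, f (τ e) = τ' (f e)) (μ ν : E)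
    (x y z : Fin 3) : T3.map f (T3.monL τ μ ν x y z) = T3.monL τ' (f μ) (f ν) x y z := by
  rw [T3.monL, T3.monL, T3.map_single]
  split_ifs <;> simp [h]

theorem T3.map_monR {E F : Type u} [AddCommGroup E] [Module K E] [AddCommGroup F] [Module K F]
    {f : E →ₗ[K] F} {τ : E →ₗ[K] E} {τ' : F →ₗ[K] F} (h : ∀ e, f (τ e) = τ' (f e)) (μ ν : E)
    (x y z : Fin 3) : T3.map f (T3.monR τ μ ν x y z) = T3.monR τ' (f μ) (f ν) x y z := by
  rw [T3.monR, T3.map_monL h, h]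
  rfl

variable (K) in
/-- The commutator bracket. -/
def lieToAss : Gens K 0 0 1 →ₗ[K] Gens K 1 0 0 where
  toFun x := (fun _ => (x.2.2 0, -x.2.2 0), 0, 0)
  map_add' x y := (basisDot K).ext_elem fun j => by fin_cases j <;> simp [add_comm]
  map_smul' c x := (basisDot K).ext_elem fun j => by fin_cases j <;> simp

variable (K) in
/-- A commutative product, considered as an associative product. -/
def assToComm : Gens K 1 0 0 →ₗ[K] Gens K 0 1 0 where
  toFun x := (0, fun _ => (x.1 0).1 + (x.1 0).2, 0)
  map_add' x y := (basisCom K).ext_elem fun j => by fin_cases j; simp [add_add_add_comm]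
  map_smul' c x := (basisCom K).ext_elem fun j => by fin_cases j; simp [mul_add]

variable (K) in
/-- The pre-Lie product `x ≺ y - y ≻ x`. -/
def preLieToDend : Gens K 1 0 0 →ₗ[K] Gens K 2 0 0 where
  toFun x := (![x.1 0, -(x.1 0).swap], 0, 0)
  map_add' x y := (basisDotDot K).ext_elem fun ⟨i, j⟩ => by
    fin_cases i <;> fin_cases j <;> simp [add_comm]
  map_smul' c x := (basisDotDot K).ext_elem fun ⟨i, j⟩ => by
    fin_cases i <;> fin_cases j <;> simp

variable (K) in
/-- The dendriform structure of a Zinbiel algebra. -/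
def dendToZinb : Gens K 2 0 0 →ₗ[K] Gens K 1 0 0 where
  toFun x := (fun _ => x.1 0 + (x.1 1).swap, 0, 0)
  map_add' x y := (basisDot K).ext_elem fun j => by fin_cases j <;> simp [add_add_add_comm]
  map_smul' c x := (basisDot K).ext_elem fun j => by fin_cases j <;> simp [mul_add]

theorem lieToAss_ant : lieToAss K (ant K 0) = dot K 0 - Gens.op K 1 0 0 (dot K 0) := by
  refine (basisDot K).ext_elem fun j => ?_
  fin_cases j <;> simp [lieToAss, dot, ant, Gens.op]

theorem assToComm_dot : assToComm K (dot K 0) = com K 0 := by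
  refine (basisCom K).ext_elem fun j => ?_
  fin_cases j; simp [assToComm, dot, com]

theorem preLieToDend_dot : preLieToDend K (dot K 0) = dot K 0 - Gens.op K 2 0 0 (dot K 1) := by
  refine (basisDotDot K).ext_elem fun ⟨i, j⟩ => ?_
  fin_cases i <;> fin_cases j <;> simp [preLieToDend, dot, Gens.op]

theorem dendToZinb_dot_zero : dendToZinb K (dot K 0) = dot K 0 := by
  refine (basisDot K).ext_elem fun j => ?_
  fin_cases j <;> simp [dendToZinb, dot]

theorem dendToZinb_dot_one : dendToZinb K (dot K 1) = Gens.op K 1 0 0 (dot K 0) := by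
  refine (basisDot K).ext_elem fun j => ?_
  fin_cases j <;> simp [dendToZinb, dot, Gens.op]

theorem lieToAss_τ (x : Gens K 0 0 1) :
    lieToAss K (Gens.op K 0 0 1 x) = Gens.op K 1 0 0 (lieToAss K x) := by
  refine (basisDot K).ext_elem fun j => ?_
  fin_cases j <;> simp [lieToAss, Gens.op]

theorem assToComm_τ (x : Gens K 1 0 0) :
    assToComm K (Gens.op K 1 0 0 x) = Gens.op K 0 1 0 (assToComm K x) := by
  refine (basisCom K).ext_elem fun j => ?_
  fin_cases j; simp [assToComm, Gens.op, add_comm]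

theorem preLieToDend_τ (x : Gens K 1 0 0) :
    preLieToDend K (Gens.op K 1 0 0 x) = Gens.op K 2 0 0 (preLieToDend K x) := by
  refine (basisDotDot K).ext_elem fun ⟨i, j⟩ => ?_
  fin_cases i <;> fin_cases j <;> simp [preLieToDend, Gens.op]

theorem dendToZinb_τ (x : Gens K 2 0 0) :
    dendToZinb K (Gens.op K 2 0 0 x) = Gens.op K 1 0 0 (dendToZinb K x) := by
  refine (basisDot K).ext_elem fun j => ?_
  fin_cases j <;> simp [dendToZinb, Gens.op]

/-- In the Jacobi sum of commutators, the two bracketings of each word occur with opposite signs. -/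
theorem isMorphism_lieToAss : (lie K).IsMorphism (ass K) (lieToAss K) := by
  refine .of_symSpan lieToAss_τ lie_rel ?_
  have hL := T3.map_monL (f := lieToAss K) (τ := Gens.op K 0 0 1) (τ' := Gens.op K 1 0 0) lieToAss_τ
  have key : ∀ b i, assEq b i (T3.map (lieToAss K) (lieRel K)) = 0 := by
    intro b i
    simp only [lieRel, map_add, hL, lieToAss_ant]
    fin_cases b <;> fin_cases i <;> simp [assEq, T3.coef_monL, dot, Gens.op]
  rintro _ rfl
  exact mem_ass_rel.mpr key

theorem isMorphism_assToComm : (ass K).IsMorphism (comm K) (assToComm K) := by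
  refine .of_symSpan assToComm_τ ass_rel ?_
  have hL := T3.map_monL (f := assToComm K) (τ := Gens.op K 1 0 0) (τ' := Gens.op K 0 1 0)
    assToComm_τ
  have hR := T3.map_monR (f := assToComm K) (τ := Gens.op K 1 0 0) (τ' := Gens.op K 0 1 0)
    assToComm_τ
  have key : ∀ b i, commEq b i (T3.map (assToComm K) (assRel K)) = 0 := by
    intro b i
    simp only [assRel, map_sub, hL, hR, assToComm_dot]
    fin_cases i <;> simp [commEq, T3.coef_monL, T3.coef_monR, com, Gens.op]
  rintro _ rfl
  exact mem_comm_rel.mpr key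

theorem isMorphism_preLieToDend : (preLie K).IsMorphism (dend K) (preLieToDend K) := by
  refine .of_symSpan preLieToDend_τ preLie_rel ?_
  have hL := T3.map_monL (f := preLieToDend K) (τ := Gens.op K 1 0 0) (τ' := Gens.op K 2 0 0)
    preLieToDend_τ
  have hR := T3.map_monR (f := preLieToDend K) (τ := Gens.op K 1 0 0) (τ' := Gens.op K 2 0 0)
    preLieToDend_τ
  have key : ∀ o b i, dendEq o b i (T3.map (preLieToDend K) (preLieRel K)) = 0 := by
    intro o b i
    simp only [preLieRel, map_sub, map_add, hL, hR,
      preLieToDend_dot]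
    fin_cases o <;> fin_cases b <;> fin_cases i <;>
      simp [dendEq, dendL, dendR, T3.coef_monL, T3.coef_monR, dot, Gens.op]
  rintro _ rfl
  exact mem_dend_rel.mpr key

theorem isMorphism_dendToZinb : (dend K).IsMorphism (zinb K) (dendToZinb K) := by
  refine .of_symSpan dendToZinb_τ dend_rel ?_
  have hL := T3.map_monL (f := dendToZinb K) (τ := Gens.op K 2 0 0) (τ' := Gens.op K 1 0 0)
    dendToZinb_τ
  have hR := T3.map_monR (f := dendToZinb K) (τ := Gens.op K 2 0 0) (τ' := Gens.op K 1 0 0)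
    dendToZinb_τ
  have key : ∀ a b i, zinbEq b i (T3.map (dendToZinb K) (dendRel K a)) = 0 := by
    intro a b i
    fin_cases a <;> simp only [dendRel, Fin.zero_eta, Fin.mk_one, Fin.reduceFinMk, Matrix.cons_val,
      map_sub, map_add, hL, hR, dendToZinb_dot_zero,
      dendToZinb_dot_one] <;>
    fin_cases b <;> fin_cases i <;> simp [zinbEq, T3.coef_monL, T3.coef_monR, dot, Gens.op]
  rintro _ ⟨a, rfl⟩
  exact mem_zinb_rel.mpr (key a)

theorem preLieToDend_repr (x : Gens K 1 0 0) (i j : Fin 2) :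
    (basisDotDot K).repr (preLieToDend K x) (i, j) = ![1, -1] j * (basisDot K).repr x (i + j) := by
  fin_cases i <;> fin_cases j <;> simp [preLieToDend]

theorem dendToZinb_repr (x : Gens K 2 0 0) (i : Fin 2) :
    (basisDot K).repr (dendToZinb K x) i =
      (basisDotDot K).repr x (i, 0) + (basisDotDot K).repr x (i + 1, 1) := by
  fin_cases i <;> simp [dendToZinb]

/-- The left square on generators: `(∪ - ∪^op) ⊗ ·` corresponds to `≺ - ≻^op`, because `∪^op ⊗ ·` is
the opposite of `∪ ⊗ ·^op`. -/
theorem assWhiteEquiv_lieToAss : (assWhiteEquiv K).toLinearMap ∘ₗ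
    TensorProduct.map (lieToAss K) LinearMap.id =
      preLieToDend K ∘ₗ (lieWhiteEquiv K).toLinearMap := by
  refine TensorProduct.ext' fun x y => (basisDotDot K).ext_elem fun ⟨i, j⟩ => ?_
  simp only [LinearMap.comp_apply, LinearEquiv.coe_coe, assWhiteEquiv, lieWhiteEquiv,
    preLieToDend_repr, scaledEquiv_repr]
  fin_cases i <;> fin_cases j <;> simp [lieToAss, assWhiteIndexEquiv]

theorem commWhiteEquiv_assToComm : (commWhiteEquiv K).toLinearMap ∘ₗ
    TensorProduct.map (assToComm K) LinearMap.id =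
      dendToZinb K ∘ₗ (assWhiteEquiv K).toLinearMap := by
  refine TensorProduct.ext' fun x y => (basisDot K).ext_elem fun j => ?_
  simp only [LinearMap.comp_apply, LinearEquiv.coe_coe, commWhiteEquiv, assWhiteEquiv,
    dendToZinb_repr, scaledEquiv_repr]
  fin_cases j <;> simp [assToComm, assWhiteIndexEquiv] <;> ring

/-- Compatibility with the white-product relations is transported from the known morphism
`preLieToDend` through the isomorphisms, instead of being checked on tensors. -/
theorem isMorphism_lie_white_zinb : ((lie K).white (zinb K)).IsMorphism ((ass K).white (zinb K))
    (TensorProduct.map (lieToAss K) (LinearMap.id (M := Gens K 1 0 0)) :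
      (lie K).E ⊗[K] (zinb K).E →ₗ[K] (ass K).E ⊗[K] (zinb K).E) :=
  .of_comp_equiv isEquiv_ass_white_zinb
    (isMorphism_preLieToDend.comp isEquiv_lie_white_zinb.isMorphism) assWhiteEquiv_lieToAss

theorem isMorphism_ass_white_zinb : ((ass K).white (zinb K)).IsMorphism ((comm K).white (zinb K))
    (TensorProduct.map (assToComm K) (LinearMap.id (M := Gens K 1 0 0)) :
      (ass K).E ⊗[K] (zinb K).E →ₗ[K] (comm K).E ⊗[K] (zinb K).E) :=
  .of_comp_equiv isEquiv_comm_white_zinb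
    (isMorphism_dendToZinb.comp isEquiv_ass_white_zinb.isMorphism) commWhiteEquiv_assToComm

end Rows

end Operads

/-! ### The isomorphisms and the two commuting squares -/

theorem mainTheorem7 (K : Type u) [Field K] :
    -- the cochain constructions
    (lieCirc (zinb K)).IsoWith (preLie K)
      {(dot K 0, dot K 0)} ∧
    (assCirc (zinb K)).IsoWith (dend K)
      {((dot K 0, 0), dot K 0),
        ((Gens.op K 1 0 0 (dot K 0), 0), dot K 1)} ∧
    (lieCirc (ass K)).IsoWith (mag K 1 0 0)
      {(dot K 0, dot K 0)} ∧
    (lieCirc (preLie K)).IsoWith (mag K 1 0 0)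
      {(dot K 0, dot K 0)} ∧
    (lieCirc (lie K)).IsoWith (mag K 0 1 0)
      {(ant K 0, com K 0)} ∧
    ((2 : K) ≠ 0 →
      (lieCirc (pois K)).IsoWith ((lie K).sum (mag K 0 1 0))
        {(com K 0, (ant K 0, 0)), (ant K 0, (0, com K 0))}) ∧
    (lieCirc (perm K)).IsoWith (leib K)
      {(dot K 0, dot K 0)} ∧
    -- the top row is the white product of the middle row with Zinb, as a diagram of operads
    (∃ (i : SymOperad.Hom (lie K).operad (ass K).operad)
      (j : SymOperad.Hom (ass K).operad (comm K).operad)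
      (i' : SymOperad.Hom (preLie K).operad (dend K).operad)
      (j' : SymOperad.Hom (dend K).operad (zinb K).operad)
      (iZ : SymOperad.Hom ((lie K).white (zinb K)).operad
        ((ass K).white (zinb K)).operad)
      (jZ : SymOperad.Hom ((ass K).white (zinb K)).operad
        ((comm K).white (zinb K)).operad)
      (a : SymOperad.Hom ((lie K).white (zinb K)).operad
        (preLie K).operad)
      (b : SymOperad.Hom ((ass K).white (zinb K)).operad
        (dend K).operad)
      (c : SymOperad.Hom ((comm K).white (zinb K)).operad
        (zinb K).operad),
      -- the middle row
      i.app (Fin 2) ((lie K).gen (ant K 0)) =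
        (ass K).gen (dot K 0 - Gens.op K 1 0 0 (dot K 0)) ∧
      j.app (Fin 2) ((ass K).gen (dot K 0)) =
        (comm K).gen (com K 0) ∧
      -- the top row
      i'.app (Fin 2) ((preLie K).gen (dot K 0)) =
        (dend K).gen (dot K 0 - Gens.op K 2 0 0 (dot K 1)) ∧
      j'.app (Fin 2) ((dend K).gen (dot K 0)) =
        (zinb K).gen (dot K 0) ∧
      j'.app (Fin 2) ((dend K).gen (dot K 1)) =
        (zinb K).gen (Gens.op K 1 0 0 (dot K 0)) ∧
      -- the white product of the middle row with Zinb
      (∀ z : (zinb K).E,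
        iZ.app (Fin 2) (((lie K).white (zinb K)).gen
            (TensorProduct.tmul K (M := (lie K).E) (ant K 0) z)) =
          ((ass K).white (zinb K)).gen
            (TensorProduct.tmul K (M := (ass K).E)
              (dot K 0 - Gens.op K 1 0 0 (dot K 0)) z)) ∧
      (∀ z : (zinb K).E,
        jZ.app (Fin 2) (((ass K).white (zinb K)).gen
            (TensorProduct.tmul K (M := (ass K).E) (dot K 0) z)) =
          ((comm K).white (zinb K)).gen
            (TensorProduct.tmul K (M := (comm K).E) (com K 0) z)) ∧
      -- the isomorphisms, and their values on the generating operations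
      a.IsIso ∧ b.IsIso ∧ c.IsIso ∧
      a.app (Fin 2) (((lie K).white (zinb K)).gen
          (TensorProduct.tmul K (M := (lie K).E) (N := (zinb K).E) (ant K 0) (dot K 0))) =
        (preLie K).gen (dot K 0) ∧
      b.app (Fin 2) (((ass K).white (zinb K)).gen
          (TensorProduct.tmul K (M := (ass K).E) (N := (zinb K).E) (dot K 0) (dot K 0))) =
        (dend K).gen (dot K 0) ∧
      b.app (Fin 2) (((ass K).white (zinb K)).gen
          (TensorProduct.tmul K (M := (ass K).E) (N := (zinb K).E) (dot K 0) (Gens.op K 1 0 0 (dot K 0)))) =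
        (dend K).gen (dot K 1) ∧
      c.app (Fin 2) (((comm K).white (zinb K)).gen
          (TensorProduct.tmul K (M := (comm K).E) (N := (zinb K).E) (com K 0) (dot K 0))) =
        (zinb K).gen (dot K 0) ∧
      -- the two squares commute
      (∀ (X : Type) [Finite X] (t : ((lie K).white (zinb K)).operad.obj X),
        i'.app X (a.app X t) = b.app X (iZ.app X t)) ∧
      (∀ (X : Type) [Finite X] (t : ((ass K).white (zinb K)).operad.obj X),
        j'.app X (b.app X t) = c.app X (jZ.app X t))) := by
  refine ⟨isEquiv_lieCirc_zinb.isoWith ?_, isEquiv_assCirc_zinb.isoWith ?_,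
    isEquiv_lieCirc_ass.isoWith ?_, isEquiv_lieCirc_preLie.isoWith ?_,
    isEquiv_lieCirc_lie.isoWith ?_, fun h2 => (isEquiv_lieCirc_pois h2).isoWith ?_,
    isEquiv_lieCirc_perm.isoWith ?_,
    BinQuad.hom _ isMorphism_lieToAss, BinQuad.hom _ isMorphism_assToComm,
    BinQuad.hom _ isMorphism_preLieToDend, BinQuad.hom _ isMorphism_dendToZinb,
    BinQuad.hom _ isMorphism_lie_white_zinb, BinQuad.hom _ isMorphism_ass_white_zinb,
    BinQuad.hom _ isEquiv_lie_white_zinb.isMorphism,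
    BinQuad.hom _ isEquiv_ass_white_zinb.isMorphism,
    BinQuad.hom _ isEquiv_comm_white_zinb.isMorphism,
    congrArg (ass K).gen lieToAss_ant, congrArg (comm K).gen assToComm_dot,
    congrArg (dend K).gen preLieToDend_dot, congrArg (zinb K).gen dendToZinb_dot_zero,
    congrArg (zinb K).gen dendToZinb_dot_one,
    fun z => congrArg (fun e => ((ass K).white (zinb K)).gen
      (TensorProduct.tmul K (M := (ass K).E) e z)) lieToAss_ant,
    fun z => congrArg (fun e => ((comm K).white (zinb K)).gen
      (TensorProduct.tmul K (M := (comm K).E) e z)) assToComm_dot,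
    isEquiv_lie_white_zinb.isIso, isEquiv_ass_white_zinb.isIso, isEquiv_comm_white_zinb.isIso,
    congrArg (preLie K).gen lieWhiteEquiv_ant_dot, congrArg (dend K).gen assWhiteEquiv_dot_dot,
    congrArg (dend K).gen assWhiteEquiv_dot_op, congrArg (zinb K).gen commWhiteEquiv_com_dot,
    fun X _ t => ?_, fun X _ t => ?_⟩
  · rintro _ rfl
    exact negOpEquiv_dot
  · rintro _ (rfl | rfl)
    exacts [cupEquiv_dot, cupEquiv_op_dot]
  · rintro _ rfl
    exact negOpEquiv_dot
  · rintro _ rfl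
    exact negOpEquiv_dot
  · rintro _ rfl
    exact antComEquiv_ant
  · rintro _ (rfl | rfl)
    exacts [poisEquiv_com, poisEquiv_ant]
  · rintro _ rfl
    exact negOpEquiv_dot
  -- Both ways around the square are induced by the same map of generators `h`, one by definition
  -- and the other by `assWhiteEquiv_lieToAss`.
  · have h := isMorphism_preLieToDend.comp (isEquiv_lie_white_zinb (K := K)).isMorphism
    exact (BinQuad.hom_hom isEquiv_lie_white_zinb.isMorphism isMorphism_preLieToDend h rfl X t).trans
      (BinQuad.hom_hom isMorphism_lie_white_zinb isEquiv_ass_white_zinb.isMorphism h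
        assWhiteEquiv_lieToAss X t).symm
  · have h := isMorphism_dendToZinb.comp (isEquiv_ass_white_zinb (K := K)).isMorphism
    exact (BinQuad.hom_hom isEquiv_ass_white_zinb.isMorphism isMorphism_dendToZinb h rfl X t).trans
      (BinQuad.hom_hom isMorphism_ass_white_zinb isEquiv_comm_white_zinb.isMorphism h
        commWhiteEquiv_assToComm X t).symm
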